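/- **Conventions.** Work over $k=\mathbb C$. Let $A$ be a unital algebra and $C$ a counital coalgebra with coproduct $\Delta(c)=c_1\otimes c_2$ and counit $\varepsilon$. An *entwining structure* $(A,C,\psi)$ is a linear map $\psi:C\otimes A\to A\otimes C$, written $\psi(c\otimes a)=a_\psi\otimes c^\psi$, such that $$(ab)_\psi\otimes c^\psi=a_\psi b_\psi\otimes {c^\psi}^\psi,\qquad a_\psi\otimes\Delta(c^\psi)={a_\psi}_\psi\otimes c_1^\psi\otimes c_2^\psi,\qquad a_\psi\,\varepsilon(c^\psi)=\varepsilon(c)a,\qquad 1_\psi\otimes c^\psi=1\otimes c .$$ For a non-unital algebra the last condition is dropped. Algebra morphisms are not required to be unital. For $n\ge 0$ let $\mathscr C^n(A,C,\psi)=\mathrm{Hom}(C\otimes A^{\otimes n+1},\mathbb C)$, with differential $$(\delta g)(c,a_1,\dots,a_{n+2})=g(c^\psi,a_2,\dots,a_{n+1},a_{n+2}a_{1\psi})+\sum_{i=1}^{n+1}(-1)^i g(c,a_1,\dots,a_ia_{i+1},\dots,a_{n+2}),$$ and let $\mathscr C^n_\lambda(A,C,\psi)$ be the subspace of those $g$ with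 $g(c,a_1,\dots,a_{n+1})=(-1)^n g(c^\psi,a_2,\dots,a_{n+1},a_{1\psi})$. Put $Z^n_\lambda=\mathscr C^n_\lambda\cap\ker\delta$ and $B^n_\lambda=\delta(\mathscr C^{n-1}_\lambda)$, with $\mathscr C^{-1}_\lambda=0$. An *$n$-dimensional entwined cycle* over $(A,C,\psi)$ is a tuple $((R^\bullet,D^\bullet),C,\Psi^\bullet,T,\rho)$ consisting of * a non-negatively graded, not necessarily unital dg-algebra $(R^\bullet,D^\bullet)$; * a linear map $\Psi^\bullet:C\otimes R^\bullet\to R^\bullet\otimes C$ of degree $0$ such that $(R,C,\Psi)$ is an entwining structure and $\Psi\circ(\mathrm{id}_C\otimes D)=(D\otimes\mathrm{id}_C)\circ\Psi$; * an algebra morphism $\rho:A\to R^0$ with $(\rho\otimes\mathrm{id}_C)\circ\psi=\Psi^0\circ(\mathrm{id}_C\otimes\rho)$; * a linear map $T:C\otimes R^n\to\mathbb C$ with $T(c\otimes D(r))=0$ for $r\in R^{n-1}$, and $T(c\otimes rr')=(-1)^{ij}T(c^\Psi\otimes r'r_\Psi)$ for $r\in R^i$, $r'\in R^j$, $i+j=n$.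 Its *character* is the element $g\in\mathscr C^n(A,C,\psi)$ given by $g(c\otimes a_1\otimes\cdots\otimes a_{n+1})=T\bigl(c\otimes\rho(a_1)D(\rho(a_2))\cdots D(\rho(a_{n+1}))\bigr)$. The cycle is *vanishing* if $R^0$ has a unit $1_{R^0}$, $\Psi^0(c\otimes 1_{R^0})=1_{R^0}\otimes c$ for all $c\in C$, and there exist an algebra morphism $\nu:R^0\to R^0$ with $(\nu\otimes\mathrm{id}_C)\circ\Psi^0=\Psi^0\circ(\mathrm{id}_C\otimes\nu)$ and a unit $X$ of $M_2(R^0)$ with $\Psi^0(c\otimes X)=X\otimes c$ for all $c\in C$ (where $\Psi^0$ is extended to matrices by $\Psi^0(c\otimes rE_{ij})=r_{\Psi}E_{ij}\otimes c^{\Psi}$), such that $$X\begin{pmatrix}r&0\\0&\nu(r)\end{pmatrix}X^{-1}=\begin{pmatrix}0&0\\0&\nu(r)\end{pmatrix}\qquad\text{for all } r\in R^0 .$$ **Theorem 7.6.** Let $(A,C,\psi)$ be an entwining structure over $\mathbb C$, let $n\ge 0$ and let $g\in Z^n_\lambda(A,C,\psi)$. Then the following are equivalent: 1. $g\in B^n_\lambda(A,C,\psi)$;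 2. $g$ is the character of an $n$-dimensional entwined vanishing cycle over $(A,C,\psi)$. -/

import Mathlib

open scoped TensorProduct

universe u v w

noncomputable section

/-! ### Compatibility of a linear map `C ⊗ M → M ⊗ C` with products, coproduct and counit

Sweedler-type notation: `ψ (c ⊗ m) = m_ψ ⊗ c^ψ`. -/

section Entwine

variable {k : Type*} [Field k] {C : Type*} [AddCommGroup C] [Module k C]
  {M N P : Type*} [AddCommGroup M] [Module k M] [AddCommGroup N] [Module k N]
  [AddCommGroup P] [Module k P]

/-- For a bilinear product `μ : M × N → P`, the map
`(μ ⊗ id) ∘ (id ⊗ ψN) ∘ (ψM ⊗ id) : C ⊗ (M ⊗ N) → P ⊗ C`,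
that is, `c ⊗ m ⊗ n ↦ m_ψ n_ψ ⊗ (c^ψ)^ψ`. -/
def entwineMul (μ : M →ₗ[k] N →ₗ[k] P) (ψM : C ⊗[k] M →ₗ[k] M ⊗[k] C)
    (ψN : C ⊗[k] N →ₗ[k] N ⊗[k] C) : C ⊗[k] (M ⊗[k] N) →ₗ[k] P ⊗[k] C :=
  LinearMap.rTensor C (TensorProduct.lift μ) ∘ₗ
    (TensorProduct.assoc k M N C).symm.toLinearMap ∘ₗ
    LinearMap.lTensor M ψN ∘ₗ
    (TensorProduct.assoc k M C N).toLinearMap ∘ₗ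
    LinearMap.rTensor N ψM ∘ₗ
    (TensorProduct.assoc k C M N).symm.toLinearMap

/-- `ψP (c ⊗ m n) = m_ψ n_ψ ⊗ (c^ψ)^ψ`. -/
def EntwineRespectsMul (μ : M →ₗ[k] N →ₗ[k] P) (ψM : C ⊗[k] M →ₗ[k] M ⊗[k] C)
    (ψN : C ⊗[k] N →ₗ[k] N ⊗[k] C) (ψP : C ⊗[k] P →ₗ[k] P ⊗[k] C) : Prop :=
  ψP ∘ₗ LinearMap.lTensor C (TensorProduct.lift μ) = entwineMul μ ψM ψN

/-- `m_ψ ⊗ Δ(c^ψ) = (m_ψ)_ψ ⊗ (c₁)^ψ ⊗ (c₂)^ψ`, i.e.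
`(id ⊗ Δ) ∘ ψ = (ψ ⊗ id) ∘ (id ⊗ ψ) ∘ (Δ ⊗ id)`. -/
def EntwineRespectsComul [Coalgebra k C] (ψ : C ⊗[k] M →ₗ[k] M ⊗[k] C) : Prop :=
  LinearMap.lTensor M (Coalgebra.comul (R := k) (A := C)) ∘ₗ ψ =
    (TensorProduct.assoc k M C C).toLinearMap ∘ₗ
      LinearMap.rTensor C ψ ∘ₗ
      (TensorProduct.assoc k C M C).symm.toLinearMap ∘ₗ
      LinearMap.lTensor C ψ ∘ₗ
      (TensorProduct.assoc k C C M).toLinearMap ∘ₗ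
      LinearMap.rTensor M (Coalgebra.comul (R := k) (A := C))

/-- `ε(c^ψ) m_ψ = ε(c) m`. -/
def EntwineRespectsCounit [Coalgebra k C] (ψ : C ⊗[k] M →ₗ[k] M ⊗[k] C) : Prop :=
  (TensorProduct.rid k M).toLinearMap ∘ₗ
      LinearMap.lTensor M (Coalgebra.counit (R := k) (A := C)) ∘ₗ ψ =
    (TensorProduct.lid k M).toLinearMap ∘ₗ
      LinearMap.rTensor M (Coalgebra.counit (R := k) (A := C))

end Entwine

/-! ### Entwining structures -/

/-- An entwining structure `(A, C, ψ)` on a not necessarily unital algebra `A`. -/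
structure NonUnitalEntwining (k : Type*) [Field k] (A : Type*) [NonUnitalRing A] [Module k A]
    [SMulCommClass k A A] [IsScalarTower k A A]
    (C : Type*) [AddCommGroup C] [Module k C] [Coalgebra k C] where
  /-- The entwining map `ψ`. -/
  map : C ⊗[k] A →ₗ[k] A ⊗[k] C
  respects_mul : EntwineRespectsMul (LinearMap.mul k A) map map map
  respects_comul : EntwineRespectsComul map
  respects_counit : EntwineRespectsCounit map

/-- An entwining structure `(A, C, ψ)` with `A` a unital algebra: moreover
`ψ (c ⊗ 1) = 1 ⊗ c`. -/
structure EntwiningStructure (k : Type*) [Field k] (A : Type*) [Ring A] [Algebra k A]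
    (C : Type*) [AddCommGroup C] [Module k C] [Coalgebra k C]
    extends NonUnitalEntwining k A C where
  map_one : ∀ c : C, map (c ⊗ₜ[k] (1 : A)) = (1 : A) ⊗ₜ[k] c

/-! ### Hochschild cochains and the cyclic complex -/

/-- `Hom (C ⊗ A^{⊗ (n+1)}, k)`, written through the universal property of the tensor product:
linear maps from `C` to the `(n+1)`-multilinear forms on `A`. -/
abbrev EntwinedCochain (k : Type*) [Field k] (A : Type*) [AddCommGroup A] [Module k A]
    (C : Type*) [AddCommGroup C] [Module k C] (n : ℕ) : Type _ :=
  C →ₗ[k] MultilinearMap k (fun _ : Fin (n + 1) => A) k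

namespace EntwinedCochain

section Module

variable {k : Type*} [Field k] {A : Type*} [AddCommGroup A] [Module k A]
  {C : Type*} [AddCommGroup C] [Module k C] {n : ℕ}

/-- For `F : A ⊗ C → {n-linear forms on A}`, the cochain
`(c, a₁, …, aₙ₊₁) ↦ F (a_{1ψ} ⊗ c^ψ) (a₂, …, aₙ₊₁)`. -/
def precompEntwining (ψ : C ⊗[k] A →ₗ[k] A ⊗[k] C)
    (F : A ⊗[k] C →ₗ[k] MultilinearMap k (fun _ : Fin n => A) k) :
    EntwinedCochain k A C n where
  toFun c := LinearMap.uncurryLeft (F ∘ₗ ψ ∘ₗ TensorProduct.mk k C A c)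
  map_add' c c' := by ext a; simp
  map_smul' r c := by ext a; simp

theorem precompEntwining_apply (ψ : C ⊗[k] A →ₗ[k] A ⊗[k] C)
    (F : A ⊗[k] C →ₗ[k] MultilinearMap k (fun _ : Fin n => A) k) (c : C) (a : Fin (n + 1) → A) :
    precompEntwining ψ F c a = F (ψ (c ⊗ₜ[k] a 0)) (Fin.tail a) := rfl

/-- `x ⊗ c ↦ ((a₁, …, aₙ) ↦ g (c, a₁, …, aₙ, x))`. -/
def insertLast (g : EntwinedCochain k A C n) :
    A ⊗[k] C →ₗ[k] MultilinearMap k (fun _ : Fin n => A) k :=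
  TensorProduct.lift (LinearMap.mk₂ k
    (fun x c =>
      MultilinearMap.mk' (fun a => g c (Fin.snoc a x))
        (fun a i y z => by
          rw [Fin.snoc_update, Fin.snoc_update, Fin.snoc_update, MultilinearMap.map_update_add])
        (fun a i r y => by
          rw [Fin.snoc_update, Fin.snoc_update, MultilinearMap.map_update_smul]))
    (fun x x' c => by ext a; simp [MultilinearMap.snoc_add])
    (fun r x c => by ext a; simp [MultilinearMap.snoc_smul])
    (fun x c c' => by ext a; simp)
    (fun r x c => by ext a; simp))

theorem insertLast_tmul (g : EntwinedCochain k A C n) (x : A) (c : C) (a : Fin n → A) :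
    g.insertLast (x ⊗ₜ[k] c) a = g c (Fin.snoc a x) := rfl

/-- The operator `(c, a₁, …, aₙ₊₁) ↦ g (c^ψ, a₂, …, aₙ₊₁, a_{1ψ})`. -/
def rotate (ψ : C ⊗[k] A →ₗ[k] A ⊗[k] C) :
    EntwinedCochain k A C n →ₗ[k] EntwinedCochain k A C n where
  toFun g := precompEntwining ψ g.insertLast
  map_add' g g' := by
    have h : (g + g').insertLast = g.insertLast + g'.insertLast :=
      TensorProduct.ext' fun x c => by ext a; simp [insertLast_tmul]
    ext c a
    simp [precompEntwining_apply, h]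
  map_smul' r g := by
    have h : (r • g).insertLast = r • g.insertLast :=
      TensorProduct.ext' fun x c => by ext a; simp [insertLast_tmul]
    ext c a
    simp [precompEntwining_apply, h]

end Module

section Algebra

variable {k : Type*} [Field k] {A : Type*} [NonUnitalRing A] [Module k A]
  [SMulCommClass k A A] [IsScalarTower k A A]
  {C : Type*} [AddCommGroup C] [Module k C] {n : ℕ}

/-- `x ⊗ c ↦ ((a₁, …, aₙ, aₙ₊₁) ↦ g (c, a₁, …, aₙ, aₙ₊₁ x))`. -/
def mulLast (g : EntwinedCochain k A C n) :
    A ⊗[k] C →ₗ[k] MultilinearMap k (fun _ : Fin (n + 1) => A) k :=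
  TensorProduct.lift (LinearMap.mk₂ k
    (fun x c =>
      MultilinearMap.mk' (fun a => g c (Function.update a (Fin.last n) (a (Fin.last n) * x)))
        (fun a i y z => by
          by_cases h : i = Fin.last n
          · subst h
            simp only [Function.update_self, Function.update_idem, add_mul,
              MultilinearMap.map_update_add]
          · simp only [Function.update_of_ne (Ne.symm h), Function.update_comm h,
              MultilinearMap.map_update_add])
        (fun a i r y => by
          by_cases h : i = Fin.last n
          · subst h
            simp only [Function.update_self, Function.update_idem, smul_mul_assoc,
              MultilinearMap.map_update_smul]
          · simp only [Function.update_of_ne (Ne.symm h), Function.update_comm h,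
              MultilinearMap.map_update_smul]))
    (fun x x' c => by ext a; simp [mul_add])
    (fun r x c => by ext a; simp [mul_smul_comm])
    (fun x c c' => by ext a; simp)
    (fun r x c => by ext a; simp))

theorem mulLast_tmul (g : EntwinedCochain k A C n) (x : A) (c : C) (a : Fin (n + 1) → A) :
    g.mulLast (x ⊗ₜ[k] c) a =
      g c (Function.update a (Fin.last n) (a (Fin.last n) * x)) := rfl

theorem contractNth_update (j : Fin (n + 1)) (a : Fin (n + 2) → A) (p : Fin (n + 2)) :
    ∃ (q : Fin (n + 1)) (l : A →ₗ[k] A), ∀ x,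
      Fin.contractNth j.castSucc (· * ·) (Function.update a p x) =
        Function.update (Fin.contractNth j.castSucc (· * ·) a) q (l x) := by
  have hj := j.isLt
  have hp := p.isLt
  rcases lt_trichotomy (p : ℕ) j with h | h | h
  · refine ⟨⟨p, by omega⟩, LinearMap.id, fun x => funext fun i => ?_⟩
    simp only [Fin.contractNth, Function.update_apply, Fin.ext_iff, Fin.val_castSucc,
      Fin.val_succ, LinearMap.id_apply]
    grind
  · refine ⟨j, LinearMap.mulRight k (a j.succ), fun x => funext fun i => ?_⟩
    simp only [Fin.contractNth, Function.update_apply, Fin.ext_iff, Fin.val_castSucc,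
      Fin.val_succ, LinearMap.mulRight_apply]
    grind
  · by_cases h' : (p : ℕ) = j + 1
    · refine ⟨j, LinearMap.mulLeft k (a j.castSucc), fun x => funext fun i => ?_⟩
      simp only [Fin.contractNth, Function.update_apply, Fin.ext_iff, Fin.val_castSucc,
        Fin.val_succ, LinearMap.mulLeft_apply]
      grind
    · refine ⟨⟨p - 1, by omega⟩, LinearMap.id, fun x => funext fun i => ?_⟩
      simp only [Fin.contractNth, Function.update_apply, Fin.ext_iff, Fin.val_castSucc,
        Fin.val_succ, LinearMap.id_apply]
      grind

/-- `(c, a₁, …, aₙ₊₂) ↦ g (c, a₁, …, a_i a_{i+1}, …, aₙ₊₂)`, where `i = j + 1`. -/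
def mulAt (j : Fin (n + 1)) (g : EntwinedCochain k A C n) : EntwinedCochain k A C (n + 1) where
  toFun c :=
    MultilinearMap.mk' (fun a => g c (Fin.contractNth j.castSucc (· * ·) a))
      (fun a p x y => by
        obtain ⟨q, l, h⟩ := contractNth_update (k := k) j a p
        simp only [h, map_add, MultilinearMap.map_update_add])
      (fun a p r x => by
        obtain ⟨q, l, h⟩ := contractNth_update (k := k) j a p
        simp only [h, map_smul, MultilinearMap.map_update_smul])
  map_add' c c' := by ext a; simp
  map_smul' r c := by ext a; simp

/-- The Hochschild differential
`(δ g)(c, a₁, …, aₙ₊₂) = g (c^ψ, a₂, …, aₙ₊₁, aₙ₊₂ a_{1ψ})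
  + ∑_{i = 1}^{n + 1} (-1)^i g (c, a₁, …, a_i a_{i+1}, …, aₙ₊₂)`. -/
def hochschildD (ψ : C ⊗[k] A →ₗ[k] A ⊗[k] C) (n : ℕ) :
    EntwinedCochain k A C n →ₗ[k] EntwinedCochain k A C (n + 1) where
  toFun g := precompEntwining ψ g.mulLast +
    ∑ j : Fin (n + 1), (-1 : k) ^ ((j : ℕ) + 1) • mulAt j g
  map_add' g g' := by
    have h : (g + g').mulLast = g.mulLast + g'.mulLast :=
      TensorProduct.ext' fun x c => by ext a; simp [mulLast_tmul]
    ext c a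
    simp [precompEntwining_apply, h, mulAt, mul_add, Finset.sum_add_distrib,
      LinearMap.sum_apply]
    abel
  map_smul' r g := by
    have h : (r • g).mulLast = r • g.mulLast :=
      TensorProduct.ext' fun x c => by ext a; simp [mulLast_tmul]
    ext c a
    simp [precompEntwining_apply, h, mulAt, Finset.mul_sum, LinearMap.sum_apply, mul_left_comm]

end Algebra

end EntwinedCochain

namespace NonUnitalEntwining

variable {k : Type*} [Field k] {A : Type*} [NonUnitalRing A] [Module k A]
  [SMulCommClass k A A] [IsScalarTower k A A]
  {C : Type*} [AddCommGroup C] [Module k C] [Coalgebra k C]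

/-- `C^n_λ(A, C, ψ)`: the cochains with
`g (c, a₁, …, aₙ₊₁) = (-1)^n g (c^ψ, a₂, …, aₙ₊₁, a_{1ψ})`. -/
def cyclicCochains (S : NonUnitalEntwining k A C) (n : ℕ) :
    Submodule k (EntwinedCochain k A C n) :=
  LinearMap.eqLocus LinearMap.id ((-1 : k) ^ n • EntwinedCochain.rotate S.map)

/-- `Z^n_λ(A, C, ψ)`. -/
def cyclicCocycles (S : NonUnitalEntwining k A C) (n : ℕ) :
    Submodule k (EntwinedCochain k A C n) :=
  S.cyclicCochains n ⊓ LinearMap.ker (EntwinedCochain.hochschildD S.map n)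

/-- `B^n_λ(A, C, ψ) = δ(C^{n-1}_λ(A, C, ψ))`, where `C^{-1}_λ = 0`. -/
def cyclicCoboundaries (S : NonUnitalEntwining k A C) :
    (n : ℕ) → Submodule k (EntwinedCochain k A C n)
  | 0 => ⊥
  | n + 1 => (S.cyclicCochains n).map (EntwinedCochain.hochschildD S.map n)

/-! ### Matrices and the vanishing condition -/

/-- The extension of `ψ` to matrices, `ψ (c ⊗ a E_{ij}) = a_ψ E_{ij} ⊗ c^ψ`. -/
def matrixMap (S : NonUnitalEntwining k A C) (r : ℕ) :
    C ⊗[k] Matrix (Fin r) (Fin r) A →ₗ[k] Matrix (Fin r) (Fin r) A ⊗[k] C :=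
  ∑ i : Fin r, ∑ j : Fin r,
    LinearMap.rTensor C (Matrix.singleLinearMap k i j) ∘ₗ S.map ∘ₗ
      LinearMap.lTensor C (Matrix.entryLinearMap k A i j)

/-- The algebra `A` has a unit `e` with `ψ (c ⊗ e) = e ⊗ c`, and there are a (not necessarily
unital) algebra endomorphism `ν` of `A` commuting with `ψ` and a unit `X` of `M₂(A)`, with inverse
`Y`, such that `ψ (c ⊗ X) = X ⊗ c` and `X diag(a, ν a) X⁻¹ = diag(0, ν a)` for all `a`. -/
def SatisfiesVanishing (S : NonUnitalEntwining k A C) : Prop :=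
  ∃ e : A, (∀ a : A, e * a = a ∧ a * e = a) ∧
    (∀ c : C, S.map (c ⊗ₜ[k] e) = e ⊗ₜ[k] c) ∧
    ∃ (ν : A →ₙₐ[k] A) (X Y : Matrix (Fin 2) (Fin 2) A),
      LinearMap.rTensor C (ν : A →ₗ[k] A) ∘ₗ S.map =
        S.map ∘ₗ LinearMap.lTensor C (ν : A →ₗ[k] A) ∧
      X * Y = !![e, 0; 0, e] ∧ Y * X = !![e, 0; 0, e] ∧
      (∀ c : C, S.matrixMap 2 (c ⊗ₜ[k] X) = X ⊗ₜ[k] c) ∧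
      ∀ a : A, X * !![a, 0; 0, ν a] * Y = !![0, 0; 0, ν a]

end NonUnitalEntwining

/-! ### Differential graded algebras and dg-entwinings -/

/-- A non-negatively graded, not necessarily unital differential graded algebra. The product
`R^i × R^j → R^n` is indexed by proofs of `i + j = n`, and the differential `R^i → R^j` by proofs
of `i + 1 = j`, so that no casts between homogeneous components are needed. -/
structure NonUnitalDGA (k : Type*) [Field k] where
  /-- The homogeneous components. -/
  obj : ℕ → Type w
  [addCommGroup : ∀ n, AddCommGroup (obj n)]
  [module : ∀ n, Module k (obj n)]
  /-- The product. -/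
  mul : ∀ {i j n : ℕ}, i + j = n → obj i →ₗ[k] obj j →ₗ[k] obj n
  mul_assoc : ∀ {i j l ij jl n : ℕ} (hij : i + j = ij) (hjl : j + l = jl)
    (h : ij + l = n) (h' : i + jl = n) (x : obj i) (y : obj j) (z : obj l),
    mul h (mul hij x y) z = mul h' x (mul hjl y z)
  /-- The differential. -/
  d : ∀ {i j : ℕ}, i + 1 = j → obj i →ₗ[k] obj j
  d_d : ∀ {i j l : ℕ} (h : i + 1 = j) (h' : j + 1 = l) (x : obj i), d h' (d h x) = 0
  leibniz : ∀ {i j n i' j' n' : ℕ} (h : i + j = n) (hi : i + 1 = i') (hj : j + 1 = j')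
    (hn : n + 1 = n') (h₁ : i' + j = n') (h₂ : i + j' = n') (x : obj i) (y : obj j),
    d hn (mul h x y) = mul h₁ (d hi x) y + (-1 : k) ^ i • mul h₂ x (d hj y)

namespace NonUnitalDGA

attribute [instance] NonUnitalDGA.addCommGroup NonUnitalDGA.module

variable {k : Type*} [Field k] (R : NonUnitalDGA.{w} k)

/-- The algebra `R^0`. -/
instance : NonUnitalRing (R.obj 0) where
  mul x y := R.mul (Nat.add_zero 0) x y
  left_distrib x y z := map_add (R.mul (Nat.add_zero 0) x) y z
  right_distrib x y z := LinearMap.map_add₂ (R.mul (Nat.add_zero 0)) x y z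
  zero_mul x := LinearMap.map_zero₂ (R.mul (Nat.add_zero 0)) x
  mul_zero x := map_zero (R.mul (Nat.add_zero 0) x)
  mul_assoc x y z := R.mul_assoc _ _ _ _ x y z

instance : IsScalarTower k (R.obj 0) (R.obj 0) where
  smul_assoc r x y := LinearMap.map_smul₂ (R.mul (Nat.add_zero 0)) r x y

instance : SMulCommClass k (R.obj 0) (R.obj 0) where
  smul_comm r x y := (map_smul (R.mul (Nat.add_zero 0) x) r y).symm

/-- `(r₀, …, rₙ) ↦ r₀ · D r₁ ⋯ D rₙ ∈ R^n` for `r₀, …, rₙ ∈ R^0`. -/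
def mulD : (n : ℕ) → (Fin (n + 1) → R.obj 0) → R.obj n
  | 0, r => r 0
  | n + 1, r => R.mul rfl (mulD n (Fin.init r)) (R.d (Nat.zero_add 1) (r (Fin.last (n + 1))))

end NonUnitalDGA

/-- A dg-entwining structure `((R, D), C, Ψ)`, with `Ψ` of degree zero given by its components
`Ψ^n : C ⊗ R^n → R^n ⊗ C`. -/
structure DGEntwining {k : Type*} [Field k] (R : NonUnitalDGA.{w} k)
    (C : Type*) [AddCommGroup C] [Module k C] [Coalgebra k C] where
  /-- The components of the entwining map. -/
  map : ∀ n, C ⊗[k] R.obj n →ₗ[k] R.obj n ⊗[k] C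
  map_d : ∀ {i j : ℕ} (h : i + 1 = j),
    LinearMap.rTensor C (R.d h) ∘ₗ map i = map j ∘ₗ LinearMap.lTensor C (R.d h)
  respects_mul : ∀ {i j n : ℕ} (h : i + j = n),
    EntwineRespectsMul (R.mul h) (map i) (map j) (map n)
  respects_comul : ∀ n, EntwineRespectsComul (map n)
  respects_counit : ∀ n, EntwineRespectsCounit (map n)

/-- The entwining structure `(R^0, C, Ψ^0)`. -/
def DGEntwining.degreeZero {k : Type*} [Field k] {R : NonUnitalDGA.{w} k}
    {C : Type*} [AddCommGroup C] [Module k C] [Coalgebra k C] (E : DGEntwining R C) :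
    NonUnitalEntwining k (R.obj 0) C where
  map := E.map 0
  respects_mul := E.respects_mul (Nat.add_zero 0)
  respects_comul := E.respects_comul 0
  respects_counit := E.respects_counit 0

/-! ### Entwined cycles -/

/-- An `n`-dimensional entwined cycle `((R, D), C, Ψ, T, ρ)` over `(A, C, ψ)`. -/
structure EntwinedCycle {k : Type*} [Field k] {A : Type u} [Ring A] [Algebra k A]
    {C : Type v} [AddCommGroup C] [Module k C] [Coalgebra k C]
    (S : EntwiningStructure k A C) (n : ℕ) where
  /-- The differential graded algebra. -/
  R : NonUnitalDGA.{w} k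
  /-- The dg-entwining. -/
  Ψ : DGEntwining R C
  /-- The (not necessarily unital) algebra morphism `A → R^0`. -/
  ρ : A →ₙₐ[k] R.obj 0
  ρ_comm : LinearMap.rTensor C (ρ : A →ₗ[k] R.obj 0) ∘ₗ S.map =
    Ψ.map 0 ∘ₗ LinearMap.lTensor C (ρ : A →ₗ[k] R.obj 0)
  /-- The closed graded entwined trace. -/
  T : C ⊗[k] R.obj n →ₗ[k] k
  T_closed : ∀ {i : ℕ} (h : i + 1 = n) (c : C) (r : R.obj i), T (c ⊗ₜ[k] R.d h r) = 0
  /-- `T (c ⊗ r r') = (-1)^{ij} T (c^Ψ ⊗ r' r_Ψ)`. -/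
  T_trace : ∀ {i j : ℕ} (h : i + j = n) (h' : j + i = n) (c : C) (r : R.obj i) (r' : R.obj j),
    T (c ⊗ₜ[k] R.mul h r r') =
      (-1 : k) ^ (i * j) *
        T (LinearMap.lTensor C (R.mul h' r')
          (TensorProduct.comm k (R.obj i) C (Ψ.map i (c ⊗ₜ[k] r))))

namespace EntwinedCycle

variable {k : Type*} [Field k] {A : Type u} [Ring A] [Algebra k A]
  {C : Type v} [AddCommGroup C] [Module k C] [Coalgebra k C]
  {S : EntwiningStructure k A C} {n : ℕ}

/-- `g` is the character of the cycle:
`g (c, a₁, …, aₙ₊₁) = T (c ⊗ ρ(a₁) D(ρ(a₂)) ⋯ D(ρ(aₙ₊₁)))`. -/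
def HasCharacter (Z : EntwinedCycle.{u, v, w} S n) (g : EntwinedCochain k A C n) : Prop :=
  ∀ (c : C) (a : Fin (n + 1) → A), g c a = Z.T (c ⊗ₜ[k] Z.R.mulD n (fun i => Z.ρ (a i)))

/-- The cycle is vanishing if `(R^0, C, Ψ^0)` is a unital entwining structure satisfying the
vanishing condition. -/
def IsVanishing (Z : EntwinedCycle.{u, v, w} S n) : Prop :=
  Z.Ψ.degreeZero.SatisfiesVanishing

end EntwinedCycle

end

/-! From vanishing cycles to coboundaries. The formula for the character makes sense for all
elements of `R⁰`, so the character is the pullback along `ρ` of a cyclic cocycle over `(R⁰, C, Ψ⁰)`.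
It is therefore enough that the vanishing condition turns every cyclic cocycle over `R⁰` into a
coboundary (`SatisfiesVanishing.cyclicCocycles_le`). The entries of `X` and `X⁻¹` supply invariant
elements `x, y, z, w` with `ν(a) x = x a`, `a y = y ν(a)`, `y x = 1` and `x y + z w = 1`, where `z`
and `w` commute with the image of `ν`. Inserting `x` into a cochain gives a homotopy from the
identity to the operator that applies `ν` to all variables but the last and `a ↦ x a y` to the last.
Inserting `z` gives one from the pullback `ν*` to the same operator with `z ν(a) w` in the last
variable. As `x a y + z ν(a) w = ν(a)`, the two targets add up to `ν*`, so the sum of the homotopies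
contracts the Hochschild complex.

To pass to cyclic cochains one compares with the complex in which the cyclic face is omitted;
inserting the unit contracts it. The usual argument needs care here, because the `(n+1)`-st power of
the cyclic operator on `n`-cochains is not the identity. All contractions must preserve the cochains
fixed by that power. They do, because the inserted elements are invariant and the maps applied to
the variables are equivariant. On such cochains the kernel of the norm is the image of `1 - λ` in
characteristic zero, and with `(1 - λ) b = b' (1 - λ)` and `b N = N b'` an induction on the degree
finishes (`ParacyclicModule.cyclic_acyclic`).

From coboundaries to vanishing cycles. Given `g = δ h`, let `V` be isomorphic to its countable power
and put `B = End(V) ⊗ A`, where `End(V)` is entwined trivially. A shift and a splitting of sequences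
generate a copy of the Cuntz relations in `End(V)`, and the operator that repeats `r` along a
sequence satisfies `N(r) = r ⊕ N(r)`; this swindle yields the vanishing condition for `B`. Adjoin
freely to `B` an element `E` of degree one. For invariant `f', g'` with `g' f' = 0` the element `F =
f' E g'` squares to zero, so the graded commutator with `F` is a differential. A cyclic `m`-cochain
`K` on `B` defines a closed graded trace of dimension `m + 1`, whose character on `B` is `δ` of the
cochain `K(c, g' b₁ f', …)` (`TensorTower.trace_baseMulD`). Finally `ρ(a) = p ⊗ a` with an
idempotent `p` such that `g' p f' = 1`, and `K` is the pullback of `h` along an equivariant linear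
map `B → A`; pulling back along `ρ` recovers `δ h`. -/

noncomputable section

/-! ### Entwining maps on elements -/

section Equivariance

variable {k : Type*} [Field k] {C : Type*} [AddCommGroup C] [Module k C]
  {M N P Q : Type*} [AddCommGroup M] [Module k M] [AddCommGroup N] [Module k N]
  [AddCommGroup P] [Module k P] [AddCommGroup Q] [Module k Q]

/-- `m ⊗ c ↦ μ(m, n_ψ) ⊗ c^ψ`. -/
def entwineStep (μ : M →ₗ[k] N →ₗ[k] P) (ψN : C ⊗[k] N →ₗ[k] N ⊗[k] C) (n : N) :
    M ⊗[k] C →ₗ[k] P ⊗[k] C :=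
  LinearMap.rTensor C (TensorProduct.lift μ) ∘ₗ
    (TensorProduct.assoc k M N C).symm.toLinearMap ∘ₗ
    LinearMap.lTensor M (ψN ∘ₗ (TensorProduct.mk k C N).flip n)

theorem entwineStep_tmul (μ : M →ₗ[k] N →ₗ[k] P) (ψN : C ⊗[k] N →ₗ[k] N ⊗[k] C) (n : N)
    (m : M) (c : C) :
    entwineStep μ ψN n (m ⊗ₜ[k] c) = LinearMap.rTensor C (μ m) (ψN (c ⊗ₜ[k] n)) := by
  simp only [entwineStep, LinearMap.comp_apply, LinearMap.lTensor_tmul, LinearMap.flip_apply,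
    TensorProduct.mk_apply]
  induction ψN (c ⊗ₜ[k] n) using TensorProduct.induction_on with
  | zero => simp
  | tmul x y => simp
  | add x y hx hy => simpa [TensorProduct.tmul_add] using congrArg₂ (· + ·) hx hy

theorem entwineMul_tmul (μ : M →ₗ[k] N →ₗ[k] P) (ψM : C ⊗[k] M →ₗ[k] M ⊗[k] C)
    (ψN : C ⊗[k] N →ₗ[k] N ⊗[k] C) (c : C) (m : M) (n : N) :
    entwineMul μ ψM ψN (c ⊗ₜ[k] (m ⊗ₜ[k] n)) = entwineStep μ ψN n (ψM (c ⊗ₜ[k] m)) := by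
  simp only [entwineMul, entwineStep, LinearMap.comp_apply, LinearEquiv.coe_coe,
    TensorProduct.assoc_symm_tmul, LinearMap.rTensor_tmul]
  congr 2
  induction ψM (c ⊗ₜ[k] m) using TensorProduct.induction_on with
  | zero => simp
  | tmul x y => simp
  | add x y hx hy => simpa [TensorProduct.add_tmul] using congrArg₂ (· + ·) hx hy

/-- Pure tensors suffice. Multiplicativity is used in this form, where `entwineStep` performs the
second of two successive entwinings. -/
theorem entwineRespectsMul_iff {μ : M →ₗ[k] N →ₗ[k] P} {ψM : C ⊗[k] M →ₗ[k] M ⊗[k] C}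
    {ψN : C ⊗[k] N →ₗ[k] N ⊗[k] C} {ψP : C ⊗[k] P →ₗ[k] P ⊗[k] C} :
    EntwineRespectsMul μ ψM ψN ψP ↔
      ∀ c m n, ψP (c ⊗ₜ[k] μ m n) = entwineStep μ ψN n (ψM (c ⊗ₜ[k] m)) := by
  constructor
  · intro h c m n
    have := LinearMap.congr_fun h (c ⊗ₜ[k] (m ⊗ₜ[k] n))
    rwa [entwineMul_tmul, LinearMap.comp_apply, LinearMap.lTensor_tmul,
      TensorProduct.lift.tmul] at this
  · intro h
    refine TensorProduct.ext' fun c x => ?_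
    induction x using TensorProduct.induction_on with
    | zero => simp
    | tmul m n =>
      rw [entwineMul_tmul, LinearMap.comp_apply, LinearMap.lTensor_tmul,
        TensorProduct.lift.tmul, h]
    | add x y hx hy => rw [TensorProduct.tmul_add, map_add, map_add, hx, hy]

/-- `f` commutes with the entwining maps: `ψ (c ⊗ f m) = f (m_ψ) ⊗ c^ψ`. -/
def EntwineEquivariant (ψM : C ⊗[k] M →ₗ[k] M ⊗[k] C) (ψN : C ⊗[k] N →ₗ[k] N ⊗[k] C)
    (f : M →ₗ[k] N) : Prop :=
  ∀ c m, ψN (c ⊗ₜ[k] f m) = LinearMap.rTensor C f (ψM (c ⊗ₜ[k] m))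

theorem entwineEquivariant_of_comp_eq {ψM : C ⊗[k] M →ₗ[k] M ⊗[k] C}
    {ψN : C ⊗[k] N →ₗ[k] N ⊗[k] C} {f : M →ₗ[k] N}
    (h : LinearMap.rTensor C f ∘ₗ ψM = ψN ∘ₗ LinearMap.lTensor C f) :
    EntwineEquivariant ψM ψN f := fun c m =>
  (LinearMap.congr_fun h (c ⊗ₜ[k] m)).symm

theorem EntwineEquivariant.comp_eq {ψM : C ⊗[k] M →ₗ[k] M ⊗[k] C}
    {ψN : C ⊗[k] N →ₗ[k] N ⊗[k] C} {f : M →ₗ[k] N} (h : EntwineEquivariant ψM ψN f) :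
    LinearMap.rTensor C f ∘ₗ ψM = ψN ∘ₗ LinearMap.lTensor C f :=
  TensorProduct.ext' fun c m => (h c m).symm

theorem EntwineEquivariant.comp {ψM : C ⊗[k] M →ₗ[k] M ⊗[k] C}
    {ψN : C ⊗[k] N →ₗ[k] N ⊗[k] C} {ψP : C ⊗[k] P →ₗ[k] P ⊗[k] C} {g : N →ₗ[k] P}
    {f : M →ₗ[k] N} (hg : EntwineEquivariant ψN ψP g) (hf : EntwineEquivariant ψM ψN f) :
    EntwineEquivariant ψM ψP (g ∘ₗ f) := fun c m => by
  rw [LinearMap.comp_apply, hg, hf, LinearMap.rTensor_comp, LinearMap.comp_apply]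

theorem EntwineEquivariant.id (ψM : C ⊗[k] M →ₗ[k] M ⊗[k] C) :
    EntwineEquivariant ψM ψM LinearMap.id := fun c m => by simp

/-- Multiplication on the left by an invariant element is equivariant. -/
theorem EntwineRespectsMul.equivariant_left {μ : M →ₗ[k] N →ₗ[k] P}
    {ψM : C ⊗[k] M →ₗ[k] M ⊗[k] C} {ψN : C ⊗[k] N →ₗ[k] N ⊗[k] C}
    {ψP : C ⊗[k] P →ₗ[k] P ⊗[k] C} (h : EntwineRespectsMul μ ψM ψN ψP) {m : M}
    (hm : ∀ c, ψM (c ⊗ₜ[k] m) = m ⊗ₜ[k] c) : EntwineEquivariant ψN ψP (μ m) := fun c n => by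
  rw [entwineRespectsMul_iff.1 h, hm, entwineStep_tmul]

/-- Multiplication on the right by an invariant element is equivariant. -/
theorem EntwineRespectsMul.equivariant_right {μ : M →ₗ[k] N →ₗ[k] P}
    {ψM : C ⊗[k] M →ₗ[k] M ⊗[k] C} {ψN : C ⊗[k] N →ₗ[k] N ⊗[k] C}
    {ψP : C ⊗[k] P →ₗ[k] P ⊗[k] C} (h : EntwineRespectsMul μ ψM ψN ψP) {n : N}
    (hn : ∀ c, ψN (c ⊗ₜ[k] n) = n ⊗ₜ[k] c) : EntwineEquivariant ψM ψP (μ.flip n) :=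
  fun c m => by
  rw [LinearMap.flip_apply, entwineRespectsMul_iff.1 h]
  induction ψM (c ⊗ₜ[k] m) using TensorProduct.induction_on with
  | zero => simp
  | tmul x y => rw [entwineStep_tmul, hn]; simp
  | add x y hx hy => rw [map_add, map_add, hx, hy]

end Equivariance

/-! ### Pullback of cochains, insertion of elements, and the cyclic operator -/

namespace EntwinedCochain

section Pullback

variable {k : Type*} [Field k] {C : Type*} [AddCommGroup C] [Module k C]
  {M N : Type*} [AddCommGroup M] [Module k M] [AddCommGroup N] [Module k N] {n : ℕ}

theorem rotate_apply (ψ : C ⊗[k] M →ₗ[k] M ⊗[k] C) (g : EntwinedCochain k M C n) (c : C)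
    (a : Fin (n + 1) → M) :
    rotate ψ g c a = g.insertLast (ψ (c ⊗ₜ[k] a 0)) (Fin.tail a) := rfl

/-- `(c, a₁, …, aₙ₊₁) ↦ g (c, f₁ a₁, …, fₙ₊₁ aₙ₊₁)`. -/
def pullback (f : Fin (n + 1) → M →ₗ[k] N) :
    EntwinedCochain k N C n →ₗ[k] EntwinedCochain k M C n where
  toFun g := MultilinearMap.compLinearMapₗ f ∘ₗ g
  map_add' g g' := by ext; simp
  map_smul' r g := by ext; simp

theorem pullback_apply (f : Fin (n + 1) → M →ₗ[k] N) (g : EntwinedCochain k N C n) (c : C)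
    (a : Fin (n + 1) → M) : pullback f g c a = g c fun i => f i (a i) := rfl

/-- Rotation carries the variable `i` to slot `i - 1`, where `0 - 1` is the last slot. Equivariance
allows the map met there by the first variable to be applied before entwining. -/
theorem rotate_pullback {ψM : C ⊗[k] M →ₗ[k] M ⊗[k] C} {ψN : C ⊗[k] N →ₗ[k] N ⊗[k] C}
    (f : Fin (n + 1) → M →ₗ[k] N) (hf : ∀ i, EntwineEquivariant ψM ψN (f i))
    (g : EntwinedCochain k N C n) :
    rotate ψM (pullback f g) = pullback (fun i => f (i - 1)) (rotate ψN g) := by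
  ext c a
  rw [rotate_apply, pullback_apply, rotate_apply, hf]
  induction ψM (c ⊗ₜ[k] a 0) using TensorProduct.induction_on with
  | zero => simp
  | tmul x y =>
    rw [LinearMap.rTensor_tmul, insertLast_tmul, insertLast_tmul, pullback_apply]
    congr 1
    funext i
    refine Fin.lastCases ?_ (fun j => ?_) i
    · have : (0 : Fin (n + 1)) - 1 = Fin.last n := by
        rw [sub_eq_iff_eq_add]; exact (Fin.last_add_one n).symm
      simp [this]
    · have : j.succ - 1 = j.castSucc := by
        rw [sub_eq_iff_eq_add]; exact (Fin.coeSucc_eq_succ).symm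
      simp [Fin.tail, this]
  | add x y hx hy => simp only [map_add, add_apply, hx, hy]

theorem rotate_pullback_const {ψM : C ⊗[k] M →ₗ[k] M ⊗[k] C} {ψN : C ⊗[k] N →ₗ[k] N ⊗[k] C}
    {f : M →ₗ[k] N} (hf : EntwineEquivariant ψM ψN f) (g : EntwinedCochain k N C n) :
    rotate ψM (pullback (fun _ => f) g) = pullback (fun _ => f) (rotate ψN g) :=
  rotate_pullback (fun _ => f) (fun _ => hf) g

theorem rotate_pow_pullback {ψM : C ⊗[k] M →ₗ[k] M ⊗[k] C} {ψN : C ⊗[k] N →ₗ[k] N ⊗[k] C}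
    (f : Fin (n + 1) → M →ₗ[k] N) (hf : ∀ i, EntwineEquivariant ψM ψN (f i))
    (g : EntwinedCochain k N C n) (r : ℕ) :
    (rotate ψM ^ r) (pullback f g) =
      pullback (fun i => f (i - r • (1 : Fin (n + 1)))) ((rotate ψN ^ r) g) := by
  induction r with
  | zero => simp
  | succ r ih =>
    rw [pow_succ', Module.End.mul_apply, ih, rotate_pullback _ (fun i => hf _), pow_succ',
      Module.End.mul_apply]
    congr 2
    funext i
    rw [succ_nsmul', sub_sub]

/-- After `n + 1` cyclic shifts each map is back in its slot, although the power of the rotation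
need not be the identity. -/
theorem rotate_pow_card_pullback {ψM : C ⊗[k] M →ₗ[k] M ⊗[k] C}
    {ψN : C ⊗[k] N →ₗ[k] N ⊗[k] C} (f : Fin (n + 1) → M →ₗ[k] N)
    (hf : ∀ i, EntwineEquivariant ψM ψN (f i)) (g : EntwinedCochain k N C n) :
    (rotate ψM ^ (n + 1)) (pullback f g) = pullback f ((rotate ψN ^ (n + 1)) g) := by
  have h : (n + 1) • (1 : Fin (n + 1)) = 0 := by
    simpa using card_nsmul_eq_zero (x := (1 : Fin (n + 1)))
  simp [rotate_pow_pullback f hf, h]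

/-- `(c, a₁, …, aₙ₊₁) ↦ g (c, a₁, …, x, …, aₙ₊₁)` with `x` in position `p`. -/
def insertAt (p : Fin (n + 2)) (x : M) :
    EntwinedCochain k M C (n + 1) →ₗ[k] EntwinedCochain k M C n where
  toFun g :=
    { toFun := fun c => (g c).curryMid p x
      map_add' := fun c c' => by ext; simp
      map_smul' := fun r c => by ext; simp }
  map_add' g g' := by ext; simp
  map_smul' r g := by ext; simp

theorem insertAt_apply (p : Fin (n + 2)) (x : M) (g : EntwinedCochain k M C (n + 1)) (c : C)
    (a : Fin (n + 1) → M) : insertAt p x g c a = g c (p.insertNth x a) := rfl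

theorem insertNth_apply_eq {α : Type*} (p : Fin (n + 1)) (x : α) (a : Fin n → α)
    (j : Fin (n + 1)) :
    (p.insertNth x a : Fin (n + 1) → α) j =
      if h : (j : ℕ) < p then a ⟨j, by omega⟩
      else if h' : (j : ℕ) = p then x else a ⟨j - 1, by omega⟩ := by
  revert j
  rw [← funext_iff, Fin.insertNth_eq_iff]
  refine ⟨by simp, funext fun i => ?_⟩
  have hi := i.isLt
  rcases lt_or_ge i.castSucc p with h | h
  · have h' : (i : ℕ) < p := h
    simp [Fin.removeNth, Fin.succAbove_of_castSucc_lt _ _ h, h']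
  · have h' : (p : ℕ) ≤ i := h
    simp [Fin.removeNth, Fin.succAbove_of_le_castSucc _ _ h, show ¬ (i : ℕ) + 1 < p by omega,
      show ¬ (i : ℕ) + 1 = p by omega]

/-- Rotation removes one variable in front of `x`, which stays where it is as long as it is not
itself the variable that is moved. -/
theorem rotate_insertAt_castSucc (ψ : C ⊗[k] M →ₗ[k] M ⊗[k] C) (p : Fin (n + 1)) (x : M)
    (g : EntwinedCochain k M C (n + 1)) :
    rotate ψ (insertAt p.castSucc x g) = insertAt p.succ x (rotate ψ g) := by
  ext c a
  rw [rotate_apply, insertAt_apply, rotate_apply]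
  have h0 : (p.succ.insertNth x a : Fin (n + 2) → M) 0 = a 0 := by
    simp [insertNth_apply_eq]
  rw [h0]
  induction ψ (c ⊗ₜ[k] a 0) using TensorProduct.induction_on with
  | zero => simp
  | tmul y d =>
    rw [insertLast_tmul, insertLast_tmul, insertAt_apply]
    congr 1
    funext i
    have hi := i.isLt
    have hp := p.isLt
    simp only [insertNth_apply_eq, Fin.snoc, Fin.tail, cast_eq]
    grind
  | add x y hx hy => simp only [map_add, add_apply, hx, hy]

theorem insertAt_last (ψ : C ⊗[k] M →ₗ[k] M ⊗[k] C) {x : M}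
    (hx : ∀ c, ψ (c ⊗ₜ[k] x) = x ⊗ₜ[k] c) (g : EntwinedCochain k M C (n + 1)) :
    insertAt (Fin.last (n + 1)) x g = insertAt 0 x (rotate ψ g) := by
  ext c a
  rw [insertAt_apply, insertAt_apply, rotate_apply, Fin.insertNth_last', Fin.insertNth_zero']
  simp [hx, insertLast_tmul]

theorem rotate_pow_insertAt (ψ : C ⊗[k] M →ₗ[k] M ⊗[k] C) (x : M) (r : ℕ) :
    ∀ (q : ℕ) (h : q + r < n + 2) (g : EntwinedCochain k M C (n + 1)),
      (rotate ψ ^ r) (insertAt ⟨q, by omega⟩ x g) =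
        insertAt ⟨q + r, h⟩ x ((rotate ψ ^ r) g) := by
  induction r with
  | zero => intros; rfl
  | succ r ih =>
    intro q h g
    rw [pow_succ', Module.End.mul_apply, ih q (by omega), pow_succ', Module.End.mul_apply]
    exact rotate_insertAt_castSucc ψ ⟨q + r, by omega⟩ x _

/-- A full turn of `n + 1` variables becomes a full turn of `n + 2` variables once the passage of
`x` from the end to the front is counted; that passage is free because `x` is invariant. -/
theorem rotate_pow_card_insertAt (ψ : C ⊗[k] M →ₗ[k] M ⊗[k] C) {x : M}
    (hx : ∀ c, ψ (c ⊗ₜ[k] x) = x ⊗ₜ[k] c) (p : Fin (n + 2))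
    (g : EntwinedCochain k M C (n + 1)) :
    (rotate ψ ^ (n + 1)) (insertAt p x g) = insertAt p x ((rotate ψ ^ (n + 2)) g) := by
  obtain ⟨q, hq⟩ := p
  -- `r` rotations bring `x` to the last slot, and `q` more return it to slot `q` after it has gone
  -- round to the front.
  obtain ⟨r, hr⟩ : ∃ r, q + r = n + 1 := ⟨n + 1 - q, by omega⟩
  have h₁ := rotate_pow_insertAt ψ x r q (by omega) g
  rw [show (⟨q + r, by omega⟩ : Fin (n + 2)) = Fin.last (n + 1) from Fin.ext hr,
    insertAt_last ψ hx] at h₁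
  have h₂ := rotate_pow_insertAt ψ x q 0 (by omega) (rotate ψ ((rotate ψ ^ r) g))
  simp only [zero_add] at h₂
  rw [show rotate ψ ^ (n + 1) = rotate (n := n) ψ ^ q * rotate ψ ^ r by rw [← pow_add, hr],
    Module.End.mul_apply, h₁]
  refine h₂.trans ?_
  rw [← Module.End.mul_apply, ← Module.End.mul_apply, ← pow_succ, ← pow_add,
    show q + 1 + r = n + 2 by omega]

end Pullback

end EntwinedCochain
end

noncomputable section

/-! ### Cyclic acyclicity from Hochschild acyclicity -/

/-- A sequence of modules with signed faces `ε i : V n → V (n + 1)`, `0 ≤ i ≤ n + 1`, and signed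
cyclic operators `l`, whose `(n + 1)`-st power on `V n` need not be the identity. -/
structure ParacyclicModule (k : Type*) [Field k] where
  obj : ℕ → Type*
  [addCommGroup : ∀ n, AddCommGroup (obj n)]
  [module : ∀ n, Module k (obj n)]
  face : ∀ n, ℕ → obj n →ₗ[k] obj (n + 1)
  cyc : ∀ n, obj n →ₗ[k] obj n
  cyc_face : ∀ n i, i ≤ n → ∀ x, cyc (n + 1) (face n i x) = face n (i + 1) (cyc n x)
  cyc_face_last : ∀ n x, cyc (n + 1) (face n (n + 1) x) = face n 0 x
  face_face_of_pos : ∀ n i j, 1 ≤ i → i ≤ j → j ≤ n + 1 → ∀ x,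
    face (n + 1) (j + 1) (face n i x) = -face (n + 1) i (face n j x)

namespace ParacyclicModule

attribute [instance] ParacyclicModule.addCommGroup ParacyclicModule.module

variable {k : Type*} [Field k] (V : ParacyclicModule k) {n : ℕ}

/-- The zeroth face is the cyclic operator applied to the last face, so the relations involving it
follow from those among faces of positive index. -/
theorem face_face (i j : ℕ) (hij : i ≤ j) (hj : j ≤ n + 1) (x : V.obj n) :
    V.face (n + 1) (j + 1) (V.face n i x) = -V.face (n + 1) i (V.face n j x) := by
  rcases Nat.eq_zero_or_pos i with rfl | hi
  · rcases Nat.eq_zero_or_pos j with rfl | hj'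
    · rw [← V.cyc_face_last n x, ← V.cyc_face (n + 1) 0 (by omega),
        ← V.cyc_face_last (n + 1) (V.cyc (n + 1) _), ← V.cyc_face_last (n + 1) (V.face n (n + 1) x),
        ← V.cyc_face (n + 1) (n + 1) le_rfl,
        V.face_face_of_pos n (n + 1) (n + 1) (by omega) le_rfl le_rfl]
      simp
    · obtain ⟨j, rfl⟩ : ∃ j', j = j' + 1 := ⟨j - 1, by omega⟩
      rw [← V.cyc_face_last n x, ← V.cyc_face (n + 1) (j + 1) (by omega),
        ← V.cyc_face_last (n + 1), V.face_face_of_pos n (j + 1) (n + 1) (by omega) hj le_rfl]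
      simp
  · exact V.face_face_of_pos n i j hi hij hj x

/-- The Hochschild differential. -/
def b (n : ℕ) : V.obj n →ₗ[k] V.obj (n + 1) := ∑ i ∈ Finset.Ico 0 (n + 2), V.face n i

/-- The differential with the zeroth face omitted. -/
def b' (n : ℕ) : V.obj n →ₗ[k] V.obj (n + 1) := ∑ i ∈ Finset.Ico 1 (n + 2), V.face n i

/-- The norm operator. -/
def norm (n : ℕ) : V.obj n →ₗ[k] V.obj n := ∑ i ∈ Finset.range (n + 1), V.cyc n ^ i

theorem b_eq (x : V.obj n) : V.b n x = V.face n 0 x + V.b' n x := by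
  rw [b, b', LinearMap.sum_apply, LinearMap.sum_apply,
    Finset.sum_eq_sum_Ico_succ_bot (by omega)]

/-- The terms `(j, i)` with `i < j` cancel against `(i, j - 1)`. The lower bound `m = 0` serves `b`
and `m = 1` serves `b'`. -/
theorem sum_face_sum_face (m : ℕ) (x : V.obj n) :
    ∑ j ∈ Finset.Ico m (n + 3), ∑ i ∈ Finset.Ico m (n + 2),
      V.face (n + 1) j (V.face n i x) = 0 := by
  rw [← Finset.sum_product',
    ← Finset.sum_filter_add_sum_filter_not _ (fun p : ℕ × ℕ => p.2 < p.1), add_eq_zero_iff_eq_neg,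
    ← Finset.sum_neg_distrib]
  refine Finset.sum_bij' (fun p _ => (p.2, p.1 - 1)) (fun p _ => (p.2 + 1, p.1)) ?_ ?_ ?_ ?_ ?_
  · simp only [Finset.mem_filter, Finset.mem_product, Finset.mem_Ico]; grind
  · simp only [Finset.mem_filter, Finset.mem_product, Finset.mem_Ico]; grind
  · simp only [Finset.mem_filter, Finset.mem_product, Finset.mem_Ico]; grind
  · simp only [Finset.mem_filter, Finset.mem_product, Finset.mem_Ico]; grind
  · rintro ⟨j, i⟩ h
    simp only [Finset.mem_filter, Finset.mem_product, Finset.mem_Ico] at h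
    obtain ⟨j, rfl⟩ : ∃ j', j = j' + 1 := ⟨j - 1, by omega⟩
    exact V.face_face i j (by omega) (by omega) x

theorem b_b (x : V.obj n) : V.b (n + 1) (V.b n x) = 0 := by
  simp only [b, LinearMap.sum_apply, map_sum]
  rw [Finset.sum_comm]
  exact V.sum_face_sum_face 0 x

theorem b'_b' (x : V.obj n) : V.b' (n + 1) (V.b' n x) = 0 := by
  simp only [b', LinearMap.sum_apply, map_sum]
  rw [Finset.sum_comm]
  exact V.sum_face_sum_face 1 x

theorem cyc_b (x : V.obj n) :
    V.cyc (n + 1) (V.b n x) = V.face n 0 x + V.b' n (V.cyc n x) := by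
  rw [b, b', LinearMap.sum_apply, LinearMap.sum_apply, map_sum]
  refine (Finset.sum_Ico_succ_top (Nat.zero_le (n + 1)) _).trans ?_
  rw [V.cyc_face_last, add_comm _ (V.face n 0 x), Finset.sum_Ico_eq_sum_range, Finset.sum_Ico_eq_sum_range]
  congr 1
  refine Finset.sum_congr rfl fun i hi => ?_
  rw [Finset.mem_range] at hi
  rw [zero_add, V.cyc_face n i (by omega), add_comm i 1]

/-- The cyclic operator raises the index of each face by one and sends the last face to the zeroth.
The zeroth face then occurs on both sides of the difference and cancels. -/
theorem b_sub_cyc_b (x : V.obj n) :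
    V.b n x - V.cyc (n + 1) (V.b n x) = V.b' n (x - V.cyc n x) := by
  rw [cyc_b, b_eq, map_sub]; abel

theorem cyc_pow_face (i r : ℕ) (h : i + r ≤ n + 1) (x : V.obj n) :
    (V.cyc (n + 1) ^ r) (V.face n i x) = V.face n (i + r) ((V.cyc n ^ r) x) := by
  induction r with
  | zero => rfl
  | succ r ih =>
    rw [pow_succ', Module.End.mul_apply, ih (by omega), V.cyc_face n _ (by omega), pow_succ',
      Module.End.mul_apply]
    rfl

/-- The step from the last face to the zeroth does not rotate the argument; hence the exponent `r -
1`. -/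
theorem cyc_pow_face_wrap (i r : ℕ) (hi : i ≤ n + 1) (hr : n + 2 ≤ i + r) (hr' : r ≤ n + 1)
    (x : V.obj n) :
    (V.cyc (n + 1) ^ r) (V.face n i x) =
      V.face n (i + r - (n + 2)) ((V.cyc n ^ (r - 1)) x) := by
  obtain ⟨s, rfl⟩ : ∃ s, r = s + 1 + (n + 1 - i) := ⟨i + r - (n + 2), by omega⟩
  rw [pow_add, Module.End.mul_apply, V.cyc_pow_face i _ (by omega), pow_succ,
    Module.End.mul_apply, show i + (n + 1 - i) = n + 1 by omega, V.cyc_face_last,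
    V.cyc_pow_face 0 s (by omega), ← Module.End.mul_apply, ← pow_add]
  congr 2
  · omega
  · congr 1; omega

/-- Both sides sum each pair (power of the cyclic operator, face) exactly once. The norm in degree
`n + 1` has one more term, which makes up for the face missing from `b'`. The reindexing adds the
power to the face index modulo `n + 2`. -/
theorem b_norm (x : V.obj n) : V.b n (V.norm n x) = V.norm (n + 1) (V.b' n x) := by
  simp only [b, norm, b', LinearMap.sum_apply, map_sum]
  rw [← Finset.sum_product', ← Finset.sum_product']
  symm
  refine Finset.sum_bij'
    (fun p _ => (if p.1 + p.2 ≤ n + 1 then p.2 else p.2 - 1,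
      if p.1 + p.2 ≤ n + 1 then p.1 + p.2 else p.1 + p.2 - (n + 2)))
    (fun p _ => (if p.1 < p.2 then p.2 - p.1 else p.2 + (n + 1) - p.1,
      if p.1 < p.2 then p.1 else p.1 + 1)) ?_ ?_ ?_ ?_ ?_
  · simp only [Finset.mem_product, Finset.mem_Ico, Finset.mem_range]; grind
  · simp only [Finset.mem_product, Finset.mem_Ico, Finset.mem_range]; grind
  · simp only [Finset.mem_product, Finset.mem_Ico, Finset.mem_range]; grind
  · simp only [Finset.mem_product, Finset.mem_Ico, Finset.mem_range]; grind
  · rintro ⟨i, r⟩ h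
    simp only [Finset.mem_product, Finset.mem_Ico, Finset.mem_range] at h
    dsimp only
    split_ifs with h'
    · exact V.cyc_pow_face i r (by omega) x
    · exact V.cyc_pow_face_wrap i r (by omega) (by omega) (by omega) x

/-- `x` is fixed by the `(n + 1)`-st power of the cyclic operator. -/
def IsInv (x : V.obj n) : Prop := (V.cyc n ^ (n + 1)) x = x

variable {V}

theorem IsInv.cyc_pow_eq {x : V.obj n} (hx : V.IsInv x) : (V.cyc n ^ (n + 1)) x = x := hx

theorem IsInv.sub {x y : V.obj n} (hx : V.IsInv x) (hy : V.IsInv y) : V.IsInv (x - y) := by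
  rw [IsInv, map_sub, hx, hy]

theorem IsInv.cyc {x : V.obj n} (hx : V.IsInv x) : V.IsInv (V.cyc n x) := by
  rw [IsInv, ← Module.End.mul_apply, ← pow_succ, pow_succ', Module.End.mul_apply, hx]

theorem cyc_pow_of_cyc {x : V.obj n} (hx : V.cyc n x = x) (r : ℕ) : (V.cyc n ^ r) x = x := by
  rw [Module.End.pow_apply]; exact Function.iterate_fixed hx r

theorem isInv_of_cyc {x : V.obj n} (hx : V.cyc n x = x) : V.IsInv x := cyc_pow_of_cyc hx _

/-- In `n + 2` rotations the face index runs once around, and only `n + 1` of them reach the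
argument. -/
theorem IsInv.face {x : V.obj n} (hx : V.IsInv x) (i : ℕ) (hi : i ≤ n + 1) :
    V.IsInv (V.face n i x) := by
  have h : (V.cyc (n + 1) ^ (n + 2)) (V.face n i x) = V.face n i ((V.cyc n ^ (n + 1)) x) := by
    rw [show n + 2 = i + 1 + (n + 1 - i) by omega, pow_add, Module.End.mul_apply,
      V.cyc_pow_face i _ (by omega), pow_succ, Module.End.mul_apply,
      show i + (n + 1 - i) = n + 1 by omega, V.cyc_face_last, V.cyc_pow_face 0 i (by omega),
      ← Module.End.mul_apply, ← pow_add, zero_add, show i + (n + 1 - i) = n + 1 by omega]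
  rw [IsInv, h, hx]

theorem IsInv.b' {x : V.obj n} (hx : V.IsInv x) : V.IsInv (V.b' n x) := by
  rw [IsInv, ParacyclicModule.b', LinearMap.sum_apply, map_sum]
  refine Finset.sum_congr rfl fun i hi => ?_
  rw [Finset.mem_Ico] at hi
  exact hx.face i (by omega)

theorem norm_of_cyc {x : V.obj n} (hx : V.cyc n x = x) : V.norm n x = (n + 1 : k) • x := by
  simp [norm, LinearMap.sum_apply, cyc_pow_of_cyc hx, ← Nat.cast_smul_eq_nsmul k]

theorem norm_sub_cyc {x : V.obj n} (hx : V.IsInv x) : V.norm n (x - V.cyc n x) = 0 := by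
  have h := congrArg (fun f : V.obj n →ₗ[k] V.obj n => f x) (geom_sum_mul_neg (V.cyc n) (n + 1))
  simp only [LinearMap.sub_apply, Module.End.one_apply, Module.End.mul_apply] at h
  rw [hx.cyc_pow_eq, sub_self] at h
  exact h

theorem cyc_norm {x : V.obj n} (hx : V.IsInv x) : V.cyc n (V.norm n x) = V.norm n x := by
  have h := congrArg (fun f : V.obj n →ₗ[k] V.obj n => f x) (mul_neg_geom_sum (V.cyc n) (n + 1))
  simp only [LinearMap.sub_apply, Module.End.one_apply, Module.End.mul_apply] at h
  rw [hx.cyc_pow_eq, sub_self, sub_eq_zero] at h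
  exact h.symm

/-- On invariant elements the kernel of the norm is the image of `1 - l`. -/
theorem exists_sub_cyc_of_norm_eq_zero [CharZero k] {x : V.obj n} (hx : V.IsInv x)
    (h : V.norm n x = 0) : ∃ y, V.IsInv y ∧ y - V.cyc n y = x := by
  -- Summation by parts. At `r = n + 1` the right side is `N x - (n + 1) x`, so when `N x = 0` the
  -- weighted sum divided by `-(n + 1)` is a preimage of `x` under `1 - λ`.
  have key : ∀ r : ℕ, ∑ i ∈ Finset.range r, (i + 1 : k) • ((V.cyc n ^ i) x - (V.cyc n ^ (i + 1)) x)
      = ∑ i ∈ Finset.range r, (V.cyc n ^ i) x - (r : k) • (V.cyc n ^ r) x := by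
    intro r
    induction r with
    | zero => simp
    | succ r ih =>
      rw [Finset.sum_range_succ, ih, Finset.sum_range_succ, Nat.cast_succ]
      module
  have hn : (n + 1 : k) ≠ 0 := by exact_mod_cast Nat.succ_ne_zero n
  refine ⟨-(n + 1 : k)⁻¹ • ∑ i ∈ Finset.range (n + 1), (i + 1 : k) • (V.cyc n ^ i) x, ?_, ?_⟩
  · rw [IsInv, map_smul, map_sum]
    congr 1
    refine Finset.sum_congr rfl fun i _ => ?_
    rw [map_smul, ← Module.End.mul_apply, ← pow_add, add_comm (n + 1), pow_add, Module.End.mul_apply,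
      hx.cyc_pow_eq]
  · rw [map_smul, map_sum, ← smul_sub, ← Finset.sum_sub_distrib]
    have := key (n + 1)
    rw [hx.cyc_pow_eq, ← LinearMap.sum_apply, ← norm, h] at this
    simp only [smul_sub, pow_succ', Module.End.mul_apply, zero_sub] at this
    simp only [map_smul, this, Nat.cast_succ, smul_neg, neg_smul, neg_neg]
    rw [smul_smul, inv_mul_cancel₀ hn, one_smul]

/-- If the Hochschild complex and the complex with differential `b'` of invariant elements are
acyclic, so is the cyclic complex. -/
theorem cyclic_acyclic [CharZero k]
    (hzero : ∀ x : V.obj 0, V.b 0 x = 0 → V.IsInv x → x = 0)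
    (hb : ∀ n (x : V.obj (n + 1)), V.b (n + 1) x = 0 → V.IsInv x → ∃ y, V.IsInv y ∧ V.b n y = x)
    (hb' : ∀ n (x : V.obj (n + 1)), V.b' (n + 1) x = 0 → V.IsInv x →
      ∃ y, V.IsInv y ∧ V.b' n y = x)
    (n : ℕ) (x : V.obj (n + 1)) (hx : V.cyc (n + 1) x = x) (hbx : V.b (n + 1) x = 0) :
    ∃ y, V.cyc n y = y ∧ V.b n y = x := by
  induction n using Nat.strong_induction_on with
  | _ n ih =>
    -- The Hochschild primitive `y` is invariant but perhaps not cyclic. It will be corrected by a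
    -- coboundary `b p` with `(1 - λ) b p = (1 - λ) y`.
    obtain ⟨y, hy, rfl⟩ := hb n x hbx (isInv_of_cyc hx)
    match n, ih, y, hy, hx with
    | 0, _, y, hy, _ =>
      exact ⟨y, by simpa [IsInv] using hy, rfl⟩
    | m + 1, ih, y, hy, hx =>
      have h₁ : V.b' (m + 1) (y - V.cyc (m + 1) y) = 0 := by
        rw [← V.b_sub_cyc_b, hx, sub_self]
      obtain ⟨z, hz, hzy⟩ := hb' m _ h₁ (hy.sub hy.cyc)
      have h₂ : V.b m (V.norm m z) = 0 := by rw [b_norm, hzy, norm_sub_cyc hy]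
      -- Since `(1 - λ) b p = b' (p - λ p)`, it is enough to replace `z` by an element of the form
      -- `p - λ p` modulo the kernel of `b'`. For this `N z` is used: it is a cyclic cocycle of
      -- lower degree.
      obtain ⟨p, hp, hpz⟩ : ∃ p, V.IsInv p ∧ V.b' m (p - V.cyc m p) = V.b' m z := by
        match m, z, hz, h₂, ih with
        | 0, z, hz, h₂, _ =>
          have : z = 0 := by
            have := hzero _ h₂ (isInv_of_cyc (cyc_norm hz))
            simpa [norm] using this
          exact ⟨0, by simp [IsInv], by simp [this]⟩
        | m + 1, z, hz, h₂, ih =>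
          -- With `N z = b q` and `q` cyclic, `q / (m + 1)` has norm `q`, so `z - b' (q / (m + 1))`
          -- has norm zero and lies in the image of `1 - λ`; the correction is killed by `b'`.
          obtain ⟨q, hq, hqz⟩ := ih m (by omega) _ (cyc_norm hz) h₂
          have hm : (m + 1 : k) ≠ 0 := by exact_mod_cast Nat.succ_ne_zero m
          have hq' : V.norm m ((m + 1 : k)⁻¹ • q) = q := by
            rw [map_smul, norm_of_cyc hq, smul_smul, inv_mul_cancel₀ hm, one_smul]
          obtain ⟨p, hp, hpz⟩ := exists_sub_cyc_of_norm_eq_zero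
            (x := z - V.b' m ((m + 1 : k)⁻¹ • q))
            (hz.sub (IsInv.b' (isInv_of_cyc (by rw [map_smul, hq]))))
            (by rw [map_sub, ← b_norm, hq', hqz, sub_self])
          exact ⟨p, hp, by rw [hpz, map_sub, b'_b', sub_zero]⟩
      refine ⟨y - V.b m p, ?_, by rw [map_sub, b_b, sub_zero]⟩
      rw [map_sub, eq_comm, ← sub_eq_zero]
      calc _ = y - V.cyc (m + 1) y - (V.b m p - V.cyc (m + 1) (V.b m p)) := by abel
        _ = 0 := by rw [b_sub_cyc_b, hpz, hzy, sub_self]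

end ParacyclicModule

end

noncomputable section

/-! ### The paracyclic module of cochains -/

namespace EntwinedCochain

section Faces

variable {k : Type*} [Field k] {A : Type*} [NonUnitalRing A] [Module k A]
  [SMulCommClass k A A] [IsScalarTower k A A]
  {C : Type*} [AddCommGroup C] [Module k C] {n : ℕ}

theorem mulAt_apply (j : Fin (n + 1)) (g : EntwinedCochain k A C n) (c : C)
    (a : Fin (n + 2) → A) :
    mulAt j g c a = g c (Fin.contractNth j.castSucc (· * ·) a) := rfl

/-- The cyclic face of the Hochschild differential, `(c, a₁, …) ↦ g (c^ψ, a₂, …, aₙ₊₂ a_{1ψ})`. -/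
def face₀ (ψ : C ⊗[k] A →ₗ[k] A ⊗[k] C) (n : ℕ) :
    EntwinedCochain k A C n →ₗ[k] EntwinedCochain k A C (n + 1) where
  toFun g := precompEntwining ψ g.mulLast
  map_add' g g' := by
    have h : (g + g').mulLast = g.mulLast + g'.mulLast :=
      TensorProduct.ext' fun x c => by ext a; simp [mulLast_tmul]
    ext c a
    simp [precompEntwining_apply, h]
  map_smul' r g := by
    have h : (r • g).mulLast = r • g.mulLast :=
      TensorProduct.ext' fun x c => by ext a; simp [mulLast_tmul]
    ext c a
    simp [precompEntwining_apply, h]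

theorem face₀_apply (ψ : C ⊗[k] A →ₗ[k] A ⊗[k] C) (g : EntwinedCochain k A C n) (c : C)
    (a : Fin (n + 2) → A) :
    face₀ ψ n g c a = g.mulLast (ψ (c ⊗ₜ[k] a 0)) (Fin.tail a) := rfl

/-- Multiplication of adjacent variables as a linear map of the cochain. -/
def mulAtₗ (j : Fin (n + 1)) : EntwinedCochain k A C n →ₗ[k] EntwinedCochain k A C (n + 1) where
  toFun g := mulAt j g
  map_add' g g' := by ext; simp [mulAt_apply]
  map_smul' r g := by ext; simp [mulAt_apply]

/-- The faces with sign: `face₀` in degree `0` and multiplication of adjacent variables in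
degrees `1, …, n + 1`. -/
def signedFace (ψ : C ⊗[k] A →ₗ[k] A ⊗[k] C) (n : ℕ) :
    ℕ → EntwinedCochain k A C n →ₗ[k] EntwinedCochain k A C (n + 1)
  | 0 => face₀ ψ n
  | j + 1 => if h : j < n + 1 then (-1 : k) ^ (j + 1) • mulAtₗ ⟨j, h⟩ else 0

theorem signedFace_zero (ψ : C ⊗[k] A →ₗ[k] A ⊗[k] C) (g : EntwinedCochain k A C n) :
    signedFace ψ n 0 g = face₀ ψ n g := rfl

theorem signedFace_succ (ψ : C ⊗[k] A →ₗ[k] A ⊗[k] C) (g : EntwinedCochain k A C n) (j : ℕ)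
    (h : j < n + 1) :
    signedFace ψ n (j + 1) g = (-1 : k) ^ (j + 1) • mulAt ⟨j, h⟩ g := by
  simp [signedFace, h, mulAtₗ]

theorem hochschildD_eq_sum (ψ : C ⊗[k] A →ₗ[k] A ⊗[k] C) (n : ℕ) :
    hochschildD ψ n = ∑ i ∈ Finset.Ico 0 (n + 2), signedFace (k := k) (C := C) ψ n i := by
  refine LinearMap.ext fun g => ?_
  rw [LinearMap.sum_apply, ← Finset.range_eq_Ico, Finset.sum_range_succ', Finset.sum_range]
  refine Eq.trans ?_ (add_comm _ _)
  change precompEntwining ψ g.mulLast + _ = precompEntwining ψ g.mulLast + _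
  congr 1
  refine Finset.sum_congr rfl fun j _ => ?_
  exact (signedFace_succ ψ g _ j.isLt).symm

theorem contractNth_contractNth (i j : ℕ) (hij : i ≤ j) (hj : j < n + 1) (a : Fin (n + 3) → A) :
    Fin.contractNth (⟨i, by omega⟩ : Fin (n + 2)) (· * ·)
        (Fin.contractNth (⟨j + 1, by omega⟩ : Fin (n + 3)) (· * ·) a) =
      Fin.contractNth (⟨j, by omega⟩ : Fin (n + 2)) (· * ·)
        (Fin.contractNth (⟨i, by omega⟩ : Fin (n + 3)) (· * ·) a) := by
  funext l
  have hl := l.isLt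
  simp only [Fin.contractNth, Fin.val_castSucc, Fin.val_succ]
  grind [mul_assoc]

theorem mulAt_mulAt (i j : ℕ) (hij : i ≤ j) (hj : j < n + 1) (g : EntwinedCochain k A C n) :
    mulAt ⟨j + 1, by omega⟩ (mulAt ⟨i, by omega⟩ g) =
      mulAt ⟨i, by omega⟩ (mulAt ⟨j, hj⟩ g) := by
  ext c a
  simp only [mulAt_apply]
  exact congrArg (g c) (contractNth_contractNth i j hij hj a)

theorem rotate_mulAt_castSucc (ψ : C ⊗[k] A →ₗ[k] A ⊗[k] C) (j : Fin n)
    (g : EntwinedCochain k A C n) :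
    rotate ψ (mulAt j.castSucc g) = mulAt j.succ (rotate ψ g) := by
  ext c a
  rw [rotate_apply, mulAt_apply, rotate_apply]
  have h0 : Fin.contractNth j.succ.castSucc (· * ·) a 0 = a 0 := by
    simp [Fin.contractNth]
  rw [h0]
  induction ψ (c ⊗ₜ[k] a 0) using TensorProduct.induction_on with
  | zero => simp
  | tmul y d =>
    rw [insertLast_tmul, insertLast_tmul, mulAt_apply]
    congr 1
    funext i
    have hi := i.isLt
    have hj := j.isLt
    simp only [Fin.contractNth, Fin.snoc, Fin.tail, cast_eq, Fin.val_castSucc, Fin.val_succ]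
    grind
  | add x y hx hy => simp only [map_add, add_apply, hx, hy]

/-- This exhibits the cyclic face as the next one in cyclic order after the products of neighbours.
-/
theorem rotate_mulAt_last (ψ : C ⊗[k] A →ₗ[k] A ⊗[k] C) (g : EntwinedCochain k A C n) :
    rotate ψ (mulAt (Fin.last n) g) = face₀ ψ n g := by
  ext c a
  rw [rotate_apply, face₀_apply]
  induction ψ (c ⊗ₜ[k] a 0) using TensorProduct.induction_on with
  | zero => simp
  | tmul y d =>
    rw [insertLast_tmul, mulLast_tmul, mulAt_apply]
    congr 1
    funext i
    have hi := i.isLt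
    simp only [Fin.contractNth, Fin.snoc, Fin.tail, cast_eq, Fin.val_castSucc, Fin.val_succ,
      Function.update_apply, Fin.val_last, Fin.ext_iff]
    grind
  | add x y hx hy => simp only [map_add, add_apply, hx, hy]

theorem insertLast_rTensor_mul (g : EntwinedCochain k A C n) (x : A) (z : A ⊗[k] C)
    (a : Fin n → A) :
    g.insertLast (LinearMap.rTensor C (LinearMap.mul k A x) z) a =
      g.mulLast z (Fin.snoc a x) := by
  induction z using TensorProduct.induction_on with
  | zero => simp
  | tmul y d =>
    rw [LinearMap.rTensor_tmul, insertLast_tmul, mulLast_tmul]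
    simp [Fin.update_snoc_last]
  | add x y hx hy => simp only [map_add, add_apply, hx, hy]

/-- Both sides end in a product of the first two variables, entwined one after the other on the left
and as a product on the right. This is the one relation of the paracyclic module that needs `ψ` to
be multiplicative. -/
theorem rotate_face₀ {ψ : C ⊗[k] A →ₗ[k] A ⊗[k] C}
    (hψ : EntwineRespectsMul (LinearMap.mul k A) ψ ψ ψ) (g : EntwinedCochain k A C n) :
    rotate ψ (face₀ ψ n g) = mulAt 0 (rotate ψ g) := by
  ext c a
  rw [rotate_apply, mulAt_apply, rotate_apply]
  have h0 : Fin.contractNth (Fin.castSucc 0) (· * ·) a 0 = LinearMap.mul k A (a 0) (a 1) := by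
    simp [Fin.contractNth]
  have h1 : Fin.tail (Fin.contractNth (Fin.castSucc 0) (· * ·) a) = Fin.tail (Fin.tail a) := by
    funext i
    simp [Fin.contractNth, Fin.tail]
  rw [h0, h1, entwineRespectsMul_iff.1 hψ]
  induction ψ (c ⊗ₜ[k] a 0) using TensorProduct.induction_on with
  | zero => simp
  | tmul y d =>
    rw [insertLast_tmul, entwineStep_tmul, insertLast_rTensor_mul, face₀_apply]
    congr 2
    funext i
    simp only [Fin.snoc, Fin.tail, cast_eq, Fin.val_succ]
    grind
  | add x y hx hy => simp only [map_add, add_apply, hx, hy]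

theorem rotate_signedFace {ψ : C ⊗[k] A →ₗ[k] A ⊗[k] C}
    (hψ : EntwineRespectsMul (LinearMap.mul k A) ψ ψ ψ) {i : ℕ} (hi : i ≤ n)
    (g : EntwinedCochain k A C n) :
    (-1 : k) ^ (n + 1) • rotate ψ (signedFace ψ n i g) =
      signedFace ψ n (i + 1) ((-1 : k) ^ n • rotate ψ g) := by
  cases i with
  | zero =>
    rw [signedFace_zero, rotate_face₀ hψ, map_smul, signedFace_succ _ _ 0 (by omega), smul_smul,
      ← pow_add]
    rfl
  | succ j =>
    have h := rotate_mulAt_castSucc ψ ⟨j, by omega⟩ g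
    simp only [Fin.castSucc_mk, Fin.succ_mk] at h
    rw [signedFace_succ _ _ j (by omega), map_smul, map_smul, signedFace_succ _ _ (j + 1) (by omega),
      smul_smul, smul_smul, ← pow_add, ← pow_add, h]
    congr 2
    omega

theorem rotate_signedFace_last (ψ : C ⊗[k] A →ₗ[k] A ⊗[k] C) (g : EntwinedCochain k A C n) :
    (-1 : k) ^ (n + 1) • rotate ψ (signedFace ψ n (n + 1) g) = signedFace ψ n 0 g := by
  have h := rotate_mulAt_last ψ g
  rw [signedFace_succ _ _ n (by omega), map_smul, smul_smul, ← mul_pow, neg_one_mul, neg_neg,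
    one_pow, one_smul, signedFace_zero, ← h]
  rfl

theorem signedFace_signedFace (ψ : C ⊗[k] A →ₗ[k] A ⊗[k] C) {i j : ℕ} (hi : 1 ≤ i) (hij : i ≤ j)
    (hj : j ≤ n + 1) (g : EntwinedCochain k A C n) :
    signedFace ψ (n + 1) (j + 1) (signedFace ψ n i g) =
      -signedFace ψ (n + 1) i (signedFace ψ n j g) := by
  obtain ⟨i, rfl⟩ : ∃ i', i = i' + 1 := ⟨i - 1, by omega⟩
  obtain ⟨j, rfl⟩ : ∃ j', j = j' + 1 := ⟨j - 1, by omega⟩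
  rw [signedFace_succ _ _ i (by omega), signedFace_succ _ _ j (by omega), map_smul, map_smul,
    signedFace_succ _ _ i (by omega), signedFace_succ _ _ (j + 1) (by omega),
    mulAt_mulAt i j (by omega) (by omega)]
  ext c a
  simp only [LinearMap.smul_apply, smul_apply, LinearMap.neg_apply, neg_apply, smul_eq_mul]
  ring

end Faces

end EntwinedCochain

namespace NonUnitalEntwining

open EntwinedCochain

variable {k : Type*} [Field k] {A : Type*} [NonUnitalRing A] [Module k A]
  [SMulCommClass k A A] [IsScalarTower k A A]
  {C : Type*} [AddCommGroup C] [Module k C] [Coalgebra k C] {n : ℕ}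

/-- The cochains of an entwining structure form a paracyclic module. -/
def paracyclic (S : NonUnitalEntwining k A C) : ParacyclicModule k where
  obj := EntwinedCochain k A C
  face := signedFace S.map
  cyc n := (-1 : k) ^ n • rotate S.map
  cyc_face _ _ hi g := rotate_signedFace S.respects_mul hi g
  cyc_face_last _ g := rotate_signedFace_last S.map g
  face_face_of_pos _ _ _ hi hij hj g := signedFace_signedFace S.map hi hij hj g

theorem paracyclic_b (S : NonUnitalEntwining k A C) (g : EntwinedCochain k A C n) :
    S.paracyclic.b n g = hochschildD S.map n g := by
  rw [hochschildD_eq_sum]; rfl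

theorem mem_cyclicCochains_iff (S : NonUnitalEntwining k A C) (g : EntwinedCochain k A C n) :
    g ∈ S.cyclicCochains n ↔ S.paracyclic.cyc n g = g := eq_comm

end NonUnitalEntwining

end

noncomputable section

/-! ### Contracting homotopies -/

/-- Here `s p i` stands for an insertion after a face and `h i p` for a face after an insertion,
signs included. Away from the pairs `(p, p)`, `(p, p + 1)` the two orders anticommute; along these
pairs the sum telescopes and only its two ends survive. -/
theorem sum_sum_of_homotopy_relations {W : Type*} [AddCommGroup W] (n : ℕ) (s h : ℕ → ℕ → W)
    (h_lt : ∀ p i, p ≤ n → i ≤ p → s (p + 1) i = -h i p)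
    (h_eq : ∀ p, p ≤ n → s (p + 1) (p + 1) = -s p (p + 1))
    (h_gt : ∀ p i, p < i → i ≤ n + 1 → s p (i + 1) = -h i p) :
    ∑ p ∈ Finset.range (n + 2), ∑ i ∈ Finset.range (n + 3), s p i =
      s 0 0 + s (n + 1) (n + 2) -
        ∑ i ∈ Finset.range (n + 2), ∑ p ∈ Finset.range (n + 1), h i p := by
  have hrow : ∀ p ∈ Finset.range (n + 2), ∑ i ∈ Finset.range (n + 3), s p i =
      ∑ i ∈ Finset.range p, s p i + (s p p + s p (p + 1)) +
        ∑ i ∈ Finset.Ico (p + 1) (n + 2), s p (i + 1) := by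
    intro p hp
    rw [Finset.mem_range] at hp
    rw [Finset.sum_Ico_add' (fun i => s p i), Finset.range_eq_Ico,
      ← Finset.sum_Ico_consecutive _ (Nat.zero_le p) (show p ≤ n + 3 by omega),
      ← Finset.sum_Ico_consecutive _ (show p ≤ p + 2 by omega) (show p + 2 ≤ n + 3 by omega),
      Finset.sum_Ico_succ_top (by omega), Finset.sum_Ico_succ_top (by omega), Finset.Ico_self,
      Finset.sum_empty, zero_add, add_assoc, add_assoc, add_assoc, Finset.range_eq_Ico]
  have hdiag : ∀ m, m ≤ n → ∑ p ∈ Finset.range (m + 2), (s p p + s p (p + 1)) =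
      s 0 0 + s (m + 1) (m + 2) := by
    intro m
    induction m with
    | zero =>
      intro hm
      rw [Finset.sum_range_succ, Finset.sum_range_one, h_eq 0 hm]
      abel
    | succ m ih =>
      intro hm
      rw [Finset.sum_range_succ, ih (by omega), h_eq (m + 1) hm]
      abel
  rw [Finset.sum_congr rfl hrow, Finset.sum_add_distrib, Finset.sum_add_distrib, hdiag n le_rfl,
    Finset.sum_range_succ' (fun p => ∑ i ∈ Finset.range p, s p i), Finset.sum_range_zero, add_zero,
    Finset.sum_range_succ (fun p => ∑ i ∈ Finset.Ico (p + 1) (n + 2), s p (i + 1)),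
    Finset.Ico_self, Finset.sum_empty, add_zero, Finset.sum_comm (t := Finset.range (n + 1)),
    add_comm (Finset.sum _ _) (s 0 0 + _), add_assoc, ← Finset.sum_add_distrib, sub_eq_add_neg,
    ← Finset.sum_neg_distrib]
  congr 1
  refine Finset.sum_congr rfl fun p hp => ?_
  rw [Finset.mem_range] at hp
  rw [Finset.range_eq_Ico, Finset.range_eq_Ico,
    ← Finset.sum_Ico_consecutive (fun i => h i p) (Nat.zero_le (p + 1))
    (show p + 1 ≤ n + 2 by omega), neg_add, ← Finset.sum_neg_distrib, ← Finset.sum_neg_distrib,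
    ← Finset.range_eq_Ico]
  congr 1
  · refine Finset.sum_congr rfl fun i hi => ?_
    rw [Finset.mem_range] at hi
    exact h_lt p i (by omega) (by omega)
  · refine Finset.sum_congr rfl fun i hi => ?_
    rw [Finset.mem_Ico] at hi
    exact h_gt p i (by omega) (by omega)

/-! ### Homotopies given by insertion of an invariant element -/

namespace EntwinedCochain

section Homotopy

variable {k : Type*} [Field k] {A : Type*} [NonUnitalRing A] [Module k A]
  [SMulCommClass k A A] [IsScalarTower k A A]
  {C : Type*} [AddCommGroup C] [Module k C] {n : ℕ}

theorem neg_smul_cochain (r : k) (g : EntwinedCochain k A C n) : (-r) • g = -(r • g) := by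
  ext
  simp

/-- The data for a homotopy between the pullbacks along two twisted homomorphisms, which inserts
the invariant element `u` that intertwines `f` and `ν`. -/
structure InsertionDatum (ψ : C ⊗[k] A →ₗ[k] A ⊗[k] C) where
  ν : A →ₗ[k] A
  f : A →ₗ[k] A
  l : A →ₗ[k] A
  u : A
  ν_equivariant : EntwineEquivariant ψ ψ ν
  f_equivariant : EntwineEquivariant ψ ψ f
  l_equivariant : EntwineEquivariant ψ ψ l
  u_invariant : ∀ c, ψ (c ⊗ₜ[k] u) = u ⊗ₜ[k] c
  ν_mul : ∀ a b, ν (a * b) = ν a * ν b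
  f_mul : ∀ a b, f (a * b) = f a * f b
  l_mul : ∀ a b, l (a * b) = l a * ν b
  l_mul' : ∀ a b, l (a * b) = f a * l b
  intertwine : ∀ a, ν a * u = u * f a

namespace InsertionDatum

variable {ψ : C ⊗[k] A →ₗ[k] A ⊗[k] C} (D : InsertionDatum ψ)

/-- The maps applied to the variables around the inserted element. -/
def family (n p : ℕ) (i : Fin (n + 1)) : A →ₗ[k] A :=
  if (i : ℕ) < p then D.ν else if (i : ℕ) = n then D.l else D.f

theorem family_equivariant (p : ℕ) (i : Fin (n + 1)) : EntwineEquivariant ψ ψ (D.family n p i) := by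
  unfold family
  split_ifs
  exacts [D.ν_equivariant, D.l_equivariant, D.f_equivariant]

/-- `(ν a₁, …, ν a_p, u, f a_{p+1}, …, f aₙ, l aₙ₊₁)`. -/
def args (p : Fin (n + 1)) (a : Fin (n + 1) → A) (j : Fin (n + 2)) : A :=
  if h : (j : ℕ) < p then D.ν (a ⟨j, by omega⟩)
  else if (j : ℕ) = p then D.u
  else if (j : ℕ) = n + 1 then D.l (a ⟨j - 1, by omega⟩)
  else D.f (a ⟨j - 1, by omega⟩)

/-- The cochain `(c, a₁, …, aₙ₊₁) ↦ g (c, ν a₁, …, ν a_p, u, f a_{p+1}, …, f aₙ, l aₙ₊₁)`. -/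
def insertion (p : Fin (n + 1)) :
    EntwinedCochain k A C (n + 1) →ₗ[k] EntwinedCochain k A C n :=
  pullback (D.family n p) ∘ₗ insertAt p.castSucc D.u

theorem insertion_apply (p : Fin (n + 1)) (g : EntwinedCochain k A C (n + 1)) (c : C)
    (a : Fin (n + 1) → A) : D.insertion p g c a = g c (D.args p a) := by
  refine congrArg (g c) (funext fun j => ?_)
  have hj := j.isLt
  have hp := p.isLt
  rw [insertNth_apply_eq]
  simp only [family, args, Fin.val_castSucc]
  split_ifs <;> first | rfl | omega

/-- Consequently the homotopy preserves the cochains fixed by a full turn, which the passage to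
cyclic cochains requires. -/
theorem rotate_pow_insertion (p : Fin (n + 1)) (g : EntwinedCochain k A C (n + 1)) :
    (rotate ψ ^ (n + 1)) (D.insertion p g) = D.insertion p ((rotate ψ ^ (n + 2)) g) := by
  rw [insertion, LinearMap.comp_apply, LinearMap.comp_apply,
    rotate_pow_card_pullback _ (D.family_equivariant p), rotate_pow_card_insertAt ψ D.u_invariant]

theorem args_contractNth_lt (p : Fin (n + 1)) (j : ℕ) (hj : j < p) (a : Fin (n + 2) → A) :
    Fin.contractNth (⟨j, by omega⟩ : Fin (n + 3)) (· * ·) (D.args p.succ a) =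
      D.args p (Fin.contractNth (⟨j, by omega⟩ : Fin (n + 2)) (· * ·) a) := by
  obtain ⟨p, hp⟩ := p
  simp only at hj
  funext i
  obtain ⟨i, hi⟩ := i
  simp only [args, Fin.contractNth, Fin.castSucc_mk, Fin.succ_mk]
  rcases lt_trichotomy i j with h | rfl | h
  · simp [h, show i < p + 1 by omega, show i < p by omega]
  · simp [hj, D.ν_mul, show i < p + 1 by omega]
  · obtain ⟨i, rfl⟩ : ∃ i', i = i' + 1 := ⟨i - 1, by omega⟩
    simp only [show ¬ i + 1 < j by omega, show i + 1 ≠ j by omega, if_false,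
      Nat.add_sub_cancel, add_lt_add_iff_right, add_left_inj]
    rcases lt_trichotomy (i + 1) p with h' | h' | h'
    · simp [h']
    · simp [h']
    · simp [show ¬ i + 1 < p by omega, show i + 1 ≠ p by omega, show ¬ i < j by omega,
        show i ≠ j by omega]

theorem insertion_mulAt_lt (p : Fin (n + 1)) (j : ℕ) (hj : j < p)
    (g : EntwinedCochain k A C (n + 1)) :
    D.insertion p.succ (mulAt ⟨j, by omega⟩ g) = mulAt ⟨j, by omega⟩ (D.insertion p g) := by
  ext c a
  rw [insertion_apply, mulAt_apply, mulAt_apply, insertion_apply]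
  exact congrArg (g c) (D.args_contractNth_lt p j hj a)

/-- One side contains `ν(a) u` and the other `u f(a)`. The variable `a` is never the last one, so
`l` does not intervene. -/
theorem insertion_mulAt_eq (p : Fin (n + 1)) (g : EntwinedCochain k A C (n + 1)) :
    D.insertion p.succ (mulAt p.castSucc g) = D.insertion p.castSucc (mulAt p.castSucc g) := by
  ext c a
  rw [insertion_apply, mulAt_apply, insertion_apply, mulAt_apply]
  congr 1
  funext i
  have hi := i.isLt
  have hp := p.isLt
  simp only [args, Fin.contractNth, Fin.val_castSucc, Fin.val_succ]
  have := D.intertwine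
  grind

theorem args_contractNth_gt (p : Fin (n + 1)) (j : ℕ) (hj : p ≤ j) (hj' : j < n + 1)
    (a : Fin (n + 2) → A) :
    Fin.contractNth (⟨j + 1, by omega⟩ : Fin (n + 3)) (· * ·) (D.args p.castSucc a) =
      D.args p (Fin.contractNth (⟨j, by omega⟩ : Fin (n + 2)) (· * ·) a) := by
  obtain ⟨p, hp⟩ := p
  simp only at hj
  funext i
  obtain ⟨i, hi⟩ := i
  simp only [args, Fin.contractNth, Fin.castSucc_mk, Fin.succ_mk]
  rcases lt_trichotomy i (j + 1) with h | rfl | h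
  · simp only [h, if_true]
    rcases lt_trichotomy i p with h' | h' | h'
    · simp [h', show i < j by omega]
    · simp [h']
    · simp [show ¬ i < p by omega, show i ≠ p by omega, show i ≠ n + 1 by omega,
        show i ≠ n + 1 + 1 by omega, show i - 1 < j by omega]
  · simp only [show ¬ j + 1 < p by omega, show ¬ j + 1 + 1 < p by omega, show j + 1 ≠ p by omega,
      show j + 1 + 1 ≠ p by omega, show j + 1 ≠ n + 1 + 1 by omega, lt_irrefl, if_false, if_true,
      dite_false, Nat.add_sub_cancel, add_left_inj]
    split_ifs
    · exact (D.l_mul' _ _).symm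
    · exact (D.f_mul _ _).symm
  · obtain ⟨i, rfl⟩ : ∃ i', i = i' + 1 := ⟨i - 1, by omega⟩
    simp [show ¬ i + 1 < p by omega, show i + 1 ≠ p by omega, show ¬ i < j by omega,
      show i ≠ j by omega, show ¬ i + 1 + 1 < p by omega, show i + 1 + 1 ≠ p by omega]

theorem insertion_mulAt_gt (p : Fin (n + 1)) (j : ℕ) (hj : p ≤ j) (hj' : j < n + 1)
    (g : EntwinedCochain k A C (n + 1)) :
    D.insertion p.castSucc (mulAt ⟨j + 1, by omega⟩ g) = mulAt ⟨j, hj'⟩ (D.insertion p g) := by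
  ext c a
  rw [insertion_apply, mulAt_apply, mulAt_apply, insertion_apply]
  exact congrArg (g c) (D.args_contractNth_gt p j hj hj' a)

/-- The cyclic face multiplies the last variable, under `l`, by the entwined first variable, under
`ν`. This is why `l` is required to be right linear along `ν`; its left linearity along `f` serves
the product of the last two variables. -/
theorem insertion_face₀ (p : Fin (n + 1)) (g : EntwinedCochain k A C (n + 1)) :
    D.insertion p.succ (face₀ ψ (n + 1) g) = face₀ ψ n (D.insertion p g) := by
  ext c a
  rw [insertion_apply, face₀_apply, face₀_apply]
  have h0 : D.args p.succ a 0 = D.ν (a 0) := by simp [args]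
  rw [h0, D.ν_equivariant]
  induction ψ (c ⊗ₜ[k] a 0) using TensorProduct.induction_on with
  | zero => simp
  | tmul y d =>
    rw [LinearMap.rTensor_tmul, mulLast_tmul, mulLast_tmul, insertion_apply]
    congr 1
    funext i
    have hi := i.isLt
    have hp := p.isLt
    simp only [args, Fin.tail, Fin.val_succ, Function.update_apply, Fin.val_last,
      Fin.ext_iff]
    have := D.l_mul
    grind
  | add x y hx hy => simp only [map_add, add_apply, hx, hy]

/-- The pullback along `f` with `a ↦ l a u` in the last variable. -/
def source (n : ℕ) : EntwinedCochain k A C n →ₗ[k] EntwinedCochain k A C n :=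
  pullback fun i => if (i : ℕ) = n then LinearMap.mulRight k D.u ∘ₗ D.l else D.f

/-- The pullback along `ν` with `a ↦ u l a` in the last variable. -/
def target (n : ℕ) : EntwinedCochain k A C n →ₗ[k] EntwinedCochain k A C n :=
  pullback fun i => if (i : ℕ) = n then LinearMap.mulLeft k D.u ∘ₗ D.l else D.ν

/-- With `u` in the first slot, the cyclic face carries it unchanged behind the last variable. -/
theorem insertion_zero_face₀ (g : EntwinedCochain k A C n) :
    D.insertion 0 (face₀ ψ n g) = D.source n g := by
  ext c a
  rw [insertion_apply, face₀_apply]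
  have h0 : D.args 0 a 0 = D.u := by simp [args]
  rw [h0, D.u_invariant, mulLast_tmul]
  refine congrArg (g c) (funext fun i => ?_)
  have hi := i.isLt
  simp only [args, Fin.tail, Fin.val_succ, Function.update_apply, Fin.val_last, Fin.ext_iff]
  have : ∀ a, (LinearMap.mulRight k D.u ∘ₗ D.l) a = D.l a * D.u := fun _ => rfl
  grind

theorem insertion_last_mulAt (g : EntwinedCochain k A C n) :
    D.insertion (Fin.last n) (mulAt (Fin.last n) g) = D.target n g := by
  ext c a
  rw [insertion_apply, mulAt_apply]
  refine congrArg (g c) (funext fun i => ?_)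
  have hi := i.isLt
  simp only [args, Fin.contractNth, Fin.val_castSucc, Fin.val_succ, Fin.val_last]
  have : ∀ a, (LinearMap.mulLeft k D.u ∘ₗ D.l) a = D.u * D.l a := fun _ => rfl
  grind

/-- The insertions with sign. -/
def signedInsertion (n p : ℕ) : EntwinedCochain k A C (n + 1) →ₗ[k] EntwinedCochain k A C n :=
  if h : p < n + 1 then (-1 : k) ^ p • D.insertion ⟨p, h⟩ else 0

theorem signedInsertion_apply {p : ℕ} (h : p < n + 1) (g : EntwinedCochain k A C (n + 1)) :
    D.signedInsertion n p g = (-1 : k) ^ p • D.insertion ⟨p, h⟩ g := by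
  simp [signedInsertion, h]

/-- The homotopy. -/
def homotopy (n : ℕ) : EntwinedCochain k A C (n + 1) →ₗ[k] EntwinedCochain k A C n :=
  ∑ p ∈ Finset.range (n + 1), D.signedInsertion n p

theorem signedInsertion_signedFace_lt {p i : ℕ} (hp : p ≤ n) (hi : i ≤ p)
    (g : EntwinedCochain k A C (n + 1)) :
    D.signedInsertion (n + 1) (p + 1) (signedFace ψ (n + 1) i g) =
      -signedFace ψ n i (D.signedInsertion n p g) := by
  rw [D.signedInsertion_apply (show p + 1 < n + 1 + 1 by omega),
    D.signedInsertion_apply (show p < n + 1 by omega), map_smul]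
  cases i with
  | zero =>
    have := D.insertion_face₀ ⟨p, by omega⟩ g
    rw [signedFace_zero, signedFace_zero, ← this, pow_succ, mul_neg_one]
    exact neg_smul_cochain _ _
  | succ j =>
    have := D.insertion_mulAt_lt ⟨p, by omega⟩ j hi g
    rw [signedFace_succ _ _ _ (show j < n + 1 + 1 by omega),
      signedFace_succ _ _ _ (show j < n + 1 by omega), map_smul, ← this, pow_succ, mul_neg_one]
    exact neg_smul_cochain _ _

theorem signedInsertion_signedFace_eq {p : ℕ} (hp : p ≤ n) (g : EntwinedCochain k A C (n + 1)) :
    D.signedInsertion (n + 1) (p + 1) (signedFace ψ (n + 1) (p + 1) g) =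
      -D.signedInsertion (n + 1) p (signedFace ψ (n + 1) (p + 1) g) := by
  have := D.insertion_mulAt_eq ⟨p, by omega⟩ g
  simp only [Fin.succ_mk, Fin.castSucc_mk] at this
  rw [D.signedInsertion_apply (show p + 1 < n + 1 + 1 by omega),
    D.signedInsertion_apply (show p < n + 1 + 1 by omega),
    signedFace_succ _ _ _ (show p < n + 1 + 1 by omega), map_smul, map_smul, this, pow_succ,
    mul_neg_one]
  exact neg_smul_cochain _ _

theorem signedInsertion_signedFace_gt {p i : ℕ} (hp : p < i) (hi : i ≤ n + 1)
    (g : EntwinedCochain k A C (n + 1)) :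
    D.signedInsertion (n + 1) p (signedFace ψ (n + 1) (i + 1) g) =
      -signedFace ψ n i (D.signedInsertion n p g) := by
  obtain ⟨j, rfl⟩ : ∃ j, i = j + 1 := ⟨i - 1, by omega⟩
  have := D.insertion_mulAt_gt ⟨p, by omega⟩ j (show p ≤ j by omega) (by omega) g
  simp only [Fin.castSucc_mk] at this
  rw [D.signedInsertion_apply (show p < n + 1 + 1 by omega),
    D.signedInsertion_apply (show p < n + 1 by omega), map_smul,
    signedFace_succ _ _ _ (show j + 1 < n + 1 + 1 by omega),
    signedFace_succ _ _ _ (show j < n + 1 by omega), map_smul, this, pow_succ _ (j + 1),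
    mul_neg_one, neg_smul_cochain]
  ext
  simp

theorem signedInsertion_zero_signedFace (g : EntwinedCochain k A C n) :
    D.signedInsertion n 0 (signedFace ψ n 0 g) = D.source n g := by
  rw [signedInsertion_apply _ (by omega), pow_zero, one_smul]
  exact D.insertion_zero_face₀ g

theorem signedInsertion_last_signedFace (g : EntwinedCochain k A C n) :
    D.signedInsertion n n (signedFace ψ n (n + 1) g) = -D.target n g := by
  rw [D.signedInsertion_apply (show n < n + 1 by omega),
    signedFace_succ _ _ _ (show n < n + 1 by omega), map_smul, smul_smul,
    ← D.insertion_last_mulAt g, ← pow_add, show n + (n + 1) = 2 * n + 1 by ring, pow_succ, pow_mul]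
  ext
  simp
  rfl

theorem hochschildD_homotopy (g : EntwinedCochain k A C (n + 1)) :
    hochschildD ψ n (D.homotopy n g) =
      D.source (n + 1) g - D.target (n + 1) g - D.homotopy (n + 1) (hochschildD ψ (n + 1) g) := by
  have h := sum_sum_of_homotopy_relations n
    (fun p i => D.signedInsertion (n + 1) p (signedFace ψ (n + 1) i g))
    (fun i p => signedFace ψ n i (D.signedInsertion n p g))
    (fun p i hp hi => D.signedInsertion_signedFace_lt hp hi g)
    (fun p hp => D.signedInsertion_signedFace_eq hp g)
    (fun p i hp hi => D.signedInsertion_signedFace_gt hp hi g)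
  rw [signedInsertion_zero_signedFace, signedInsertion_last_signedFace] at h
  simp only [hochschildD_eq_sum, homotopy, LinearMap.sum_apply, map_sum, ← Finset.range_eq_Ico] at h ⊢
  rw [Finset.sum_comm] at h
  refine Eq.trans ?_ (congrArg (_ - ·) h.symm)
  rw [Finset.sum_comm]
  abel

/-- In the lowest degree there is no cochain below, so only the two ends of the telescoping sum
remain. -/
theorem homotopy_hochschildD (g : EntwinedCochain k A C 0) :
    D.homotopy 0 (hochschildD ψ 0 g) = D.source 0 g - D.target 0 g := by
  rw [hochschildD_eq_sum, LinearMap.sum_apply, map_sum, ← Finset.range_eq_Ico,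
    Finset.sum_range_succ, Finset.sum_range_one, homotopy, Finset.sum_range_one,
    signedInsertion_zero_signedFace, signedInsertion_last_signedFace]
  exact (sub_eq_add_neg (D.source 0 g) (D.target 0 g)).symm

end InsertionDatum

end Homotopy

end EntwinedCochain

end

noncomputable section

/-! ### Vanishing of cyclic cohomology -/

namespace NonUnitalEntwining

open EntwinedCochain

variable {k : Type*} [Field k] {A : Type*} [NonUnitalRing A] [Module k A]
  [SMulCommClass k A A] [IsScalarTower k A A]
  {C : Type*} [AddCommGroup C] [Module k C] [Coalgebra k C] {n : ℕ}

/-- The accumulated sign has exponent `n (n + 1)`, which is even. -/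
theorem paracyclic_cyc_pow (S : NonUnitalEntwining k A C) (g : EntwinedCochain k A C n) :
    (S.paracyclic.cyc n ^ (n + 1)) g = (rotate S.map ^ (n + 1)) g := by
  change (((-1 : k) ^ n • rotate (n := n) S.map) ^ (n + 1)) g = _
  rw [smul_pow, ← pow_mul, (Nat.even_mul_succ_self n).neg_one_pow, one_smul]

theorem isInv_iff (S : NonUnitalEntwining k A C) (g : EntwinedCochain k A C n) :
    S.paracyclic.IsInv (n := n) g ↔ (rotate S.map ^ (n + 1)) g = g := by
  rw [← paracyclic_cyc_pow]; rfl

/-- The vanishing condition in terms of the entries of the intertwining unit. -/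
structure VanishingDatum (S : NonUnitalEntwining k A C) where
  e : A
  e_mul : ∀ a, e * a = a
  mul_e : ∀ a, a * e = a
  e_invariant : ∀ c, S.map (c ⊗ₜ[k] e) = e ⊗ₜ[k] c
  ν : A →ₗ[k] A
  ν_mul : ∀ a b, ν (a * b) = ν a * ν b
  ν_equivariant : EntwineEquivariant S.map S.map ν
  x : A
  y : A
  z : A
  w : A
  x_invariant : ∀ c, S.map (c ⊗ₜ[k] x) = x ⊗ₜ[k] c
  y_invariant : ∀ c, S.map (c ⊗ₜ[k] y) = y ⊗ₜ[k] c
  z_invariant : ∀ c, S.map (c ⊗ₜ[k] z) = z ⊗ₜ[k] c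
  w_invariant : ∀ c, S.map (c ⊗ₜ[k] w) = w ⊗ₜ[k] c
  ν_mul_x : ∀ a, ν a * x = x * a
  mul_y : ∀ a, a * y = y * ν a
  ν_mul_z : ∀ a, ν a * z = z * ν a
  ν_mul_w : ∀ a, ν a * w = w * ν a
  y_mul_x : y * x = e
  x_mul_y_add : x * y + z * w = e
  ν_mul_w_mul_z : ∀ a, ν a * (w * z) = ν a

theorem map_entry_of_matrixMap {S : NonUnitalEntwining k A C} {r : ℕ}
    {X : Matrix (Fin r) (Fin r) A} (hX : ∀ c : C, S.matrixMap r (c ⊗ₜ[k] X) = X ⊗ₜ[k] c)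
    (i j : Fin r) (c : C) : S.map (c ⊗ₜ[k] X i j) = X i j ⊗ₜ[k] c := by
  have h := congrArg (LinearMap.rTensor C (Matrix.entryLinearMap k A i j)) (hX c)
  rw [LinearMap.rTensor_tmul, matrixMap, LinearMap.sum_apply, map_sum,
    Finset.sum_eq_single i, LinearMap.sum_apply, map_sum, Finset.sum_eq_single j] at h
  · rw [LinearMap.comp_apply, LinearMap.comp_apply, LinearMap.lTensor_tmul,
      ← LinearMap.comp_apply, ← LinearMap.rTensor_comp] at h
    have h' : (Matrix.entryLinearMap k A i j) ∘ₗ (Matrix.singleLinearMap k i j) = LinearMap.id := by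
      ext; simp
    rw [h', LinearMap.rTensor_id] at h
    exact h
  · intro j' _ hj
    rw [LinearMap.comp_apply, ← LinearMap.comp_apply, ← LinearMap.rTensor_comp]
    have h' : (Matrix.entryLinearMap k A i j) ∘ₗ (Matrix.singleLinearMap k i j') = 0 := by
      ext; simp [hj]
    rw [h', LinearMap.rTensor_zero, LinearMap.zero_apply]
  · simp
  · intro i' _ hi
    rw [LinearMap.sum_apply, map_sum]
    refine Finset.sum_eq_zero fun j' _ => ?_
    rw [LinearMap.comp_apply, ← LinearMap.comp_apply, ← LinearMap.rTensor_comp]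
    have h' : (Matrix.entryLinearMap k A i j) ∘ₗ (Matrix.singleLinearMap k i' j') = 0 := by
      ext; simp [hi]
    rw [h', LinearMap.rTensor_zero, LinearMap.zero_apply]
  · simp

/-- All relations are entries of `X Y = 1`, `Y X = 1` and of the conjugation identity multiplied by
`X` on the right or by `Y` on the left. -/
theorem SatisfiesVanishing.exists_datum {S : NonUnitalEntwining k A C}
    (h : S.SatisfiesVanishing) : Nonempty S.VanishingDatum := by
  obtain ⟨e, he, hec, ν, X, Y, hν, hXY, hYX, hX, hconj⟩ := h
  have hE : ∀ M : Matrix (Fin 2) (Fin 2) A, M * !![e, 0; 0, e] = M := fun M => by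
    ext i j; fin_cases i <;> fin_cases j <;> simp [Matrix.mul_apply, Fin.sum_univ_two, he]
  have hE' : ∀ M : Matrix (Fin 2) (Fin 2) A, !![e, 0; 0, e] * M = M := fun M => by
    ext i j; fin_cases i <;> fin_cases j <;> simp [Matrix.mul_apply, Fin.sum_univ_two, he]
  have h₁ : ∀ a, X * !![a, 0; 0, ν a] = !![0, 0; 0, ν a] * X := fun a => by
    rw [← hconj, Matrix.mul_assoc, hYX, hE]
  have h₂ : ∀ a, !![a, 0; 0, ν a] * Y = Y * !![0, 0; 0, ν a] := fun a => by
    rw [← hconj, Matrix.mul_assoc, ← Matrix.mul_assoc Y, hYX, hE']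
  have entry : ∀ {M N : Matrix (Fin 2) (Fin 2) A}, M = N → ∀ i j, M i j = N i j := by
    rintro M _ rfl i j; rfl
  -- With this entry zero, the corner of `Y X = 1` reads `y x = e` without a further term.
  have hX0 : X 0 0 = 0 := by
    simpa [Matrix.mul_apply, Fin.sum_univ_two, he] using entry (h₁ e) 0 0
  have hXc := map_entry_of_matrixMap hX
  have hmul := fun (i j : Fin 2) (c : C) (b : A) =>
    S.respects_mul.equivariant_left (hXc i j) c b
  -- The inverse of an invariant matrix is invariant: left multiplication by `X` commutes with the
  -- entwining, so entwining `Y` and multiplying by `X` gives the identity, and multiplication by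
  -- `Y` on the left then isolates the entry.
  have hYc : ∀ (m l : Fin 2) (c : C), S.map (c ⊗ₜ[k] Y m l) = Y m l ⊗ₜ[k] c := by
    intro m l c
    have hcomp : ∀ a b z, LinearMap.rTensor C (LinearMap.mul k A (a * b)) z =
        LinearMap.rTensor C (LinearMap.mul k A a) (LinearMap.rTensor C (LinearMap.mul k A b) z) := by
      intro a b z
      rw [← LinearMap.comp_apply, ← LinearMap.rTensor_comp]
      congr 2
      ext x
      exact mul_assoc a b x
    have hone : LinearMap.mul k A e = LinearMap.id := by ext x; exact (he x).1
    have hrow : ∀ i, ∑ j, LinearMap.rTensor C (LinearMap.mul k A (X i j)) (S.map (c ⊗ₜ[k] Y j l)) =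
        (X * Y) i l ⊗ₜ[k] c := by
      intro i
      simp only [← hmul]
      rw [← map_sum, ← TensorProduct.tmul_sum]
      change S.map (c ⊗ₜ[k] ∑ j, X i j * Y j l) = _
      rw [← Matrix.mul_apply, hXY]
      fin_cases i <;> fin_cases l <;> simp [hec]
    have hid : ∑ i, LinearMap.rTensor C (LinearMap.mul k A (Y m i))
        (∑ j, LinearMap.rTensor C (LinearMap.mul k A (X i j)) (S.map (c ⊗ₜ[k] Y j l))) =
        ∑ j, LinearMap.rTensor C (LinearMap.mul k A ((Y * X) m j)) (S.map (c ⊗ₜ[k] Y j l)) := by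
      simp only [Fin.sum_univ_two, Matrix.mul_apply, map_add, LinearMap.rTensor_add,
        LinearMap.add_apply, hcomp]
      abel
    simp only [hrow, LinearMap.rTensor_tmul, LinearMap.mul_apply', hYX] at hid
    rw [← TensorProduct.sum_tmul, ← Matrix.mul_apply, hXY, hE] at hid
    rw [hid]
    fin_cases m <;> simp [hone]
  refine ⟨{
    e := e, e_mul := fun a => (he a).1, mul_e := fun a => (he a).2, e_invariant := hec
    ν := ν, ν_mul := fun a b => map_mul ν a b
    ν_equivariant := entwineEquivariant_of_comp_eq hν
    x := X 1 0, y := Y 0 1, z := X 1 1, w := Y 1 1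
    x_invariant := hXc _ _, y_invariant := hYc _ _, z_invariant := hXc _ _
    w_invariant := hYc _ _
    ν_mul_x := fun a => ?_, mul_y := fun a => ?_, ν_mul_z := fun a => ?_, ν_mul_w := fun a => ?_
    y_mul_x := ?_, x_mul_y_add := ?_, ν_mul_w_mul_z := fun a => ?_ }⟩
  · simpa [Matrix.mul_apply, Fin.sum_univ_two] using (entry (h₁ a) 1 0).symm
  · simpa [Matrix.mul_apply, Fin.sum_univ_two] using entry (h₂ a) 0 1
  · simpa [Matrix.mul_apply, Fin.sum_univ_two] using (entry (h₁ a) 1 1).symm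
  · simpa [Matrix.mul_apply, Fin.sum_univ_two] using entry (h₂ a) 1 1
  · simpa [Matrix.mul_apply, Fin.sum_univ_two, hX0] using entry hYX 0 0
  · simpa [Matrix.mul_apply, Fin.sum_univ_two] using entry hXY 1 1
  · have h₃ : ν a * Y 1 0 = 0 := by
      simpa [Matrix.mul_apply, Fin.sum_univ_two] using entry (h₂ a) 1 0
    -- The product `w z` need not be `e`, but the image of `ν` annihilates the other summand.
    have h₄ : Y 1 0 * X 0 1 + Y 1 1 * X 1 1 = e := by
      simpa [Matrix.mul_apply, Fin.sum_univ_two] using entry hYX 1 1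
    have h₅ := congrArg (ν a * ·) h₄
    simpa [mul_add, ← mul_assoc, h₃, he] using h₅

/-! ### Contraction of the Hochschild complex and of the complex without cyclic face -/

namespace VanishingDatum

variable {S : NonUnitalEntwining k A C}

/-- The homotopy from the identity to `a ↦ x a y`. -/
def insertX (V : S.VanishingDatum) : InsertionDatum S.map where
  ν := V.ν
  f := LinearMap.id
  l := LinearMap.mulRight k V.y
  u := V.x
  ν_equivariant := V.ν_equivariant
  f_equivariant := .id _
  l_equivariant := S.respects_mul.equivariant_right V.y_invariant
  u_invariant := V.x_invariant
  ν_mul := V.ν_mul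
  f_mul _ _ := rfl
  l_mul a b := by simp [mul_assoc, V.mul_y b]
  l_mul' a b := by simp [mul_assoc]
  intertwine := V.ν_mul_x

/-- The homotopy from `ν` to `a ↦ z ν(a) w`. -/
def insertZ (V : S.VanishingDatum) : InsertionDatum S.map where
  ν := V.ν
  f := V.ν
  l := LinearMap.mulRight k V.w ∘ₗ V.ν
  u := V.z
  ν_equivariant := V.ν_equivariant
  f_equivariant := V.ν_equivariant
  l_equivariant := .comp (S.respects_mul.equivariant_right V.w_invariant) V.ν_equivariant
  u_invariant := V.z_invariant
  ν_mul := V.ν_mul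
  f_mul := V.ν_mul
  l_mul a b := by simp [mul_assoc, V.ν_mul, V.ν_mul_w b]
  l_mul' a b := by simp [mul_assoc, V.ν_mul]
  intertwine := V.ν_mul_z

theorem source_insertX (V : S.VanishingDatum) (g : EntwinedCochain k A C n) : V.insertX.source n g = g := by
  ext c a
  refine congrArg (g c) (funext fun i => ?_)
  dsimp only
  split_ifs
  · simp [insertX, mul_assoc, V.y_mul_x, V.mul_e]
  · rfl

theorem source_insertZ (V : S.VanishingDatum) (g : EntwinedCochain k A C n) :
    V.insertZ.source n g = pullback (fun _ => V.ν) g := by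
  ext c a
  refine congrArg (g c) (funext fun i => ?_)
  dsimp only
  split_ifs
  · simp [insertZ, mul_assoc, V.ν_mul_w_mul_z]
  · rfl

/-- The two cochains differ only in the last variable, so they add there: `x a y + z ν(a) w = (x y +
z w) ν(a) = ν(a)`. -/
theorem target_add_target (V : S.VanishingDatum) (g : EntwinedCochain k A C n) :
    V.insertX.target n g + V.insertZ.target n g = pullback (fun _ => V.ν) g := by
  ext c a
  have h : ∀ (D : InsertionDatum S.map), D.target n g c a = g c
      (Function.update (fun i => D.ν (a i)) (Fin.last n) (D.u * D.l (a (Fin.last n)))) := by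
    intro D
    refine congrArg (g c) (funext fun i => ?_)
    by_cases hi : i = Fin.last n
    · subst hi; simp
    · have : (i : ℕ) ≠ n := fun h => hi (Fin.ext h)
      simp [hi, this]
  rw [LinearMap.add_apply, add_apply, h, h]
  refine (MultilinearMap.map_update_add (g c) (fun i => V.ν (a i)) (Fin.last n) _ _).symm.trans ?_
  refine congrArg (g c) (Function.update_eq_iff.2 ⟨?_, fun i hi => rfl⟩)
  change V.x * (a _ * V.y) + V.z * (V.ν (a _) * V.w) = V.ν (a _)
  rw [V.mul_y, ← mul_assoc, V.ν_mul_w, ← mul_assoc, ← add_mul, V.x_mul_y_add, V.e_mul]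

/-- On a cocycle the two homotopies give `g` minus one target and `ν* g` minus the other. The
targets sum to `ν* g`, so `g` alone is left. -/
theorem exists_hochschild_primitive (V : S.VanishingDatum) (g : EntwinedCochain k A C (n + 1))
    (hg : hochschildD S.map (n + 1) g = 0) (hinv : (rotate S.map ^ (n + 2)) g = g) :
    ∃ h, (rotate S.map ^ (n + 1)) h = h ∧ hochschildD S.map n h = g := by
  refine ⟨V.insertX.homotopy n g + V.insertZ.homotopy n g, ?_, ?_⟩
  · have hD : ∀ D : InsertionDatum S.map,
        (rotate S.map ^ (n + 1)) (D.homotopy n g) = D.homotopy n g := by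
      intro D
      rw [InsertionDatum.homotopy, LinearMap.sum_apply, map_sum]
      refine Finset.sum_congr rfl fun p hp => ?_
      rw [D.signedInsertion_apply (Finset.mem_range.1 hp), map_smul, D.rotate_pow_insertion, hinv]
    rw [map_add, hD, hD]
  · rw [map_add, InsertionDatum.hochschildD_homotopy, InsertionDatum.hochschildD_homotopy, hg,
      map_zero, map_zero, source_insertX, source_insertZ, ← target_add_target]
    have h : ∀ {W : Type _} [AddCommGroup W] (x y z : W), x - y - 0 + (y + z - z - 0) = x := by
      intros; abel
    exact h (W := EntwinedCochain k A C (n + 1)) _ _ _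

theorem eq_zero_of_hochschildD (V : S.VanishingDatum) (g : EntwinedCochain k A C 0) (hg : hochschildD S.map 0 g = 0) :
    g = 0 := by
  have h₁ := V.insertX.homotopy_hochschildD g
  have h₂ := V.insertZ.homotopy_hochschildD g
  rw [hg, map_zero, source_insertX] at h₁
  rw [hg, map_zero, source_insertZ, ← target_add_target] at h₂
  have h : ∀ {W : Type _} [AddCommGroup W] (x y z : W), 0 = x - y → 0 = y + z - z → x = 0 := by
    intro W _ x y z h h'
    rw [sub_eq_zero.1 h.symm, h', add_sub_cancel_right]
  exact h (W := EntwinedCochain k A C 0) _ _ _ h₁ h₂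

theorem insertAt_zero_e_mulAt_zero (V : S.VanishingDatum) (g : EntwinedCochain k A C n) :
    insertAt 0 V.e (mulAt 0 g) = g := by
  ext c a
  rw [insertAt_apply, mulAt_apply]
  refine congrArg (g c) (funext fun i => ?_)
  rw [Fin.insertNth_zero']
  refine Fin.cases ?_ (fun i => ?_) i <;> simp [Fin.contractNth, V.e_mul]

theorem insertAt_zero_mulAt_succ (x : A) (j : Fin (n + 1)) (g : EntwinedCochain k A C (n + 1)) :
    insertAt 0 x (mulAt j.succ g) = mulAt j (insertAt 0 x g) := by
  ext c a
  rw [insertAt_apply, mulAt_apply, mulAt_apply, insertAt_apply]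
  refine congrArg (g c) (funext fun i => ?_)
  rw [Fin.insertNth_zero', Fin.insertNth_zero']
  refine Fin.cases ?_ (fun i => ?_) i <;> simp [Fin.contractNth]

/-- Inserting the unit in front undoes the first product and lowers the index of every later one.
With the alternating signs, minus this insertion is a contracting homotopy for `b'`. -/
theorem exists_bar_primitive (V : S.VanishingDatum) (g : EntwinedCochain k A C (n + 1))
    (hg : S.paracyclic.b' (n + 1) g = 0) (hinv : (rotate S.map ^ (n + 2)) g = g) :
    ∃ h : EntwinedCochain k A C n,
      (rotate S.map ^ (n + 1)) h = h ∧ S.paracyclic.b' n h = g := by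
  refine ⟨(-1 : k) • insertAt 0 V.e g, ?_, ?_⟩
  · rw [map_smul, rotate_pow_card_insertAt S.map V.e_invariant, hinv]
  · have hface : ∀ j ∈ Finset.range (n + 1),
        insertAt 0 V.e (signedFace S.map (n + 1) (j + 1 + 1) g) =
          (-1 : k) • signedFace S.map n (j + 1) (insertAt 0 V.e g) := by
      intro j hj
      rw [Finset.mem_range] at hj
      have := insertAt_zero_mulAt_succ V.e ⟨j, hj⟩ g
      rw [signedFace_succ _ _ _ (show j + 1 < n + 1 + 1 by omega), signedFace_succ _ _ _ hj,
        map_smul, ← this, pow_succ' _ (j + 1), mul_smul]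
      rfl
    have h : ∑ i ∈ Finset.Ico 1 (n + 3), signedFace S.map (n + 1) i g = 0 :=
      (LinearMap.sum_apply _ _ _).symm.trans hg
    rw [Finset.sum_Ico_eq_sum_range] at h
    simp only [add_comm 1] at h
    change ∑ i ∈ Finset.range (n + 2), signedFace S.map (n + 1) (i + 1) g = 0 at h
    have h' := congrArg (insertAt 0 V.e) h
    rw [map_zero, map_sum, Finset.sum_range_succ', Finset.sum_congr rfl hface,
      signedFace_succ _ _ _ (show 0 < n + 1 + 1 by omega), map_smul] at h'
    replace h' : ∑ j ∈ Finset.range (n + 1),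
        (-1 : k) • signedFace S.map n (j + 1) (insertAt 0 V.e g) + (-1 : k) ^ (0 + 1) • g = 0 := by
      refine Eq.trans ?_ h'
      congr 2
      exact (V.insertAt_zero_e_mulAt_zero g).symm
    have hW : ∀ {W : Type _} [AddCommGroup W] [Module k W] (x y : W),
        x + (-1 : k) ^ (0 + 1) • y = 0 → x = y := by
      intro W _ _ x y h
      rwa [zero_add, pow_one, neg_one_smul, ← sub_eq_add_neg, sub_eq_zero] at h
    have hb : ∀ y : EntwinedCochain k A C n, S.paracyclic.b' n y =
        ∑ j ∈ Finset.range (n + 1), signedFace S.map n (j + 1) y := by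
      intro y
      refine (LinearMap.sum_apply _ _ _).trans ((Finset.sum_Ico_eq_sum_range _ _ _).trans ?_)
      simp only [add_comm 1]
      rfl
    refine (hb _).trans ?_
    simp only [map_smul]
    exact hW (W := EntwinedCochain k A C (n + 1)) _ _ h'

end VanishingDatum

/-- The vanishing condition implies the vanishing of cyclic cohomology. -/
theorem SatisfiesVanishing.cyclicCocycles_le [CharZero k] {S : NonUnitalEntwining k A C}
    (hS : S.SatisfiesVanishing) (n : ℕ) : S.cyclicCocycles n ≤ S.cyclicCoboundaries n := by
  obtain ⟨V⟩ := hS.exists_datum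
  rintro g ⟨hg, hbg⟩
  replace hbg : hochschildD S.map n g = 0 := hbg
  cases n with
  | zero => exact V.eq_zero_of_hochschildD g hbg
  | succ n =>
    obtain ⟨h, hh, hbh⟩ := S.paracyclic.cyclic_acyclic
      (fun x hx _ => V.eq_zero_of_hochschildD x ((S.paracyclic_b x).symm.trans hx))
      (fun n x hx hinv => by
        obtain ⟨y, hy, hby⟩ := V.exists_hochschild_primitive x ((S.paracyclic_b x).symm.trans hx)
          ((S.isInv_iff x).1 hinv)
        exact ⟨y, (S.isInv_iff y).2 hy, (S.paracyclic_b y).trans hby⟩)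
      (fun n x hx hinv => by
        obtain ⟨y, hy, hby⟩ := V.exists_bar_primitive x hx ((S.isInv_iff x).1 hinv)
        exact ⟨y, (S.isInv_iff y).2 hy, hby⟩)
      n g ((S.mem_cyclicCochains_iff g).1 hg) ((S.paracyclic_b g).trans hbg)
    exact ⟨h, (S.mem_cyclicCochains_iff h).2 hh, (S.paracyclic_b h).symm.trans hbh⟩

end NonUnitalEntwining

end

noncomputable section

/-! ### Characters of closed graded traces -/

namespace EntwinedCochain

variable {k : Type*} [Field k] {A B : Type*} [NonUnitalRing A] [Module k A]
  [SMulCommClass k A A] [IsScalarTower k A A] [NonUnitalRing B] [Module k B]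
  [SMulCommClass k B B] [IsScalarTower k B B]
  {C : Type*} [AddCommGroup C] [Module k C] {n : ℕ}

theorem hochschildD_apply (ψ : C ⊗[k] A →ₗ[k] A ⊗[k] C) (g : EntwinedCochain k A C n) (c : C)
    (a : Fin (n + 2) → A) :
    hochschildD ψ n g c a = g.mulLast (ψ (c ⊗ₜ[k] a 0)) (Fin.tail a) +
      ∑ j : Fin (n + 1), (-1 : k) ^ ((j : ℕ) + 1) * g c (Fin.contractNth j.castSucc (· * ·) a) := by
  simp [hochschildD, precompEntwining_apply, mulAt_apply, LinearMap.sum_apply]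

theorem hochschildD_pullback {ψA : C ⊗[k] A →ₗ[k] A ⊗[k] C} {ψB : C ⊗[k] B →ₗ[k] B ⊗[k] C}
    {f : A →ₗ[k] B} (hf : EntwineEquivariant ψA ψB f) (hmul : ∀ a b, f (a * b) = f a * f b)
    (g : EntwinedCochain k B C n) :
    hochschildD ψA n (pullback (fun _ => f) g) = pullback (fun _ => f) (hochschildD ψB n g) := by
  have h₀ : face₀ ψA n (pullback (fun _ => f) g) = pullback (fun _ => f) (face₀ ψB n g) := by
    ext c a
    rw [face₀_apply, pullback_apply, face₀_apply, hf]
    induction ψA (c ⊗ₜ[k] a 0) using TensorProduct.induction_on with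
    | zero => simp
    | tmul x d =>
      rw [LinearMap.rTensor_tmul, mulLast_tmul, mulLast_tmul, pullback_apply]
      refine congrArg (g d) (funext fun i => ?_)
      by_cases hi : i = Fin.last n
      · subst hi; simp [Fin.tail, hmul]
      · simp [Fin.tail, hi]
    | add x y hx hy => simp only [map_add, add_apply, hx, hy]
  have h₁ : ∀ j : Fin (n + 1), mulAt j (pullback (fun _ => f) g) =
      pullback (fun _ => f) (mulAt j g) := by
    intro j
    ext c a
    rw [mulAt_apply, pullback_apply, pullback_apply, mulAt_apply]
    refine congrArg (g c) (funext fun i => ?_)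
    simp only [Fin.contractNth]
    split_ifs
    exacts [rfl, hmul _ _, rfl]
  rw [hochschildD_eq_sum, hochschildD_eq_sum, LinearMap.sum_apply, LinearMap.sum_apply, map_sum]
  refine Finset.sum_congr rfl fun i hi => ?_
  rw [Finset.mem_Ico] at hi
  cases i with
  | zero => exact h₀
  | succ j =>
    rw [signedFace_succ _ _ _ (show j < n + 1 by omega),
      signedFace_succ _ _ _ (show j < n + 1 by omega), h₁, map_smul]

end EntwinedCochain

/-! ### Products of differentials of elements of degree zero -/

namespace NonUnitalDGA

variable {k : Type*} [Field k] (R : NonUnitalDGA.{w} k) {n : ℕ}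

theorem mulD_succ (r : Fin (n + 2) → R.obj 0) :
    R.mulD (n + 1) r =
      R.mul rfl (R.mulD n (Fin.init r)) (R.d (Nat.zero_add 1) (r (Fin.last (n + 1)))) := rfl

theorem mulD_update_add (r : Fin (n + 1) → R.obj 0) (i : Fin (n + 1)) (x y : R.obj 0) :
    R.mulD n (Function.update r i (x + y)) =
      R.mulD n (Function.update r i x) + R.mulD n (Function.update r i y) := by
  induction n with
  | zero =>
    obtain rfl : i = 0 := Fin.fin_one_eq_zero i
    simp [mulD]
  | succ n ih =>
    refine Fin.lastCases ?_ (fun j => ?_) i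
    · simp [mulD_succ, Fin.init_update_last]
    · simp [mulD_succ, Fin.init_update_castSucc, ih, Function.update_of_ne (Fin.castSucc_lt_last j).ne']

theorem mulD_update_smul (r : Fin (n + 1) → R.obj 0) (i : Fin (n + 1)) (s : k) (x : R.obj 0) :
    R.mulD n (Function.update r i (s • x)) = s • R.mulD n (Function.update r i x) := by
  induction n with
  | zero =>
    obtain rfl : i = 0 := Fin.fin_one_eq_zero i
    simp [mulD]
  | succ n ih =>
    refine Fin.lastCases ?_ (fun j => ?_) i
    · simp [mulD_succ, Fin.init_update_last]
    · simp [mulD_succ, Fin.init_update_castSucc, ih, Function.update_of_ne (Fin.castSucc_lt_last j).ne']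

/-- `(r₀, …, rₙ) ↦ r₀ · D r₁ ⋯ D rₙ` as a multilinear map. -/
def mulDₗ (n : ℕ) : MultilinearMap k (fun _ : Fin (n + 1) => R.obj 0) (R.obj n) :=
  MultilinearMap.mk' (R.mulD n) R.mulD_update_add R.mulD_update_smul

theorem mulD_snoc (r : Fin (n + 1) → R.obj 0) (x : R.obj 0) :
    R.mulD (n + 1) (Fin.snoc r x) = R.mul rfl (R.mulD n r) (R.d (Nat.zero_add 1) x) := by
  rw [mulD_succ, Fin.init_snoc, Fin.snoc_last]

/-- `r₀ · D r₁ ⋯ D rₙ₊₁ = r₀ · D (r₁ · D r₂ ⋯ D rₙ₊₁)`. -/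
theorem mulD_eq_mul_d (r : Fin (n + 2) → R.obj 0) :
    R.mulD (n + 1) r = R.mul (Nat.zero_add _) (r 0) (R.d rfl (R.mulD n (Fin.tail r))) := by
  induction n with
  | zero => rfl
  | succ n ih =>
    rw [mulD_succ, ih, R.mul_assoc (Nat.zero_add _) (l := 1) rfl rfl (Nat.zero_add _),
      R.mulD_succ (Fin.tail r),
      R.leibniz rfl rfl rfl rfl rfl rfl, R.d_d]
    simp
    rfl

theorem d_mul_degreeZero (x y : R.obj 0) :
    R.mul (Nat.add_zero 1) (R.d (Nat.zero_add 1) x) y =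
      R.d (Nat.zero_add 1) (x * y) -
        R.mul (Nat.zero_add 1) x (R.d (Nat.zero_add 1) y) := by
  have h := R.leibniz (Nat.add_zero 0) (Nat.zero_add 1) (Nat.zero_add 1) (Nat.zero_add 1)
    (Nat.add_zero 1) (Nat.zero_add 1) x y
  rw [pow_zero, one_smul] at h
  exact eq_sub_of_add_eq h.symm

/-- `r₀ · D r₁ ⋯ D rₙ · rₙ₊₁` as a combination of elements of the same form. -/
theorem mulD_mul (r : Fin (n + 2) → R.obj 0) :
    R.mul (Nat.add_zero n) (R.mulD n (Fin.init r)) (r (Fin.last (n + 1))) =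
      ∑ j : Fin (n + 1), (-1 : k) ^ (n - (j : ℕ)) •
        R.mulD n (Fin.contractNth j.castSucc (· * ·) r) := by
  induction n with
  | zero =>
    simp [mulD]
    rfl
  | succ n ih =>
    have h₁ : ∀ j : Fin (n + 1), Fin.contractNth j.castSucc.castSucc (· * ·) r =
        Fin.snoc (Fin.contractNth j.castSucc (· * ·) (Fin.init r)) (r (Fin.last (n + 2))) := by
      intro j
      funext i
      have hj := j.isLt
      refine Fin.lastCases ?_ (fun i => ?_) i
      · simp [Fin.contractNth, show ¬ n + 1 < (j : ℕ) by omega, show n + 1 ≠ (j : ℕ) by omega]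
      · simp [Fin.contractNth, Fin.init]
    have h₂ : Fin.contractNth (Fin.last (n + 1)).castSucc (· * ·) r =
        Fin.snoc (Fin.init (Fin.init r))
          (Fin.init r (Fin.last (n + 1)) * r (Fin.last (n + 2))) := by
      funext i
      refine Fin.lastCases ?_ (fun i => ?_) i
      · simp [Fin.contractNth, Fin.init]
      · simp [Fin.contractNth, Fin.init]
        intro h
        have := i.isLt
        omega
    -- By the Leibniz rule `D x · y = D (x y) - x · D y` at the right end, the first term is the new
    -- summand, and the second is the induction hypothesis followed by a differential.
    rw [Fin.sum_univ_castSucc, h₂]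
    simp only [h₁, mulD_snoc]
    rw [mulD_succ, R.mul_assoc (l := 0) rfl (Nat.add_zero 1) _ rfl, d_mul_degreeZero, map_sub,
      ← R.mul_assoc (Nat.add_zero n) (Nat.zero_add 1) rfl rfl, ih, map_sum, LinearMap.sum_apply,
      sub_eq_add_neg, ← Finset.sum_neg_distrib]
    refine (add_comm _ _).trans ?_
    congr 1
    · refine Finset.sum_congr rfl fun j _ => ?_
      have hj := j.isLt
      rw [Fin.val_castSucc, show n + 1 - (j : ℕ) = n - j + 1 by omega, pow_succ, mul_neg_one,
        neg_smul, map_smul, LinearMap.smul_apply]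
    · simp

end NonUnitalDGA

/-! ### The character of a cycle as a cyclic cocycle on the degree zero part -/

namespace EntwinedCycle

variable {k : Type*} [Field k] {A : Type u} [Ring A] [Algebra k A]
  {C : Type v} [AddCommGroup C] [Module k C] [Coalgebra k C]
  {S : EntwiningStructure k A C} {n : ℕ}

open EntwinedCochain

/-- The character of a cycle, as a cochain on `R⁰`. -/
def degreeZeroCharacter (Z : EntwinedCycle.{u, v, w} S n) :
    EntwinedCochain k (Z.R.obj 0) C n where
  toFun c := (Z.T ∘ₗ TensorProduct.mk k C (Z.R.obj n) c).compMultilinearMap (Z.R.mulDₗ n)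
  map_add' c c' := by ext; simp
  map_smul' r c := by ext; simp

theorem degreeZeroCharacter_apply (Z : EntwinedCycle.{u, v, w} S n) (c : C)
    (r : Fin (n + 1) → Z.R.obj 0) :
    Z.degreeZeroCharacter c r = Z.T (c ⊗ₜ[k] Z.R.mulD n r) := rfl

theorem HasCharacter.eq_pullback {Z : EntwinedCycle.{u, v, w} S n} {g : EntwinedCochain k A C n}
    (h : Z.HasCharacter g) :
    g = pullback (fun _ => (Z.ρ : A →ₗ[k] Z.R.obj 0)) Z.degreeZeroCharacter := by
  ext c a
  exact h c a

/-- `r ⊗ c ↦ T (c ⊗ r' r)`. -/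
def traceMulLeft (Z : EntwinedCycle.{u, v, w} S n) {i j : ℕ} (h : j + i = n) (r' : Z.R.obj j) :
    Z.R.obj i ⊗[k] C →ₗ[k] k :=
  Z.T ∘ₗ LinearMap.lTensor C (Z.R.mul h r') ∘ₗ (TensorProduct.comm k (Z.R.obj i) C).toLinearMap

theorem traceMulLeft_tmul (Z : EntwinedCycle.{u, v, w} S n) {i j : ℕ} (h : j + i = n)
    (r' : Z.R.obj j) (r : Z.R.obj i) (c : C) :
    Z.traceMulLeft h r' (r ⊗ₜ[k] c) = Z.T (c ⊗ₜ[k] Z.R.mul h r' r) := rfl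

theorem T_mul (Z : EntwinedCycle.{u, v, w} S n) {i j : ℕ} (h : i + j = n) (h' : j + i = n) (c : C)
    (r : Z.R.obj i) (r' : Z.R.obj j) :
    Z.T (c ⊗ₜ[k] Z.R.mul h r r') =
      (-1 : k) ^ (i * j) * Z.traceMulLeft h' r' (Z.Ψ.map i (c ⊗ₜ[k] r)) :=
  Z.T_trace h h' c r r'

/-- `T (c ⊗ D r · r') = (-1)^{j} T (c^Ψ ⊗ r' · D r_Ψ)` for `r ∈ R⁰`. -/
theorem T_d_mul (Z : EntwinedCycle.{u, v, w} S n) {j : ℕ} (h : 1 + j = n) (h' : j + 1 = n) (c : C)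
    (r : Z.R.obj 0) (r' : Z.R.obj j) :
    Z.T (c ⊗ₜ[k] Z.R.mul h (Z.R.d (Nat.zero_add 1) r) r') =
      (-1 : k) ^ j * Z.traceMulLeft h' r'
        (LinearMap.rTensor C (Z.R.d (Nat.zero_add 1)) (Z.Ψ.map 0 (c ⊗ₜ[k] r))) := by
  have hd := LinearMap.congr_fun (Z.Ψ.map_d (Nat.zero_add 1)) (c ⊗ₜ[k] r)
  rw [LinearMap.comp_apply, LinearMap.comp_apply, LinearMap.lTensor_tmul] at hd
  rw [Z.T_mul h h', one_mul, hd]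

/-- Integration by parts: `T (c ⊗ r · D r') = -T (c ⊗ D r · r')` for `r ∈ R⁰`. -/
theorem T_mul_d (Z : EntwinedCycle.{u, v, w} S n) {j : ℕ} (h : 1 + j = n) (h' : j + 1 = n) (c : C)
    (r : Z.R.obj 0) (r' : Z.R.obj j) :
    Z.T (c ⊗ₜ[k] Z.R.mul (Nat.zero_add n) r (Z.R.d h' r')) =
      -Z.T (c ⊗ₜ[k] Z.R.mul h (Z.R.d (Nat.zero_add 1) r) r') := by
  have := Z.T_closed h' c (Z.R.mul (Nat.zero_add j) r r')
  rw [Z.R.leibniz (Nat.zero_add j) (Nat.zero_add 1) h' h' h (Nat.zero_add n), pow_zero, one_smul,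
    TensorProduct.tmul_add, map_add] at this
  exact (neg_eq_of_add_eq_zero_right this).symm

/-- Write `r₀ D r₁ ⋯ D rₙ₊₁ = r₀ D ω`, move `D` onto `r₀` by closedness, and carry `D r₀` past `ω`
by the trace property. In positive dimension this needs no unit. -/
theorem rotate_degreeZeroCharacter (Z : EntwinedCycle.{u, v, w} S (n + 1)) :
    rotate (Z.Ψ.map 0) Z.degreeZeroCharacter = (-1 : k) ^ (n + 1) • Z.degreeZeroCharacter := by
  ext c a
  have h : ∀ z : Z.R.obj 0 ⊗[k] C, Z.degreeZeroCharacter.insertLast z (Fin.tail a) =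
      Z.traceMulLeft rfl (Z.R.mulD n (Fin.tail a))
        (LinearMap.rTensor C (Z.R.d (Nat.zero_add 1)) z) := by
    intro z
    induction z using TensorProduct.induction_on with
    | zero => simp
    | tmul x d =>
      rw [insertLast_tmul, degreeZeroCharacter_apply, NonUnitalDGA.mulD_snoc]
      rfl
    | add x y hx hy => simp only [map_add, add_apply, hx, hy]
  have h₁ : (-1 : k) ^ n * (-1 : k) ^ n = 1 := by rw [← mul_pow]; simp
  have h₂ := Z.T_d_mul (add_comm 1 n) rfl c (a 0) (Z.R.mulD n (Fin.tail a))
  have h₃ := Z.T_mul_d (add_comm 1 n) rfl c (a 0) (Z.R.mulD n (Fin.tail a))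
  rw [rotate_apply, h]
  change _ = (-1 : k) ^ (n + 1) * Z.degreeZeroCharacter c a
  rw [degreeZeroCharacter_apply, NonUnitalDGA.mulD_eq_mul_d, h₃, h₂, pow_succ]
  linear_combination (-Z.traceMulLeft rfl (Z.R.mulD n (Fin.tail a))
        (LinearMap.rTensor C (Z.R.d (Nat.zero_add 1)) (Z.Ψ.map 0 (c ⊗ₜ[k] a 0)))) * h₁

theorem hochschildD_degreeZeroCharacter_zero (Z : EntwinedCycle.{u, v, w} S 0) :
    hochschildD (Z.Ψ.map 0) 0 Z.degreeZeroCharacter = 0 := by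
  ext c a
  have h : ∀ z : Z.R.obj 0 ⊗[k] C, Z.degreeZeroCharacter.mulLast z (Fin.tail a) =
      Z.traceMulLeft (Nat.add_zero 0) (a 1) z := by
    intro z
    induction z using TensorProduct.induction_on with
    | zero => simp
    | tmul x d =>
      rw [mulLast_tmul, degreeZeroCharacter_apply, traceMulLeft_tmul]
      rfl
    | add x y hx hy => simp only [map_add, add_apply, hx, hy]
  have h' := Z.T_mul (Nat.add_zero 0) (Nat.add_zero 0) c (a 0) (a 1)
  rw [hochschildD_apply, h, Fin.sum_univ_one, degreeZeroCharacter_apply]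
  change _ + _ * Z.T (c ⊗ₜ[k] Z.R.mul (Nat.add_zero 0) (a 0) (a 1)) = 0
  rw [h']
  simp

/-- The differential of the product in the last slot splits by the Leibniz rule. -/
theorem mulLast_degreeZeroCharacter (Z : EntwinedCycle.{u, v, w} S (n + 1))
    (a : Fin (n + 2) → Z.R.obj 0) (z : Z.R.obj 0 ⊗[k] C) :
    Z.degreeZeroCharacter.mulLast z a =
      Z.traceMulLeft (Nat.add_zero (n + 1)) (Z.R.mulD (n + 1) a) z +
        Z.traceMulLeft rfl
          (Z.R.mul (Nat.add_zero n) (Z.R.mulD n (Fin.init a)) (a (Fin.last (n + 1))))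
          (LinearMap.rTensor C (Z.R.d (Nat.zero_add 1)) z) := by
  induction z using TensorProduct.induction_on with
  | zero => simp
  | tmul x d =>
    have h := Z.R.leibniz (Nat.add_zero 0) (Nat.zero_add 1) (Nat.zero_add 1) (Nat.zero_add 1)
      (Nat.add_zero 1) (Nat.zero_add 1) (a (Fin.last (n + 1))) x
    rw [pow_zero, one_smul] at h
    rw [mulLast_tmul, degreeZeroCharacter_apply, LinearMap.rTensor_tmul, traceMulLeft_tmul,
      traceMulLeft_tmul, NonUnitalDGA.mulD_succ, Fin.init_update_last, Function.update_self,
      NonUnitalDGA.mulD_succ, Z.R.mul_assoc (l := 0) rfl (Nat.add_zero 1) (Nat.add_zero _) rfl,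
      Z.R.mul_assoc (Nat.add_zero n) (Nat.zero_add 1) rfl rfl, ← map_add,
      ← TensorProduct.tmul_add, ← map_add, ← h]
    rfl
  | add x y hx hy =>
    simp only [map_add, add_apply, hx, hy]
    abel

/-- Of the two parts of the cyclic face, the one without a differential on the entwined variable
cancels the first product, by the trace property. The other cancels the remaining products: these
are `T (c ⊗ a₀ D ω)` with `ω` expanded by `mulD_mul`, and integration by parts followed by the trace
property applies. -/
theorem hochschildD_degreeZeroCharacter_succ (Z : EntwinedCycle.{u, v, w} S (n + 1)) :
    hochschildD (Z.Ψ.map 0) (n + 1) Z.degreeZeroCharacter = 0 := by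
  ext c a
  rw [hochschildD_apply, mulLast_degreeZeroCharacter, Fin.sum_univ_succ]
  simp only [degreeZeroCharacter_apply]
  have h₁ : Z.R.mulD (n + 1) (Fin.contractNth (Fin.castSucc 0) (· * ·) a) =
      Z.R.mul (Nat.zero_add _) (a 0) (Z.R.mulD (n + 1) (Fin.tail a)) := by
    rw [NonUnitalDGA.mulD_eq_mul_d, NonUnitalDGA.mulD_eq_mul_d (r := Fin.tail a),
      ← Z.R.mul_assoc (Nat.add_zero 0) (Nat.zero_add _) (Nat.zero_add _) (Nat.zero_add _)]
    rfl
  have h₂ : ∀ j : Fin (n + 1),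
      Z.R.mulD (n + 1) (Fin.contractNth j.succ.castSucc (· * ·) a) =
        Z.R.mul (Nat.zero_add _) (a 0)
          (Z.R.d rfl (Z.R.mulD n (Fin.contractNth j.castSucc (· * ·) (Fin.tail a)))) := by
    intro j
    rw [NonUnitalDGA.mulD_eq_mul_d]
    have h0 : Fin.contractNth j.succ.castSucc (· * ·) a 0 = a 0 := by simp [Fin.contractNth]
    have h0' : Fin.tail (Fin.contractNth j.succ.castSucc (· * ·) a) =
        Fin.contractNth j.castSucc (· * ·) (Fin.tail a) := by
      funext i
      simp [Fin.contractNth, Fin.tail]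
    rw [h0, h0']
  have h₃ := Z.T_mul (Nat.zero_add _) (Nat.add_zero _) c (a 0) (Z.R.mulD (n + 1) (Fin.tail a))
  have h₄ := Z.T_d_mul (add_comm 1 n) rfl c (a 0) (Z.R.mul (Nat.add_zero n)
    (Z.R.mulD n (Fin.init (Fin.tail a))) (Fin.tail a (Fin.last (n + 1))))
  have h₅ := Z.T_mul_d (add_comm 1 n) rfl c (a 0) (Z.R.mul (Nat.add_zero n)
    (Z.R.mulD n (Fin.init (Fin.tail a))) (Fin.tail a (Fin.last (n + 1))))
  have h₆ : (-1 : k) ^ n * (-1 : k) ^ n = 1 := by rw [← mul_pow]; simp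
  have h₇ : ∀ j : Fin (n + 1), (-1 : k) ^ n * (-1 : k) ^ (n - (j : ℕ)) = (-1 : k) ^ (j : ℕ) := by
    intro j
    have hj := j.isLt
    rw [← pow_add, show n + (n - (j : ℕ)) = 2 * (n - j) + j by omega, pow_add, pow_mul]
    simp
  simp only [h₁, h₂, h₃]
  conv_lhs at h₅ =>
    rw [NonUnitalDGA.mulD_mul]
    simp only [map_sum, map_smul, TensorProduct.tmul_sum, TensorProduct.tmul_smul, smul_eq_mul]
  have hs : ∑ j : Fin (n + 1), (-1 : k) ^ ((j.succ : Fin (n + 2)) : ℕ).succ *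
      Z.T (c ⊗ₜ[k] Z.R.mul (Nat.zero_add _) (a 0)
        (Z.R.d rfl (Z.R.mulD n (Fin.contractNth j.castSucc (· * ·) (Fin.tail a))))) =
      (-1 : k) ^ n * ∑ j : Fin (n + 1), (-1 : k) ^ (n - (j : ℕ)) *
        Z.T (c ⊗ₜ[k] Z.R.mul (Nat.zero_add _) (a 0)
        (Z.R.d rfl (Z.R.mulD n (Fin.contractNth j.castSucc (· * ·) (Fin.tail a))))) := by
    rw [Finset.mul_sum]
    refine Finset.sum_congr rfl fun j _ => ?_
    rw [← mul_assoc, h₇, Fin.val_succ, pow_succ, pow_succ]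
    ring
  simp only [Nat.succ_eq_add_one] at hs
  rw [hs, h₅, h₄, Fin.val_zero]
  simp only [zero_mul, pow_zero, zero_add, pow_one, one_mul, LinearMap.zero_apply,
    zero_apply]
  linear_combination (-Z.traceMulLeft rfl (Z.R.mul (Nat.add_zero n)
    (Z.R.mulD n (Fin.init (Fin.tail a))) (Fin.tail a (Fin.last (n + 1))))
        (LinearMap.rTensor C (Z.R.d (Nat.zero_add 1)) (Z.Ψ.map 0 (c ⊗ₜ[k] a 0)))) * h₆

theorem degreeZeroCharacter_mem_cyclicCocycles (Z : EntwinedCycle.{u, v, w} S n)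
    (hZ : Z.IsVanishing) : Z.degreeZeroCharacter ∈ Z.Ψ.degreeZero.cyclicCocycles n := by
  refine ⟨?_, ?_⟩
  · refine (NonUnitalEntwining.mem_cyclicCochains_iff _ _).2 ?_
    change (-1 : k) ^ n • rotate (Z.Ψ.map 0) Z.degreeZeroCharacter = Z.degreeZeroCharacter
    cases n with
    | zero =>
      -- In dimension zero the trace property concerns only products, so the unit is needed to write
      -- `r = r e`.
      obtain ⟨e, he, hec, -⟩ := hZ
      rw [pow_zero, one_smul]
      ext c a
      have h : ∀ z : Z.R.obj 0 ⊗[k] C, Z.degreeZeroCharacter.insertLast z (Fin.tail a) =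
          Z.traceMulLeft (Nat.add_zero 0) e z := by
        intro z
        induction z using TensorProduct.induction_on with
        | zero => simp
        | tmul x d =>
          rw [insertLast_tmul, degreeZeroCharacter_apply, traceMulLeft_tmul]
          exact congrArg (fun y => Z.T (d ⊗ₜ[k] y)) (he x).1.symm
        | add x y hx hy => simp only [map_add, add_apply, hx, hy]
      have h' := Z.T_mul (Nat.add_zero 0) (Nat.add_zero 0) c (a 0) e
      rw [mul_zero, pow_zero, one_mul] at h'
      rw [rotate_apply, h, ← h']
      exact congrArg (fun y => Z.T (c ⊗ₜ[k] y)) (he (a 0)).2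
    | succ n =>
      rw [rotate_degreeZeroCharacter, smul_smul, ← mul_pow]
      simp
  · cases n with
    | zero => exact Z.hochschildD_degreeZeroCharacter_zero
    | succ n => exact Z.hochschildD_degreeZeroCharacter_succ

/-- The character of a vanishing cycle is a coboundary. -/
theorem HasCharacter.mem_cyclicCoboundaries [CharZero k] {Z : EntwinedCycle.{u, v, w} S n}
    {g : EntwinedCochain k A C n} (h : Z.HasCharacter g) (hZ : Z.IsVanishing) :
    g ∈ S.cyclicCoboundaries n := by
  have hG := hZ.cyclicCocycles_le n (Z.degreeZeroCharacter_mem_cyclicCocycles hZ)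
  have hρ := entwineEquivariant_of_comp_eq Z.ρ_comm
  rw [h.eq_pullback]
  cases n with
  | zero =>
    have : Z.degreeZeroCharacter = 0 := hG
    rw [this, map_zero]
    exact Submodule.zero_mem _
  | succ n =>
    obtain ⟨K, hK, hKG⟩ := hG
    refine ⟨pullback (fun _ => (Z.ρ : A →ₗ[k] Z.R.obj 0)) K, ?_, ?_⟩
    · refine (NonUnitalEntwining.mem_cyclicCochains_iff _ _).2 ?_
      have hK' := (NonUnitalEntwining.mem_cyclicCochains_iff _ _).1 hK
      change (-1 : k) ^ n • rotate _ _ = _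
      change (-1 : k) ^ n • rotate _ _ = _ at hK'
      rw [rotate_pullback_const hρ, ← map_smul]
      exact congrArg _ hK'
    · rw [hochschildD_pullback hρ (fun a b => map_mul Z.ρ a b)]
      exact congrArg _ hKG

end EntwinedCycle

end

noncomputable section

/-! ### Tensor products of entwined modules -/

section TensorEntwining

variable {k : Type*} [Field k] {C : Type*} [AddCommGroup C] [Module k C]
  {M N P Q T W : Type*} [AddCommGroup M] [Module k M] [AddCommGroup N] [Module k N]
  [AddCommGroup P] [Module k P] [AddCommGroup Q] [Module k Q] [AddCommGroup T] [Module k T]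
  [AddCommGroup W] [Module k W]

/-- Associative products give associative entwined products. -/
theorem entwineStep_rTensor {μ : M →ₗ[k] N →ₗ[k] P} {μ' : P →ₗ[k] Q →ₗ[k] W}
    {κ : N →ₗ[k] Q →ₗ[k] T} {κ' : M →ₗ[k] T →ₗ[k] W} (m : M) (q : Q)
    (h : ∀ n q, μ' (μ m n) q = κ' m (κ n q)) (ψQ : C ⊗[k] Q →ₗ[k] Q ⊗[k] C) (y : N ⊗[k] C) :
    entwineStep μ' ψQ q (LinearMap.rTensor C (μ m) y) =
      LinearMap.rTensor C (κ' m) (entwineStep κ ψQ q y) := by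
  induction y using TensorProduct.induction_on with
  | zero => simp
  | tmul n c =>
    have h' : μ' (μ m n) = κ' m ∘ₗ κ n := LinearMap.ext (h n)
    rw [LinearMap.rTensor_tmul, entwineStep_tmul, entwineStep_tmul, h', LinearMap.rTensor_comp,
      LinearMap.comp_apply]
  | add x y hx hy => simp only [map_add, hx, hy]

theorem entwineStep_add (μ : M →ₗ[k] N →ₗ[k] P) (ψN : C ⊗[k] N →ₗ[k] N ⊗[k] C) (n n' : N) :
    entwineStep μ ψN (n + n') = entwineStep μ ψN n + entwineStep μ ψN n' :=
  TensorProduct.ext' fun m c => by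
    simp only [LinearMap.add_apply, entwineStep_tmul, TensorProduct.tmul_add, map_add]

theorem entwineStep_zero (μ : M →ₗ[k] N →ₗ[k] P) (ψN : C ⊗[k] N →ₗ[k] N ⊗[k] C) :
    entwineStep μ ψN 0 = 0 :=
  TensorProduct.ext' fun m c => by simp [entwineStep_tmul]

/-- The diagonal entwining map of `M ⊗ N`. -/
def tensorEntwine (ψM : C ⊗[k] M →ₗ[k] M ⊗[k] C) (ψN : C ⊗[k] N →ₗ[k] N ⊗[k] C) :
    C ⊗[k] (M ⊗[k] N) →ₗ[k] (M ⊗[k] N) ⊗[k] C :=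
  entwineMul (TensorProduct.mk k M N) ψM ψN

theorem tensorEntwine_tmul (ψM : C ⊗[k] M →ₗ[k] M ⊗[k] C) (ψN : C ⊗[k] N →ₗ[k] N ⊗[k] C)
    (c : C) (m : M) (n : N) :
    tensorEntwine ψM ψN (c ⊗ₜ[k] (m ⊗ₜ[k] n)) =
      entwineStep (TensorProduct.mk k M N) ψN n (ψM (c ⊗ₜ[k] m)) :=
  entwineMul_tmul _ _ _ _ _ _

/-- `c ⊗ m ⊗ c' ↦ m_ψ ⊗ c^ψ ⊗ c'`. -/
def entwineOuter (ψ : C ⊗[k] M →ₗ[k] M ⊗[k] C) : C ⊗[k] (M ⊗[k] C) →ₗ[k] M ⊗[k] (C ⊗[k] C) :=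
  (TensorProduct.assoc k M C C).toLinearMap ∘ₗ LinearMap.rTensor C ψ ∘ₗ
    (TensorProduct.assoc k C M C).symm.toLinearMap

theorem entwineOuter_tmul (ψ : C ⊗[k] M →ₗ[k] M ⊗[k] C) (c c' : C) (m : M) :
    entwineOuter ψ (c ⊗ₜ[k] (m ⊗ₜ[k] c')) =
      TensorProduct.assoc k M C C (ψ (c ⊗ₜ[k] m) ⊗ₜ[k] c') := rfl

/-- `c ⊗ c' ↦ (m_ψ)_ψ ⊗ c^ψ ⊗ c'^ψ`. -/
def entwinePair (ψ : C ⊗[k] M →ₗ[k] M ⊗[k] C) (m : M) : C ⊗[k] C →ₗ[k] M ⊗[k] (C ⊗[k] C) :=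
  entwineOuter ψ ∘ₗ LinearMap.lTensor C (ψ ∘ₗ (TensorProduct.mk k C M).flip m)

theorem entwinePair_tmul (ψ : C ⊗[k] M →ₗ[k] M ⊗[k] C) (m : M) (c c' : C) :
    entwinePair ψ m (c ⊗ₜ[k] c') = entwineOuter ψ (c ⊗ₜ[k] ψ (c' ⊗ₜ[k] m)) := rfl

/-- The counit applied to the second factor. -/
def counitRight (M : Type*) [AddCommGroup M] [Module k M] [Coalgebra k C] : M ⊗[k] C →ₗ[k] M :=
  (TensorProduct.rid k M).toLinearMap ∘ₗ
    LinearMap.lTensor M (Coalgebra.counit (R := k) (A := C))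

theorem counitRight_tmul [Coalgebra k C] (m : M) (c : C) :
    counitRight M (m ⊗ₜ[k] c) = Coalgebra.counit (R := k) c • m := rfl

theorem counitRight_rTensor [Coalgebra k C] (f : M →ₗ[k] N) (z : M ⊗[k] C) :
    counitRight N (LinearMap.rTensor C f z) = f (counitRight M z) := by
  induction z using TensorProduct.induction_on with
  | zero => simp
  | tmul m c => simp [counitRight_tmul]
  | add x y hx hy => simp only [map_add, hx, hy]

theorem entwineRespectsCounit_iff [Coalgebra k C] {ψ : C ⊗[k] M →ₗ[k] M ⊗[k] C} :
    EntwineRespectsCounit ψ ↔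
      ∀ c m, counitRight M (ψ (c ⊗ₜ[k] m)) = Coalgebra.counit (R := k) c • m :=
  ⟨fun h c m => LinearMap.congr_fun h (c ⊗ₜ[k] m), fun h => TensorProduct.ext' fun c m => h c m⟩

theorem entwineRespectsComul_iff [Coalgebra k C] {ψ : C ⊗[k] M →ₗ[k] M ⊗[k] C} :
    EntwineRespectsComul ψ ↔
      ∀ c m, LinearMap.lTensor M (Coalgebra.comul (R := k)) (ψ (c ⊗ₜ[k] m)) =
        entwinePair ψ m (Coalgebra.comul (R := k) c) := by
  have key : ∀ (w : C ⊗[k] C) (m : M), ((TensorProduct.assoc k M C C).toLinearMap ∘ₗ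
      LinearMap.rTensor C ψ ∘ₗ (TensorProduct.assoc k C M C).symm.toLinearMap ∘ₗ
      LinearMap.lTensor C ψ ∘ₗ (TensorProduct.assoc k C C M).toLinearMap) (w ⊗ₜ[k] m) =
        entwinePair ψ m w := by
    intro w m
    induction w using TensorProduct.induction_on with
    | zero => simp
    | tmul c c' => rfl
    | add x y hx hy => rw [TensorProduct.add_tmul, map_add, map_add, hx, hy]
  constructor
  · intro h c m
    rw [← key]
    exact LinearMap.congr_fun h (c ⊗ₜ[k] m)
  · intro h
    refine TensorProduct.ext' fun c m => ?_
    refine (h c m).trans ?_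
    rw [← key]
    rfl

theorem EntwineRespectsCounit.tensor [Coalgebra k C] {ψM : C ⊗[k] M →ₗ[k] M ⊗[k] C}
    {ψN : C ⊗[k] N →ₗ[k] N ⊗[k] C} (hM : EntwineRespectsCounit ψM)
    (hN : EntwineRespectsCounit ψN) : EntwineRespectsCounit (tensorEntwine ψM ψN) := by
  rw [entwineRespectsCounit_iff] at *
  have key : ∀ (z : M ⊗[k] C) (n : N), counitRight (M ⊗[k] N)
      (entwineStep (TensorProduct.mk k M N) ψN n z) = counitRight M z ⊗ₜ[k] n := by
    intro z n
    induction z using TensorProduct.induction_on with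
    | zero => simp
    | tmul m c =>
      rw [entwineStep_tmul, counitRight_rTensor, hN, counitRight_tmul, map_smul,
        ← TensorProduct.smul_tmul', TensorProduct.mk_apply]
    | add x y hx hy => rw [map_add, map_add, hx, hy, map_add, TensorProduct.add_tmul]
  intro c x
  induction x using TensorProduct.induction_on with
  | zero => simp
  | tmul m n => rw [tensorEntwine_tmul, key, hM, TensorProduct.smul_tmul']
  | add x y hx hy => rw [TensorProduct.tmul_add, map_add, map_add, hx, hy, smul_add]

theorem lTensor_entwineStep [Coalgebra k C] {ψN : C ⊗[k] N →ₗ[k] N ⊗[k] C}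
    (hN : EntwineRespectsComul ψN) (n : N) (z : M ⊗[k] C) :
    LinearMap.lTensor (M ⊗[k] N) (Coalgebra.comul (R := k))
      (entwineStep (TensorProduct.mk k M N) ψN n z) =
    (TensorProduct.assoc k M N (C ⊗[k] C)).symm (LinearMap.lTensor M (entwinePair ψN n)
      (LinearMap.lTensor M (Coalgebra.comul (R := k)) z)) := by
  induction z using TensorProduct.induction_on with
  | zero => simp
  | tmul m c =>
    rw [entwineStep_tmul, LinearMap.lTensor_tmul, LinearMap.lTensor_tmul,
      ← entwineRespectsComul_iff.1 hN]
    induction ψN (c ⊗ₜ[k] n) using TensorProduct.induction_on with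
    | zero => simp
    | tmul x y => simp
    | add x y hx hy => simp only [map_add, TensorProduct.tmul_add, hx, hy]
  | add x y hx hy => simp only [map_add, hx, hy]

theorem entwinePair_tensor (ψM : C ⊗[k] M →ₗ[k] M ⊗[k] C) (ψN : C ⊗[k] N →ₗ[k] N ⊗[k] C)
    (m : M) (n : N) (w : C ⊗[k] C) :
    entwinePair (tensorEntwine ψM ψN) (m ⊗ₜ[k] n) w =
      (TensorProduct.assoc k M N (C ⊗[k] C)).symm
        (LinearMap.lTensor M (entwinePair ψN n) (entwinePair ψM m w)) := by
  induction w using TensorProduct.induction_on with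
  | zero => simp
  | tmul c c' =>
    rw [entwinePair_tmul, entwinePair_tmul, tensorEntwine_tmul]
    induction ψM (c' ⊗ₜ[k] m) using TensorProduct.induction_on with
    | zero => simp
    | tmul m' c' =>
      have h : ∀ z : M ⊗[k] C,
          LinearMap.lTensor M (entwinePair ψN n) (TensorProduct.assoc k M C C (z ⊗ₜ[k] c')) =
          LinearMap.lTensor M (entwineOuter ψN ∘ₗ
            (TensorProduct.mk k C (N ⊗[k] C)).flip (ψN (c' ⊗ₜ[k] n))) z := by
        intro z
        induction z using TensorProduct.induction_on with
        | zero => simp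
        | tmul x d => rfl
        | add x y hx hy => rw [TensorProduct.add_tmul, map_add, map_add, map_add, hx, hy]
      rw [entwineStep_tmul, entwineOuter_tmul, h]
      induction ψN (c' ⊗ₜ[k] n) using TensorProduct.induction_on with
      | zero => simp
      | tmul n' d =>
        rw [LinearMap.rTensor_tmul, entwineOuter_tmul, TensorProduct.mk_apply, tensorEntwine_tmul]
        induction ψM (c ⊗ₜ[k] m') using TensorProduct.induction_on with
        | zero => simp
        | tmul x e =>
          rw [entwineStep_tmul, LinearMap.lTensor_tmul, LinearMap.comp_apply,
            LinearMap.flip_apply, TensorProduct.mk_apply, entwineOuter_tmul]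
          induction ψN (e ⊗ₜ[k] n') using TensorProduct.induction_on with
          | zero => simp
          | tmul p q => rfl
          | add p q hp hq =>
            simp only [map_add, TensorProduct.tmul_add, TensorProduct.add_tmul, hp, hq]
        | add x y hx hy => simp only [map_add, TensorProduct.add_tmul, hx, hy]
      | add x y hx hy =>
        simp only [map_add, TensorProduct.tmul_add, LinearMap.comp_add, LinearMap.lTensor_add,
          LinearMap.add_apply, hx, hy]
    | add x y hx hy => simp only [map_add, TensorProduct.tmul_add, hx, hy]
  | add x y hx hy => simp only [map_add, hx, hy]

/-- The coproduct is carried through the entwining of `N` and then through that of `M`;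
`entwinePair_tensor` identifies the result with the diagonal entwining of both copies of `C`. -/
theorem EntwineRespectsComul.tensor [Coalgebra k C] {ψM : C ⊗[k] M →ₗ[k] M ⊗[k] C}
    {ψN : C ⊗[k] N →ₗ[k] N ⊗[k] C} (hM : EntwineRespectsComul ψM)
    (hN : EntwineRespectsComul ψN) : EntwineRespectsComul (tensorEntwine ψM ψN) := by
  rw [entwineRespectsComul_iff]
  intro c x
  induction x using TensorProduct.induction_on with
  | zero => simp [entwinePair]
  | tmul m n =>
    rw [tensorEntwine_tmul, lTensor_entwineStep hN, entwineRespectsComul_iff.1 hM,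
      entwinePair_tensor]
  | add x y hx hy =>
    rw [TensorProduct.tmul_add, map_add, map_add, hx, hy]
    have h : entwinePair (tensorEntwine ψM ψN) (x + y) =
        entwinePair (tensorEntwine ψM ψN) x + entwinePair (tensorEntwine ψM ψN) y :=
      TensorProduct.ext' fun a b => by simp [entwinePair_tmul, TensorProduct.tmul_add]
    rw [h]
    rfl

/-- The flip is the trivial entwining, carried by the factor `D` in `EntwiningStructure.extend`. -/
theorem EntwineRespectsCounit.comm [Coalgebra k C] :
    EntwineRespectsCounit (TensorProduct.comm k C M).toLinearMap := by
  rw [entwineRespectsCounit_iff]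
  intro c m
  rfl

theorem EntwineRespectsComul.comm [Coalgebra k C] :
    EntwineRespectsComul (TensorProduct.comm k C M).toLinearMap := by
  rw [entwineRespectsComul_iff]
  intro c m
  change m ⊗ₜ[k] Coalgebra.comul (R := k) c = _
  induction Coalgebra.comul (R := k) c using TensorProduct.induction_on with
  | zero => simp
  | tmul a b => rfl
  | add x y hx hy => rw [TensorProduct.tmul_add, map_add, hx, hy]

end TensorEntwining

end

noncomputable section

/-! ### The free product of an algebra with a polynomial algebra in one variable -/

/-- The modules `B ⊗ ⋯ ⊗ B` with `n + 1` factors, as objects of the category of modules. -/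
def tensorTowerCat (k : Type*) [Field k] (B : Type w) [AddCommGroup B] [Module k B] :
    ℕ → ModuleCat.{w} k
  | 0 => ModuleCat.of k B
  | n + 1 => ModuleCat.of k (B ⊗[k] tensorTowerCat k B n)

/-- The component `B ⊗ ⋯ ⊗ B` (`n + 1` factors) of degree `n` of the algebra freely generated by
`B` and an element of degree one. -/
abbrev TensorTower (k : Type*) [Field k] (B : Type w) [AddCommGroup B] [Module k B] (n : ℕ) :
    Type w := tensorTowerCat k B n

namespace TensorTower

section Module

variable {k : Type*} [Field k] {B : Type w} [AddCommGroup B] [Module k B] {n : ℕ}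
  {P : Type*} [AddCommGroup P] [Module k P]

/-- The component of degree zero. -/
def base : B →ₗ[k] TensorTower k B 0 := (LinearMap.id : B →ₗ[k] B)

/-- `b ⊗ u`. -/
def cons : B →ₗ[k] TensorTower k B n →ₗ[k] TensorTower k B (n + 1) :=
  TensorProduct.mk k B (TensorTower k B n)

/-- The universal property of the component of degree zero. -/
def baseLift (f : B →ₗ[k] P) : TensorTower k B 0 →ₗ[k] P := f

/-- The universal property of the components of positive degree. -/
def consLift (f : B →ₗ[k] TensorTower k B n →ₗ[k] P) : TensorTower k B (n + 1) →ₗ[k] P :=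
  TensorProduct.lift f

theorem consLift_cons (f : B →ₗ[k] TensorTower k B n →ₗ[k] P) (b : B) (u : TensorTower k B n) :
    consLift f (cons b u) = f b u := rfl

theorem base_induction {p : TensorTower k B 0 → Prop} (x : TensorTower k B 0)
    (base : ∀ b, p (base b)) : p x := base x

theorem cons_induction {p : TensorTower k B (n + 1) → Prop} (x : TensorTower k B (n + 1))
    (tmul : ∀ b u, p (cons b u)) (add : ∀ x y, p x → p y → p (x + y)) : p x :=
  TensorProduct.induction_on (motive := p) x
    (map_zero (cons (k := k) (n := n) (0 : B)) ▸ tmul 0 0) tmul add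

end Module

section Algebra

variable {k : Type*} [Field k] {B : Type w} [Ring B] [Algebra k B]

/-- The left action of `B`. -/
def baseMul : (n : ℕ) → B →ₗ[k] TensorTower k B n →ₗ[k] TensorTower k B n
  | 0 => LinearMap.mul k B
  | n + 1 => LinearMap.rTensorHom (TensorTower k B n) ∘ₗ LinearMap.mul k B

/-- The product, `(b₀ ⊗ ⋯ ⊗ bᵢ) (b'₀ ⊗ ⋯ ⊗ b'ⱼ) = b₀ ⊗ ⋯ ⊗ bᵢ b'₀ ⊗ ⋯ ⊗ b'ⱼ`. -/
def mul : {i j n : ℕ} → i + j = n →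
    TensorTower k B i →ₗ[k] TensorTower k B j →ₗ[k] TensorTower k B n
  | 0, j, _, h =>
    baseLift (((Nat.zero_add j).symm.trans h) ▸ baseMul j)
  | i + 1, j, 0, h => absurd h (by omega)
  | i + 1, j, n + 1, h => consLift (LinearMap.mk₂ k
      (fun b u => cons b ∘ₗ mul (show i + j = n by omega) u)
      (fun b b' u => by ext; simp) (fun r b u => by ext; simp)
      (fun b u u' => by ext; simp) (fun r b u => by ext; simp))

theorem mul_base_base (h : 0 + 0 = 0) (b b' : B) :
    mul (k := k) h (base b) (base b') = base (b * b') := rfl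

theorem mul_base_cons {n : ℕ} (h : 0 + (n + 1) = n + 1) (b b' : B) (u : TensorTower k B n) :
    mul h (base b) (cons b' u) = cons (b * b') u := rfl

theorem mul_cons {i j n : ℕ} (h : i + 1 + j = n + 1) (h' : i + j = n) (b : B)
    (u : TensorTower k B i) (x : TensorTower k B j) :
    mul h (cons b u) x = cons b (mul h' u x) := rfl

theorem base_mul_assoc {j l n : ℕ} (h₀ : 0 + j = j) (h : j + l = n) (h' : 0 + n = n) (b : B)
    (y : TensorTower k B j) (z : TensorTower k B l) :
    mul h (mul h₀ (base b) y) z = mul h' (base b) (mul h y z) := by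
  cases j with
  | zero =>
    induction y using base_induction with | base b' =>
    obtain rfl : l = n := by omega
    cases l with
    | zero =>
      induction z using base_induction with | base b'' =>
      simp only [mul_base_base, mul_assoc]
    | succ l =>
      induction z using cons_induction with
      | tmul b'' u => simp only [mul_base_base, mul_base_cons, mul_assoc]
      | add x y hx hy => simp only [map_add, hx, hy]
  | succ j =>
    cases n with
    | zero => omega
    | succ n =>
      induction y using cons_induction with
      | tmul b' u => rw [mul_base_cons, mul_cons h (by omega), mul_cons h (by omega), mul_base_cons]
      | add x y hx hy => simp only [map_add, LinearMap.add_apply, hx, hy]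

/-- The product affects only the last entry of the left factor, so leading entries split off by
induction on its length. -/
protected theorem mul_assoc {i j l ij jl n : ℕ} (hij : i + j = ij) (hjl : j + l = jl)
    (h : ij + l = n) (h' : i + jl = n) (x : TensorTower k B i) (y : TensorTower k B j)
    (z : TensorTower k B l) : mul h (mul hij x y) z = mul h' x (mul hjl y z) := by
  induction i generalizing ij n with
  | zero =>
    induction x using base_induction with | base b =>
    obtain rfl : j = ij := by omega
    obtain rfl : jl = n := by omega
    exact base_mul_assoc hij h h' b y z
  | succ i ih =>
    cases ij with
    | zero => omega
    | succ ij =>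
      cases n with
      | zero => omega
      | succ n =>
        induction x using cons_induction with
        | tmul b u =>
          rw [mul_cons hij (by omega), mul_cons h (show ij + l = n by omega),
            mul_cons h' (show i + jl = n by omega)]
          rw [ih]
        | add x y hx hy => simp only [map_add, LinearMap.add_apply, hx, hy]

theorem base_one_mul {n : ℕ} (h : 0 + n = n) (u : TensorTower k B n) :
    mul h (base 1) u = u := by
  cases n with
  | zero =>
    induction u using base_induction with | base b' =>
    rw [mul_base_base, one_mul]
  | succ n =>
    induction u using cons_induction with
    | tmul b' u => rw [mul_base_cons, one_mul]
    | add x y hx hy => rw [map_add, hx, hy]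

variable (k B) in
/-- The free generator of degree one. -/
def generator : TensorTower k B 1 := cons 1 (base 1)

theorem base_mul_generator (h : 0 + 1 = 1) (b : B) :
    mul h (base b) (generator k B) = cons b (base 1) := by
  rw [generator, mul_base_cons, mul_one]

/-! ### The inner differential -/

/-- The graded commutator with an element of degree one. -/
def commutator (F : TensorTower k B 1) {i j : ℕ} (h : i + 1 = j) :
    TensorTower k B i →ₗ[k] TensorTower k B j :=
  mul ((add_comm 1 i).trans h) F - (-1 : k) ^ i • (mul h).flip F

theorem commutator_apply (F : TensorTower k B 1) {i j : ℕ} (h : i + 1 = j) (h' : 1 + i = j)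
    (x : TensorTower k B i) :
    commutator F h x = mul h' F x - (-1 : k) ^ i • mul h x F := rfl

/-- The two terms `F x F` have opposite signs, and what remains contains `F²`. -/
theorem commutator_commutator {F : TensorTower k B 1} (hF : mul (n := 2) rfl F F = 0)
    {i j l : ℕ} (h : i + 1 = j) (h' : j + 1 = l) (x : TensorTower k B i) :
    commutator F h' (commutator F h x) = 0 := by
  have hj : (-1 : k) ^ j = (-1) ^ i * -1 := by rw [← h, pow_succ]
  rw [commutator_apply F h (by omega), commutator_apply F h' (by omega)]
  simp only [map_sub, map_smul, LinearMap.sub_apply, LinearMap.smul_apply]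
  rw [← TensorTower.mul_assoc (ij := 2) rfl (by omega) (by omega), hF,
    ← TensorTower.mul_assoc (by omega) (by omega) (show j + 1 = l by omega),
    TensorTower.mul_assoc (jl := 2) h rfl h' (by omega), hF, hj]
  simp

theorem commutator_mul (F : TensorTower k B 1) {i j n i' j' n' : ℕ} (h : i + j = n)
    (hi : i + 1 = i') (hj : j + 1 = j') (hn : n + 1 = n') (h₁ : i' + j = n') (h₂ : i + j' = n')
    (x : TensorTower k B i) (y : TensorTower k B j) :
    commutator F hn (mul h x y) =
      mul h₁ (commutator F hi x) y + (-1 : k) ^ i • mul h₂ x (commutator F hj y) := by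
  rw [commutator_apply F hn ((add_comm 1 n).trans hn),
    commutator_apply F hi ((add_comm 1 i).trans hi),
    commutator_apply F hj ((add_comm 1 j).trans hj)]
  simp only [map_sub, map_smul, LinearMap.sub_apply, LinearMap.smul_apply]
  rw [TensorTower.mul_assoc (i := 1) ((add_comm 1 i).trans hi) h h₁ ((add_comm 1 n).trans hn),
    TensorTower.mul_assoc (j := 1) hi ((add_comm 1 j).trans hj) h₁ h₂,
    TensorTower.mul_assoc (l := 1) h hj hn h₂, smul_sub, smul_smul, ← pow_add, h]
  abel

/-- The dg-algebra with the graded commutator with `F` as differential, where `F² = 0`. -/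
abbrev dga (F : TensorTower k B 1) (hF : mul (n := 2) rfl F F = 0) : NonUnitalDGA.{w} k where
  obj := TensorTower k B
  mul := mul
  mul_assoc := TensorTower.mul_assoc
  d := commutator F
  d_d := commutator_commutator hF
  leibniz := commutator_mul F

end Algebra

/-! ### The entwining -/

section Entwining

variable {k : Type*} [Field k] {B : Type w} [Ring B] [Algebra k B]
  {C : Type*} [AddCommGroup C] [Module k C] [Coalgebra k C] (S : EntwiningStructure k B C)

/-- The entwining map in degree `n`. -/
def entwine : (n : ℕ) → C ⊗[k] TensorTower k B n →ₗ[k] TensorTower k B n ⊗[k] C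
  | 0 => S.map
  | n + 1 => tensorEntwine S.map (entwine n)

theorem entwine_base (c : C) (b : B) :
    entwine S 0 (c ⊗ₜ[k] base b) = LinearMap.rTensor C base (S.map (c ⊗ₜ[k] b)) :=
  (LinearMap.rTensor_id_apply (R := k) C B _).symm

theorem entwine_cons {n : ℕ} (c : C) (b : B) (u : TensorTower k B n) :
    entwine S (n + 1) (c ⊗ₜ[k] cons b u) = entwineStep cons (entwine S n) u (S.map (c ⊗ₜ[k] b)) :=
  tensorEntwine_tmul _ _ _ _ _

theorem entwine_respectsCounit : ∀ n, EntwineRespectsCounit (entwine S n)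
  | 0 => S.respects_counit
  | n + 1 => S.respects_counit.tensor (entwine_respectsCounit n)

theorem entwine_respectsComul : ∀ n, EntwineRespectsComul (entwine S n)
  | 0 => S.respects_comul
  | n + 1 => S.respects_comul.tensor (entwine_respectsComul n)

theorem entwineStep_base {M N P : Type*} [AddCommGroup M] [Module k M] [AddCommGroup N]
    [Module k N] [AddCommGroup P] [Module k P] {C : Type*} [AddCommGroup C] [Module k C]
    (μ : P →ₗ[k] N →ₗ[k] M) (f : B →ₗ[k] P)
    (ψ : C ⊗[k] N →ₗ[k] N ⊗[k] C) (n : N) (z : B ⊗[k] C) :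
    entwineStep μ ψ n (LinearMap.rTensor C f z) = entwineStep (μ ∘ₗ f) ψ n z := by
  induction z using TensorProduct.induction_on with
  | zero => simp
  | tmul m c => rw [LinearMap.rTensor_tmul, entwineStep_tmul, entwineStep_tmul]; rfl
  | add x y hx hy => simp only [map_add, hx, hy]

theorem entwine_base_mul {n : ℕ} (h : 0 + n = n) (c : C) (b : B) (x : TensorTower k B n) :
    entwine S n (c ⊗ₜ[k] mul h (base b) x) =
      entwineStep (mul h ∘ₗ base) (entwine S n) x (S.map (c ⊗ₜ[k] b)) := by
  cases n with
  | zero =>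
    induction x using base_induction with | base b' =>
    exact entwineRespectsMul_iff.1 S.respects_mul c b b'
  | succ n =>
    induction x using cons_induction with
    | tmul b' u =>
      rw [mul_base_cons, entwine_cons, ← LinearMap.mul_apply' (R := k),
        entwineRespectsMul_iff.1 S.respects_mul]
      induction S.map (c ⊗ₜ[k] b) using TensorProduct.induction_on with
      | zero => simp
      | tmul b₁ c₁ =>
        rw [entwineStep_tmul, entwineStep_tmul, entwine_cons,
          entwineStep_rTensor (κ := cons) (κ' := mul h ∘ₗ base) b₁ u (fun _ _ => rfl)]
      | add x y hx hy => simp only [map_add, hx, hy]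
    | add x y hx hy =>
      rw [map_add, TensorProduct.tmul_add, map_add, hx, hy, entwineStep_add]
      rfl

theorem entwine_mul {i j n : ℕ} (h : i + j = n) (c : C) (x : TensorTower k B i)
    (y : TensorTower k B j) :
    entwine S n (c ⊗ₜ[k] mul h x y) = entwineStep (mul h) (entwine S j) y
      (entwine S i (c ⊗ₜ[k] x)) := by
  induction i generalizing n c with
  | zero =>
    obtain rfl : j = n := by omega
    induction x using base_induction with | base b =>
    rw [entwine_base, entwineStep_base, entwine_base_mul]
  | succ i ih =>
    cases n with
    | zero => omega
    | succ n =>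
      induction x using cons_induction with
      | tmul b u =>
        rw [mul_cons h (show i + j = n by omega), entwine_cons, entwine_cons]
        induction S.map (c ⊗ₜ[k] b) using TensorProduct.induction_on with
        | zero => simp
        | tmul b₁ c₁ =>
          rw [entwineStep_tmul, entwineStep_tmul, ih,
            entwineStep_rTensor (κ := mul (show i + j = n by omega)) (κ' := cons) b₁ y
              (fun _ _ => rfl)]
        | add x y hx hy => simp only [map_add, hx, hy]
      | add x y hx hy =>
        simp only [map_add, LinearMap.add_apply, TensorProduct.tmul_add, hx, hy]

theorem entwine_respectsMul {i j n : ℕ} (h : i + j = n) :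
    EntwineRespectsMul (mul h) (entwine S i) (entwine S j) (entwine S n) :=
  entwineRespectsMul_iff.2 (entwine_mul S h)

theorem commutator_equivariant {F : TensorTower k B 1}
    (hF : ∀ c, entwine S 1 (c ⊗ₜ[k] F) = F ⊗ₜ[k] c) {i j : ℕ} (h : i + 1 = j) :
    EntwineEquivariant (entwine S i) (entwine S j) (commutator F h) := by
  intro c x
  have h₁ := (entwine_respectsMul S ((add_comm 1 i).trans h)).equivariant_left hF c x
  have h₂ := (entwine_respectsMul S h).equivariant_right hF c x
  rw [commutator, LinearMap.sub_apply, LinearMap.smul_apply, TensorProduct.tmul_sub, map_sub,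
    TensorProduct.tmul_smul, map_smul, h₁, h₂, LinearMap.rTensor_sub, LinearMap.rTensor_smul]
  rfl

/-- The dg-entwining. -/
abbrev dgEntwining (F : TensorTower k B 1) (hF : mul (n := 2) rfl F F = 0)
    (hFS : ∀ c, entwine S 1 (c ⊗ₜ[k] F) = F ⊗ₜ[k] c) : DGEntwining (dga F hF) C where
  map := entwine S
  map_d h := (commutator_equivariant S hFS h).comp_eq
  respects_mul := entwine_respectsMul S
  respects_comul := entwine_respectsComul S
  respects_counit := entwine_respectsCounit S

end Entwining

end TensorTower

end

noncomputable section

/-! ### The closed graded trace defined by a cyclic cochain -/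

namespace TensorTower

open EntwinedCochain

section Pure

variable {k : Type*} [Field k] {B : Type w} [AddCommGroup B] [Module k B] {n : ℕ}

variable (k) in
/-- `b₀ ⊗ ⋯ ⊗ bₙ`. -/
def tprod : (n : ℕ) → (Fin (n + 1) → B) → TensorTower k B n
  | 0, b => base (b 0)
  | n + 1, b => cons (b 0) (tprod n (Fin.tail b))

theorem tprod_zero (b : Fin 1 → B) : tprod k 0 b = base (b 0) := rfl

theorem tprod_succ (b : Fin (n + 2) → B) :
    tprod k (n + 1) b = cons (b 0) (tprod k n (Fin.tail b)) := rfl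

theorem tprod_induction {p : TensorTower k B n → Prop} (x : TensorTower k B n)
    (tprod : ∀ b, p (tprod k n b)) (add : ∀ x y, p x → p y → p (x + y)) : p x := by
  induction n with
  | zero => exact tprod fun _ => x
  | succ n ih =>
    induction x using cons_induction with
    | tmul b u =>
      refine ih (p := fun u => p (cons b u)) u (fun a => ?_) fun x y hx hy => ?_
      · have := tprod (Fin.cons b a)
        rwa [tprod_succ, Fin.cons_zero, Fin.tail_cons] at this
      · simp only [map_add]
        exact add _ _ hx hy
    | add x y hx hy => exact add _ _ hx hy

/-- The universal property of `B ⊗ ⋯ ⊗ B`. -/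
def multilinearLift : (n : ℕ) →
    MultilinearMap k (fun _ : Fin (n + 1) => B) k →ₗ[k] TensorTower k B n →ₗ[k] k
  | 0 =>
    haveI : Subsingleton (Fin (0 + 1)) := inferInstanceAs (Subsingleton (Fin 1))
    { toFun := fun F => baseLift ((MultilinearMap.ofSubsingletonₗ k k B k 0).symm F)
      map_add' := fun F G => rfl
      map_smul' := fun r F => rfl }
  | n + 1 =>
    { toFun := fun F => consLift (multilinearLift n ∘ₗ F.curryLeft)
      map_add' := fun F G => by
        ext x
        induction x using cons_induction with
        | tmul b u =>
          have h : (F + G).curryLeft b = F.curryLeft b + G.curryLeft b := rfl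
          simp only [LinearMap.add_apply, consLift_cons, LinearMap.comp_apply, h, map_add]
        | add x y hx hy => simp only [map_add, hx, hy]
      map_smul' := fun r F => by
        ext x
        induction x using cons_induction with
        | tmul b u =>
          have h : (r • F).curryLeft b = r • F.curryLeft b := rfl
          simp only [LinearMap.smul_apply, consLift_cons, LinearMap.comp_apply, h, map_smul,
            RingHom.id_apply]
        | add x y hx hy => simp only [map_add, hx, hy] }

theorem multilinearLift_tprod (F : MultilinearMap k (fun _ : Fin (n + 1) => B) k)
    (b : Fin (n + 1) → B) : multilinearLift n F (tprod k n b) = F b := by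
  induction n with
  | zero => exact congrArg F (funext fun i => congrArg b (Fin.fin_one_eq_zero i).symm)
  | succ n ih =>
    refine (ih (F.curryLeft (b 0)) (Fin.tail b)).trans ?_
    rw [MultilinearMap.curryLeft_apply, Fin.cons_self_tail]

end Pure

/-! ### Construction of the trace and the trace property -/

section Algebra

variable {k : Type*} [Field k] {B : Type w} [Ring B] [Algebra k B] {m n : ℕ}

theorem mul_base_one (h : n + 0 = n) (u : TensorTower k B n) : mul h u (base 1) = u := by
  induction n with
  | zero =>
    induction u using base_induction with | base b =>
    rw [mul_base_base, mul_one]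
  | succ n ih =>
    induction u using cons_induction with
    | tmul b u => rw [mul_cons h (Nat.add_zero n), ih]
    | add x y hx hy => rw [map_add, LinearMap.add_apply, hx, hy]

/-- `(b₀ ⊗ ⋯ ⊗ bₙ) · E · b = b₀ ⊗ ⋯ ⊗ bₙ ⊗ b`. -/
theorem tprod_mul_mul (h : n + 1 = n + 1) (h' : n + 1 + 0 = n + 1) (a : Fin (n + 1) → B) (b : B) :
    mul h' (mul h (tprod k n a) (generator k B)) (base b) = tprod k (n + 1) (Fin.snoc a b) := by
  induction n with
  | zero =>
    rw [tprod_zero, base_mul_generator, mul_cons h' (Nat.add_zero 0), mul_base_base, one_mul]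
    rfl
  | succ n ih =>
    have h₁ : Fin.tail (Fin.snoc a b : Fin (n + 3) → B) = Fin.snoc (Fin.tail a) b := by
      funext i
      refine Fin.lastCases ?_ (fun i => ?_) i
      · simp [Fin.tail, Fin.succ_last]
      · simp [Fin.tail, ← Fin.castSucc_succ]
    rw [tprod_succ, mul_cons h rfl, mul_cons h' (Nat.add_zero _), ih, tprod_succ (n := n + 1), h₁]
    rfl

variable {C : Type*} [AddCommGroup C] [Module k C] [Coalgebra k C] (S : EntwiningStructure k B C)
  (K : EntwinedCochain k B C m)

/-- `b ⊗ c ↦ K (c, u b)`. -/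
def mulBaseForm : TensorTower k B m →ₗ[k] B ⊗[k] C →ₗ[k] k where
  toFun u := TensorProduct.lift
    ((multilinearLift m ∘ₗ K).flip ∘ₗ mul (Nat.add_zero m) u ∘ₗ base)
  map_add' u u' := TensorProduct.ext' fun b c => by simp
  map_smul' r u := TensorProduct.ext' fun b c => by simp

theorem mulBaseForm_tmul (u : TensorTower k B m) (b : B) (c : C) :
    mulBaseForm K u (b ⊗ₜ[k] c) = multilinearLift m (K c) (mul (Nat.add_zero m) u (base b)) := rfl

/-- `c ⊗ b₀ ⊗ ⋯ ⊗ bₘ₊₁ ↦ K (c^ψ, b₁, …, bₘ, bₘ₊₁ b_{0ψ})`. -/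
def trace : C ⊗[k] TensorTower k B (m + 1) →ₗ[k] k :=
  TensorProduct.lift
    { toFun := fun c => consLift (LinearMap.mk₂ k
        (fun b u => mulBaseForm K u (S.map (c ⊗ₜ[k] b)))
        (fun b b' u => by simp [TensorProduct.tmul_add]) (fun r b u => by simp)
        (fun b u u' => by simp) (fun r b u => by simp))
      map_add' := fun c c' => by
        ext x
        induction x using cons_induction with
        | tmul b u => simp [consLift_cons, TensorProduct.add_tmul]
        | add x y hx hy => simp only [map_add, hx, hy]
      map_smul' := fun r c => by
        ext x
        induction x using cons_induction with
        | tmul b u => simp [consLift_cons, ← TensorProduct.smul_tmul']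
        | add x y hx hy => simp only [map_add, hx, hy] }

theorem trace_cons (c : C) (b : B) (u : TensorTower k B m) :
    trace S K (c ⊗ₜ[k] cons b u) = mulBaseForm K u (S.map (c ⊗ₜ[k] b)) := rfl

/-- `r ⊗ c ↦ T (c ⊗ r' r)`. -/
def mulLeftForm {i j : ℕ} (T : C ⊗[k] TensorTower k B n →ₗ[k] k) (h : j + i = n)
    (r' : TensorTower k B j) : TensorTower k B i ⊗[k] C →ₗ[k] k :=
  T ∘ₗ LinearMap.lTensor C (mul h r') ∘ₗ (TensorProduct.comm k (TensorTower k B i) C).toLinearMap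

theorem mulLeftForm_tmul {i j : ℕ} (T : C ⊗[k] TensorTower k B n →ₗ[k] k) (h : j + i = n)
    (r' : TensorTower k B j) (r : TensorTower k B i) (c : C) :
    mulLeftForm T h r' (r ⊗ₜ[k] c) = T (c ⊗ₜ[k] mul h r' r) := rfl

/-- Both sides equal the value of `K` with the two entwined elements multiplied onto the end in the
same order. Only multiplicativity of `ψ` enters; `K` is arbitrary. -/
theorem trace_base_mul (h : 0 + (m + 1) = m + 1) (h' : m + 1 + 0 = m + 1) (c : C)
    (r : TensorTower k B 0) (r' : TensorTower k B (m + 1)) :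
    trace S K (c ⊗ₜ[k] mul h r r') =
      mulLeftForm (trace S K) h' r' (entwine S 0 (c ⊗ₜ[k] r)) := by
  induction r using base_induction with | base b =>
  induction r' using cons_induction with
  | tmul b' u =>
    rw [mul_base_cons, trace_cons, ← LinearMap.mul_apply' (R := k),
      entwineRespectsMul_iff.1 S.respects_mul, entwine_base]
    induction S.map (c ⊗ₜ[k] b) using TensorProduct.induction_on with
    | zero => simp
    | tmul b₁ c₁ =>
      rw [entwineStep_tmul, LinearMap.rTensor_tmul, mulLeftForm_tmul,
        mul_cons h' (Nat.add_zero m), trace_cons]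
      induction S.map (c₁ ⊗ₜ[k] b') using TensorProduct.induction_on with
      | zero => simp
      | tmul b₂ c₂ =>
        rw [LinearMap.rTensor_tmul, mulBaseForm_tmul, mulBaseForm_tmul, LinearMap.mul_apply',
          ← mul_base_base (k := k) (Nat.add_zero 0),
          TensorTower.mul_assoc (Nat.add_zero m) (Nat.add_zero 0)]
      | add x y hx hy => simp only [map_add, hx, hy]
    | add x y hx hy => simp only [map_add, hx, hy]
  | add x y hx hy =>
    rw [map_add, TensorProduct.tmul_add, map_add, hx, hy]
    induction entwine S 0 (c ⊗ₜ[k] base b) using TensorProduct.induction_on with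
    | zero => simp
    | tmul b₁ c₁ => simp only [mulLeftForm_tmul, map_add, LinearMap.add_apply,
        TensorProduct.tmul_add]
    | add x y hx hy =>
      simp only [map_add, ← hx, ← hy]
      abel

variable {K} in
-- In `u E` the final entry is `1`, so the first entry of `u`, once carried to the end, stands alone
-- there and `T` returns a rotation of `K`. The cyclicity of `K` enters the trace property through
-- this lemma.
theorem trace_mul_generator (hK : K ∈ S.cyclicCochains m) (h : m + 1 = m + 1) (c : C)
    (u : TensorTower k B m) :
    trace S K (c ⊗ₜ[k] mul h u (generator k B)) = (-1 : k) ^ m * multilinearLift m (K c) u := by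
  induction u using tprod_induction with
  | tprod a =>
    have hK' := LinearMap.congr_fun ((NonUnitalEntwining.mem_cyclicCochains_iff _ _).1 hK) c
    have hK'' := congrArg (fun F => F a) hK'
    change (-1 : k) ^ m * rotate S.map K c a = K c a at hK''
    rw [multilinearLift_tprod, ← hK'', ← mul_assoc, ← mul_pow, neg_one_mul, neg_neg, one_pow,
      one_mul, rotate_apply]
    cases m with
    | zero =>
      rw [tprod_zero, base_mul_generator, trace_cons]
      induction S.map (c ⊗ₜ[k] a 0) using TensorProduct.induction_on with
      | zero => simp
      | tmul b₁ c₁ =>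
        rw [mulBaseForm_tmul, mul_base_base, one_mul, insertLast_tmul, ← multilinearLift_tprod,
          tprod_zero]
        rfl
      | add x y hx hy => simp only [map_add, add_apply, hx, hy]
    | succ m =>
      rw [tprod_succ, mul_cons h rfl, trace_cons]
      induction S.map (c ⊗ₜ[k] a 0) using TensorProduct.induction_on with
      | zero => simp
      | tmul b₁ c₁ =>
        rw [mulBaseForm_tmul, tprod_mul_mul, multilinearLift_tprod, insertLast_tmul]
      | add x y hx hy => simp only [map_add, add_apply, hx, hy]
  | add x y hx hy =>
    simp only [map_add, LinearMap.add_apply, TensorProduct.tmul_add, hx, hy, mul_add]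

variable {K} in
/-- `T (c ⊗ r r') = (-1)^{ij} T (c^Ψ ⊗ r' r_Ψ)`. -/
theorem trace_mul (hK : K ∈ S.cyclicCochains m) {i j : ℕ} (h : i + j = m + 1)
    (h' : j + i = m + 1) (c : C) (r : TensorTower k B i) (r' : TensorTower k B j) :
    trace S K (c ⊗ₜ[k] mul h r r') =
      (-1 : k) ^ (i * j) * mulLeftForm (trace S K) h' r' (entwine S i (c ⊗ₜ[k] r)) := by
  induction i generalizing j c with
  | zero =>
    obtain rfl : j = m + 1 := by omega
    rw [zero_mul, pow_zero, one_mul, trace_base_mul]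
  | succ i ih =>
    have hij : i + j = m := by omega
    have hs : (-1 : k) ^ m * (-1 : k) ^ (i * (j + 1)) = (-1) ^ ((i + 1) * j) := by
      rw [← pow_add, show m + i * (j + 1) = 2 * i + (i + 1) * j by rw [← hij]; ring, pow_add,
        pow_mul]
      simp
    induction r using cons_induction with
    | tmul b u =>
      -- The leading entry `b` is an element of degree zero and can be moved to the end first. A
      -- leading `1 E` is left, on which `T` evaluates to `K` of the remainder.
      have hbu : cons b (mul hij u r') = mul (Nat.zero_add _) (base b) (cons 1 (mul hij u r')) := by
        rw [mul_base_cons, mul_one]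
      rw [mul_cons h hij, hbu, trace_base_mul S K _ (Nat.add_zero _), entwine_base, entwine_cons]
      induction S.map (c ⊗ₜ[k] b) using TensorProduct.induction_on with
      | zero => simp
      | tmul b₁ c₁ =>
        rw [LinearMap.rTensor_tmul, mulLeftForm_tmul, entwineStep_tmul,
          mul_cons _ (Nat.add_zero m), trace_cons, S.map_one, mulBaseForm_tmul, mul_base_one,
          TensorTower.mul_assoc (l := 0) hij (Nat.add_zero j) _ hij]
        -- The same value of `K` is, up to sign, `T` of the remainder followed by `E`. There `u`, of
        -- lower degree, stands in front, and the induction hypothesis moves it past `r' b₁ E`.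
        have hg := trace_mul_generator S hK rfl c₁ (mul hij u (mul (Nat.add_zero j) r' (base b₁)))
        rw [TensorTower.mul_assoc (l := 1) (jl := j + 1) hij rfl rfl
            (show i + (j + 1) = m + 1 by omega),
          TensorTower.mul_assoc (l := 1) (Nat.add_zero j) (Nat.zero_add 1) rfl rfl,
          base_mul_generator, ih _ (show j + 1 + i = m + 1 by omega)] at hg
        have hΨ : ∀ z : TensorTower k B i ⊗[k] C,
            mulLeftForm (trace S K) (show j + 1 + i = m + 1 by omega)
              (mul rfl r' (cons b₁ (base 1))) z =
            mulLeftForm (trace S K) h' r' (LinearMap.rTensor C (cons b₁) z) := by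
          intro z
          induction z using TensorProduct.induction_on with
          | zero => simp
          | tmul x d =>
            rw [LinearMap.rTensor_tmul, mulLeftForm_tmul, mulLeftForm_tmul,
              TensorTower.mul_assoc (jl := i + 1) rfl (add_comm 1 i) _ h',
              mul_cons (add_comm 1 i) (Nat.zero_add i), base_one_mul]
          | add x y hx hy => simp only [map_add, hx, hy]
        rw [hΨ] at hg
        rw [← hs, mul_assoc, hg, ← mul_assoc, ← mul_pow]
        simp
      | add x y hx hy => simp only [map_add, hx, hy, mul_add]
    | add x y hx hy =>
      simp only [map_add, LinearMap.add_apply, TensorProduct.tmul_add, hx, hy, mul_add]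

end Algebra

end TensorTower

end

noncomputable section

/-! ### The character of the trace defined by a cyclic cochain -/

namespace TensorTower

open EntwinedCochain

/-! ### Expansion of products of commutators with `F` -/

section Differential

variable {k : Type*} [Field k] {B : Type w} [Ring B] [Algebra k B] {m n : ℕ} (f g : B)

variable (k) in
/-- The element `f ⊗ g` of degree one. -/
def connection : TensorTower k B 1 := cons f (base g)

theorem connection_mul (h : 1 + n = n + 1) (h' : 0 + n = n) (u : TensorTower k B n) :
    mul h (connection k f g) u = cons f (mul h' (base g) u) := mul_cons h h' _ _ _

variable {f g} in
theorem connection_mul_connection (hgf : g * f = 0) :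
    mul (n := 2) rfl (connection k f g) (connection k f g) = 0 := by
  rw [connection_mul f g rfl (Nat.zero_add 1), connection, mul_base_cons, hgf]
  simp

variable (k) in
/-- `b₀ F b₁ F ⋯ F bₙ` with `F = f ⊗ g`. -/
def interleave : (n : ℕ) → (Fin (n + 1) → B) → TensorTower k B n
  | 0, b => base (b 0)
  | n + 1, b => cons (b 0 * f) (mul (Nat.zero_add n) (base g) (interleave n (Fin.tail b)))

theorem interleave_zero (b : Fin 1 → B) : interleave k f g 0 b = base (b 0) := rfl

theorem interleave_succ (b : Fin (n + 2) → B) :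
    interleave k f g (n + 1) b =
      cons (b 0 * f) (mul (Nat.zero_add n) (base g) (interleave k f g n (Fin.tail b))) := rfl

theorem interleave_eq_snoc (h : n + 1 = n + 1) (h' : n + 1 + 0 = n + 1) (b : Fin (n + 2) → B) :
    interleave k f g (n + 1) b =
      mul h' (mul h (interleave k f g n (Fin.init b)) (connection k f g))
        (base (b (Fin.last (n + 1)))) := by
  induction n with
  | zero =>
    rw [interleave_succ, interleave_zero, interleave_zero, connection, mul_base_cons,
      mul_cons _ (Nat.add_zero 0)]
    rfl
  | succ n ih =>
    rw [interleave_succ, ih rfl (Nat.add_zero _), interleave_succ, mul_cons _ rfl,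
      mul_cons _ (Nat.add_zero _), TensorTower.mul_assoc (Nat.zero_add n) rfl rfl (Nat.zero_add _),
      TensorTower.mul_assoc (Nat.zero_add _) (Nat.add_zero _) (Nat.add_zero _) (Nat.zero_add _)]
    rfl

theorem interleave_mul_base (h : n + 0 = n) (b : Fin (n + 1) → B) (y : B) :
    mul h (interleave k f g n b) (base y) =
      interleave k f g n (Function.update b (Fin.last n) (b (Fin.last n) * y)) := by
  induction n with
  | zero =>
    rw [interleave_zero, interleave_zero, mul_base_base]
    simp
  | succ n ih =>
    have h0 : Function.update b (Fin.last (n + 1)) (b (Fin.last (n + 1)) * y) 0 = b 0 :=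
      Function.update_of_ne (Fin.last_pos).ne _ _
    rw [interleave_succ, interleave_succ, mul_cons h (Nat.add_zero n),
      TensorTower.mul_assoc (Nat.zero_add n) (Nat.add_zero n) _ (Nat.zero_add n), ih, h0,
      ← Fin.succ_last, Fin.tail_update_succ]
    rfl

/-- `g · b₀ F b₁ F ⋯ F bₙ · f = g b₀ f ⊗ ⋯ ⊗ g bₙ f`. -/
theorem base_mul_interleave_mul (h : 0 + n = n) (h' : n + 0 = n) (b : Fin (n + 1) → B) :
    mul h' (mul h (base g) (interleave k f g n b)) (base f) = tprod k n fun i => g * b i * f := by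
  induction n with
  | zero => rw [interleave_zero, mul_base_base, mul_base_base]; rfl
  | succ n ih =>
    rw [interleave_succ, mul_base_cons, mul_cons h' (Nat.add_zero n), ih, tprod_succ, mul_assoc]
    rfl

variable {f g}

/-- `b₀ · D b₁ ⋯ D bₙ` for `b₀, …, bₙ ∈ B`. -/
def baseMulD (hgf : g * f = 0) (n : ℕ) (b : Fin (n + 1) → B) : TensorTower k B n :=
  (dga (connection k f g) (connection_mul_connection hgf)).mulD n fun i => base (k := k) (b i)

theorem baseMulD_succ (hgf : g * f = 0) (h : n + 0 = n) (b : Fin (n + 2) → B) :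
    baseMulD (k := k) hgf (n + 1) b =
      mul (Nat.add_zero _) (mul rfl (baseMulD hgf n (Fin.init b)) (connection k f g))
          (base (b (Fin.last (n + 1)))) -
        mul rfl (mul h (baseMulD hgf n (Fin.init b)) (base (b (Fin.last (n + 1)))))
          (connection k f g) := by
  change mul rfl (baseMulD hgf n (Fin.init b))
    (commutator (connection k f g) (Nat.zero_add 1) (base (b (Fin.last (n + 1))))) = _
  rw [commutator_apply _ _ (Nat.add_zero 1), pow_zero, one_smul, map_sub,
    ← TensorTower.mul_assoc rfl (Nat.add_zero 1) (Nat.add_zero _) rfl,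
    ← TensorTower.mul_assoc (Nat.add_zero n) (Nat.zero_add 1) rfl rfl]

theorem baseMulD_mul (hgf : g * f = 0) (h : n + 0 = n) (b : Fin (n + 2) → B) :
    mul h (baseMulD (k := k) hgf n (Fin.init b)) (base (b (Fin.last (n + 1)))) =
      ∑ j : Fin (n + 1), (-1 : k) ^ (n - (j : ℕ)) •
        baseMulD hgf n (Fin.contractNth j.castSucc (· * ·) b) := by
  refine ((dga (connection k f g) (connection_mul_connection hgf)).mulD_mul
    fun i => base (k := k) (b i)).trans (Finset.sum_congr rfl fun j _ => ?_)
  have h : Fin.contractNth j.castSucc (fun x y => mul (Nat.add_zero 0) x y)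
      (fun i => base (k := k) (b i)) =
      fun i => base (Fin.contractNth j.castSucc (· * ·) b i) := by
    funext i
    simp only [Fin.contractNth]
    split_ifs <;> rfl
  exact congrArg (fun x => (-1 : k) ^ (n - (j : ℕ)) •
    (dga (connection k f g) (connection_mul_connection hgf)).mulD n x) h

/-- In `(F b - b F) F` the second term vanishes as `F² = 0`. Working from the right, every
commutator followed by `F` loses its second term. -/
theorem baseMulD_mul_connection (hgf : g * f = 0) (b : Fin (n + 1) → B) :
    mul (n := n + 1) rfl (baseMulD (k := k) hgf n b) (connection k f g) =
      mul rfl (interleave k f g n b) (connection k f g) := by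
  induction n with
  | zero => rfl
  | succ n ih =>
    rw [baseMulD_succ hgf (Nat.add_zero n), ih, map_sub, LinearMap.sub_apply,
      TensorTower.mul_assoc (j := 1) (l := 1) (jl := 2) rfl rfl rfl rfl,
      connection_mul_connection hgf, map_zero, sub_zero, ← interleave_eq_snoc]

/-- Expand the last commutator. Its first term is alternating in `F` by the preceding reduction. In
the second, `baseMulD_mul` absorbs the last element into products of neighbours before the factor
`F`, to which the reduction applies again. -/
theorem baseMulD_eq (hgf : g * f = 0) (b : Fin (n + 2) → B) :
    baseMulD (k := k) hgf (n + 1) b =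
      interleave k f g (n + 1) b + ∑ j : Fin (n + 1), (-1 : k) ^ (n - (j : ℕ) + 1) •
        mul rfl (interleave k f g n (Fin.contractNth j.castSucc (· * ·) b)) (connection k f g) := by
  rw [baseMulD_succ hgf (Nat.add_zero n), baseMulD_mul_connection, ← interleave_eq_snoc,
    baseMulD_mul, sub_eq_add_neg, map_sum, LinearMap.sum_apply, ← Finset.sum_neg_distrib]
  congr 1
  refine Finset.sum_congr rfl fun j _ => ?_
  rw [map_smul, LinearMap.smul_apply, baseMulD_mul_connection, pow_succ, mul_neg_one, neg_smul]

end Differential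

/-! ### The trace evaluated on products of commutators -/

section Character

variable {k : Type*} [Field k] {B : Type w} [Ring B] [Algebra k B] {m : ℕ} {f g : B}
  {C : Type*} [AddCommGroup C] [Module k C] [Coalgebra k C] {S : EntwiningStructure k B C}
  {K : EntwinedCochain k B C m}

theorem entwine_connection (hf : ∀ c, S.map (c ⊗ₜ[k] f) = f ⊗ₜ[k] c)
    (hg : ∀ c, S.map (c ⊗ₜ[k] g) = g ⊗ₜ[k] c) (c : C) :
    entwine S 1 (c ⊗ₜ[k] connection k f g) = connection k f g ⊗ₜ[k] c := by
  rw [connection, entwine_cons, hf, entwineStep_tmul, entwine_base, hg]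
  rfl

theorem trace_connection_mul (hK : K ∈ S.cyclicCochains m)
    {F : TensorTower k B 1} (hF : ∀ c, entwine S 1 (c ⊗ₜ[k] F) = F ⊗ₜ[k] c) (h : m + 1 = m + 1)
    (h' : 1 + m = m + 1) (c : C) (x : TensorTower k B m) :
    trace S K (c ⊗ₜ[k] mul h' F x) = (-1 : k) ^ m * trace S K (c ⊗ₜ[k] mul h x F) := by
  rw [trace_mul S hK h' h, hF, one_mul, mulLeftForm_tmul]

theorem trace_commutator (hK : K ∈ S.cyclicCochains m)
    {F : TensorTower k B 1} (hF : ∀ c, entwine S 1 (c ⊗ₜ[k] F) = F ⊗ₜ[k] c) (h : m + 1 = m + 1)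
    (c : C) (x : TensorTower k B m) : trace S K (c ⊗ₜ[k] commutator F h x) = 0 := by
  rw [commutator_apply F h (add_comm 1 m), TensorProduct.tmul_sub, map_sub,
    TensorProduct.tmul_smul, map_smul, trace_connection_mul hK hF h, smul_eq_mul, sub_self]

variable (k f g) in
/-- `b ↦ g b f`. -/
def compression : B →ₗ[k] B := LinearMap.mulLeftRight k (g, f)

/-- The factor `f` standing behind `b₀` is invariant and travels with it to the end, so the last
entry becomes `g b f` with `b` the product of the last variable and the entwined first one: the
cyclic face. -/
theorem trace_interleave (hf : ∀ c, S.map (c ⊗ₜ[k] f) = f ⊗ₜ[k] c) (c : C)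
    (b : Fin (m + 2) → B) :
    trace S K (c ⊗ₜ[k] interleave k f g (m + 1) b) =
      (pullback (fun _ => compression k f g) K).mulLast (S.map (c ⊗ₜ[k] b 0)) (Fin.tail b) := by
  have h := S.respects_mul.equivariant_right hf c (b 0)
  rw [LinearMap.flip_apply, LinearMap.mul_apply'] at h
  rw [interleave_succ, trace_cons, h]
  induction S.map (c ⊗ₜ[k] b 0) using TensorProduct.induction_on with
  | zero => simp
  | tmul b₁ c₁ =>
    rw [LinearMap.rTensor_tmul, mulBaseForm_tmul, mulLast_tmul, pullback_apply,
      LinearMap.flip_apply, LinearMap.mul_apply', ← mul_base_base (k := k) (Nat.add_zero 0),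
      ← TensorTower.mul_assoc (Nat.add_zero m) (Nat.add_zero 0) (Nat.add_zero m),
      TensorTower.mul_assoc (Nat.zero_add m) (Nat.add_zero m) (Nat.add_zero m) (Nat.zero_add m),
      interleave_mul_base, base_mul_interleave_mul, multilinearLift_tprod]
    rfl
  | add x y hx hy => simp only [map_add, add_apply, hx, hy]

theorem trace_connection_mul_interleave (hf : ∀ c, S.map (c ⊗ₜ[k] f) = f ⊗ₜ[k] c)
    (h : 1 + m = m + 1) (c : C) (b : Fin (m + 1) → B) :
    trace S K (c ⊗ₜ[k] mul h (connection k f g) (interleave k f g m b)) =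
      pullback (fun _ => compression k f g) K c b := by
  rw [connection_mul f g h (Nat.zero_add m), trace_cons, hf, mulBaseForm_tmul,
    base_mul_interleave_mul, multilinearLift_tprod]
  rfl

/-- The character of the trace defined by a cyclic cochain is a Hochschild coboundary. -/
theorem trace_baseMulD (hgf : g * f = 0) (hf : ∀ c, S.map (c ⊗ₜ[k] f) = f ⊗ₜ[k] c)
    (hg : ∀ c, S.map (c ⊗ₜ[k] g) = g ⊗ₜ[k] c) (hK : K ∈ S.cyclicCochains m)
    (c : C) (b : Fin (m + 2) → B) :
    trace S K (c ⊗ₜ[k] baseMulD hgf (m + 1) b) =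
      hochschildD S.map m (pullback (fun _ => compression k f g) K) c b := by
  rw [baseMulD_eq, hochschildD_apply, TensorProduct.tmul_add, map_add, trace_interleave hf,
    TensorProduct.tmul_sum, map_sum]
  congr 1
  refine Finset.sum_congr rfl fun j _ => ?_
  have hj := j.isLt
  have hs : (-1 : k) ^ (m - (j : ℕ) + 1) = (-1) ^ ((j : ℕ) + 1) * (-1) ^ m := by
    rw [← pow_add, show (j : ℕ) + 1 + m = 2 * j + (m - j + 1) by omega, pow_add _ (2 * (j : ℕ)),
      pow_mul]
    simp
  -- Moving `F` from the back to the front costs `(-1)^m`, which turns the sign of each summand into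
  -- that of the Hochschild differential.
  rw [TensorProduct.tmul_smul, map_smul, smul_eq_mul, hs, mul_assoc,
    ← trace_connection_mul hK (entwine_connection hf hg) rfl (add_comm 1 m),
    trace_connection_mul_interleave hf]

end Character

end TensorTower

end

noncomputable section

/-! ### Algebras satisfying the vanishing condition -/

section Vanishing

variable {k : Type*} [Field k] {B : Type*} [Ring B] [Algebra k B]
  {C : Type*} [AddCommGroup C] [Module k C] [Coalgebra k C]

theorem NonUnitalEntwining.matrixMap_tmul_of_invariant (S : NonUnitalEntwining k B C) {r : ℕ}
    {X : Matrix (Fin r) (Fin r) B}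
    (hX : ∀ (c : C) (i j : Fin r), S.map (c ⊗ₜ[k] X i j) = X i j ⊗ₜ[k] c) (c : C) :
    S.matrixMap r (c ⊗ₜ[k] X) = X ⊗ₜ[k] c := by
  have h : ∀ i j : Fin r, (LinearMap.rTensor C (Matrix.singleLinearMap k i j) ∘ₗ S.map ∘ₗ
      LinearMap.lTensor C (Matrix.entryLinearMap k B i j)) (c ⊗ₜ[k] X) =
      Matrix.single i j (X i j) ⊗ₜ[k] c := by
    intro i j
    change LinearMap.rTensor C (Matrix.singleLinearMap k i j) (S.map (c ⊗ₜ[k] X i j)) = _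
    rw [hX]
    rfl
  simp only [NonUnitalEntwining.matrixMap, LinearMap.sum_apply, h, ← TensorProduct.sum_tmul]
  rw [← Matrix.matrix_eq_sum_single]

/-- The invariant elements of an entwining structure. -/
def EntwiningStructure.invariants (S : EntwiningStructure k B C) : Subalgebra k B where
  carrier := {b | ∀ c : C, S.map (c ⊗ₜ[k] b) = b ⊗ₜ[k] c}
  mul_mem' {a b} ha hb c := by
    have := S.respects_mul.equivariant_left ha c b
    rw [LinearMap.mul_apply'] at this
    rw [this, hb]
    rfl
  add_mem' {a b} ha hb c := by
    rw [TensorProduct.tmul_add, map_add, ha, hb, TensorProduct.add_tmul]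
  algebraMap_mem' r c := by
    rw [Algebra.algebraMap_eq_smul_one, TensorProduct.tmul_smul, map_smul, S.map_one,
      TensorProduct.smul_tmul']

/-- An algebra containing an invariant copy of the Cuntz algebra with two generators, and an
endomorphism `N` with `N b = i₁ b p₁ + i₂ N(b) p₂`, satisfies the vanishing condition. -/
theorem EntwiningStructure.satisfiesVanishing_of_cuntz (S : EntwiningStructure k B C)
    {i₁ i₂ p₁ p₂ : B} (hi₁ : i₁ ∈ S.invariants) (hi₂ : i₂ ∈ S.invariants)
    (hp₁ : p₁ ∈ S.invariants) (hp₂ : p₂ ∈ S.invariants)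
    (h₁₁ : p₁ * i₁ = 1) (h₁₂ : p₁ * i₂ = 0) (h₂₁ : p₂ * i₁ = 0) (h₂₂ : p₂ * i₂ = 1)
    (hsum : i₁ * p₁ + i₂ * p₂ = 1) (N : B →ₐ[k] B) (hN : EntwineEquivariant S.map S.map N.toLinearMap)
    (hNsum : ∀ b, N b = i₁ * b * p₁ + i₂ * N b * p₂) :
    S.SatisfiesVanishing := by
  have a₁₁ : ∀ x, p₁ * (i₁ * x) = x := fun x => by rw [← mul_assoc, h₁₁, one_mul]
  have a₁₂ : ∀ x, p₁ * (i₂ * x) = 0 := fun x => by rw [← mul_assoc, h₁₂, zero_mul]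
  have a₂₁ : ∀ x, p₂ * (i₁ * x) = 0 := fun x => by rw [← mul_assoc, h₂₁, zero_mul]
  have a₂₂ : ∀ x, p₂ * (i₂ * x) = x := fun x => by rw [← mul_assoc, h₂₂, one_mul]
  have key : ∀ x, i₁ * (p₁ * x) + i₂ * (p₂ * x) = x := fun x => by
    rw [← mul_assoc, ← mul_assoc, ← add_mul, hsum, one_mul]
  let ν : B →ₙₐ[k] B :=
    { toFun := fun b => i₂ * N b * p₂
      map_smul' := fun r b => by simp
      map_zero' := by simp
      map_add' := fun b b' => by simp [mul_add, add_mul]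
      map_mul' := fun b b' => by simp [mul_assoc, a₂₂] }
  have hν : EntwineEquivariant S.map S.map (ν : B →ₗ[k] B) := by
    have h : (ν : B →ₗ[k] B) = (LinearMap.mul k B).flip p₂ ∘ₗ LinearMap.mul k B i₂ ∘ₗ
        N.toLinearMap := rfl
    rw [h]
    exact (S.respects_mul.equivariant_right hp₂).comp
      ((S.respects_mul.equivariant_left hi₂).comp hN)
  have hν' : ∀ b, ν b = i₂ * N b * p₂ := fun b => rfl
  -- View the second coordinate as split by `p₁, p₂`: `ν(a)` is zero on the first piece and `N a = a
  -- ⊕ N a` on the second. `X` sends the first coordinate, where `a` acts, to the `a`-piece of `N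
  -- a`, and the old `N a`-piece to the new one. The null piece is divided between the first
  -- coordinate and the new null piece.
  refine ⟨1, fun a => ⟨one_mul a, mul_one a⟩, S.map_one, ν,
    !![0, p₁ * p₁; i₂ * i₁, i₁ * p₂ * p₁ + i₂ * i₂ * p₂],
    !![0, p₁ * p₂; i₁ * i₁, i₁ * i₂ * p₁ + i₂ * p₂ * p₂], hν.comp_eq, ?_, ?_, ?_, ?_⟩
  · rw [Matrix.mul_fin_two]
    simp only [mul_add, add_mul, mul_assoc, a₁₁, a₁₂, a₂₁, a₂₂, h₁₁, h₂₁, mul_zero, zero_mul, add_zero,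
      zero_add]
    refine congrArg (fun x : B => !![1, 0; 0, x]) ?_
    have h := congrArg (i₂ * ·) (key p₂)
    simp only [mul_add] at h
    rw [← hsum, ← h]
    abel
  · rw [Matrix.mul_fin_two]
    simp only [mul_add, add_mul, mul_assoc, a₁₁, a₁₂, a₂₁, a₂₂, h₁₁, h₂₁, mul_zero, zero_mul, add_zero,
      zero_add]
    refine congrArg (fun x : B => !![1, 0; 0, x]) ?_
    have h := congrArg (i₁ * ·) (key p₁)
    simp only [mul_add] at h
    rw [← hsum, ← h]
    abel
  · refine S.matrixMap_tmul_of_invariant fun c i j => ?_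
    revert c
    change _ ∈ S.invariants
    fin_cases i <;> fin_cases j
    · exact S.invariants.zero_mem
    · exact S.invariants.mul_mem hp₁ hp₁
    · exact S.invariants.mul_mem hi₂ hi₁
    · exact S.invariants.add_mem (S.invariants.mul_mem (S.invariants.mul_mem hi₁ hp₂) hp₁)
        (S.invariants.mul_mem (S.invariants.mul_mem hi₂ hi₂) hp₂)
  · intro a
    rw [Matrix.mul_fin_two, Matrix.mul_fin_two, hν']
    simp only [mul_add, add_mul, mul_assoc, a₁₂, a₂₁, a₂₂, mul_zero, zero_mul, add_zero, zero_add]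
    refine congrArg (fun x : B => !![0, 0; 0, x]) ?_
    conv_rhs => rw [hNsum a]
    simp only [mul_add, add_mul, mul_assoc]

end Vanishing

/-! ### The Cuntz algebra acting on a space isomorphic to its countable power -/

section Sequence

variable {k : Type*} [Field k] {V : Type*} [AddCommGroup V] [Module k V] (σ : V ≃ₗ[k] ℕ → V)

namespace LinearEquiv

/-- `v ↦ (v, 0, 0, …)`. -/
def seqSingle : Module.End k V := σ.symm.toLinearMap ∘ₗ LinearMap.single k (fun _ : ℕ => V) 0

/-- `(v₀, v₁, …) ↦ (0, v₀, v₁, …)`. -/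
def seqShift : Module.End k V :=
  σ.symm.toLinearMap ∘ₗ (LinearMap.pi fun n : ℕ => Nat.casesOn n 0 LinearMap.proj) ∘ₗ σ.toLinearMap

/-- `(v₀, v₁, …) ↦ v₀`. -/
def seqHead : Module.End k V := LinearMap.proj 0 ∘ₗ σ.toLinearMap

/-- `(v₀, v₁, …) ↦ (v₁, v₂, …)`. -/
def seqTail : Module.End k V :=
  σ.symm.toLinearMap ∘ₗ LinearMap.funLeft k V Nat.succ ∘ₗ σ.toLinearMap

variable {σ}

theorem apply_seqSingle_zero (v : V) : σ (σ.seqSingle v) 0 = v := by simp [seqSingle]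

theorem apply_seqSingle_succ (v : V) (n : ℕ) : σ (σ.seqSingle v) (n + 1) = 0 := by
  simp [seqSingle]

theorem apply_seqShift_zero (v : V) : σ (σ.seqShift v) 0 = 0 := by simp [seqShift]

theorem apply_seqShift_succ (v : V) (n : ℕ) : σ (σ.seqShift v) (n + 1) = σ v n := by
  simp [seqShift]

theorem seqHead_apply (v : V) : σ.seqHead v = σ v 0 := rfl

theorem apply_seqTail (v : V) (n : ℕ) : σ (σ.seqTail v) n = σ v (n + 1) := by
  simp [seqTail, LinearMap.funLeft_apply]

variable (σ) in
/-- `r ↦ ((v₀, v₁, …) ↦ (r v₀, r v₁, …))` as a map. -/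
def seqMapFun (r : Module.End k V) : Module.End k V :=
  σ.symm.toLinearMap ∘ₗ r.compLeft ℕ ∘ₗ σ.toLinearMap

theorem apply_seqMapFun (r : Module.End k V) (v : V) (n : ℕ) :
    σ (σ.seqMapFun r v) n = r (σ v n) := by
  simp [seqMapFun]

theorem end_ext_apply {r s : Module.End k V} (h : ∀ v n, σ (r v) n = σ (s v) n) : r = s :=
  LinearMap.ext fun v => σ.injective (funext (h v))

variable (σ) in
/-- `r ↦ ((v₀, v₁, …) ↦ (r v₀, r v₁, …))`. -/
def seqMap : Module.End k V →ₐ[k] Module.End k V where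
  toFun := σ.seqMapFun
  map_one' := end_ext_apply (σ := σ) fun v n => by simp [apply_seqMapFun]
  map_mul' r s := end_ext_apply (σ := σ) fun v n => by simp [apply_seqMapFun]
  map_zero' := end_ext_apply (σ := σ) fun v n => by simp [apply_seqMapFun]
  map_add' r s := end_ext_apply (σ := σ) fun v n => by simp [apply_seqMapFun]
  commutes' a := end_ext_apply (σ := σ) fun v n => by simp [apply_seqMapFun]

theorem apply_seqMap (r : Module.End k V) (v : V) (n : ℕ) :
    σ (σ.seqMap r v) n = r (σ v n) := apply_seqMapFun r v n

theorem seqHead_mul_seqSingle : σ.seqHead * σ.seqSingle = 1 :=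
  LinearMap.ext fun v => apply_seqSingle_zero v

theorem seqHead_mul_seqShift : σ.seqHead * σ.seqShift = 0 :=
  LinearMap.ext fun v => apply_seqShift_zero v

theorem seqTail_mul_seqSingle : σ.seqTail * σ.seqSingle = 0 :=
  end_ext_apply (σ := σ) fun v n => by
    simp [Module.End.mul_apply, apply_seqTail, apply_seqSingle_succ]

theorem seqTail_mul_seqShift : σ.seqTail * σ.seqShift = 1 :=
  end_ext_apply (σ := σ) fun v n => by
    simp [Module.End.mul_apply, apply_seqTail, apply_seqShift_succ]

theorem seqSingle_mul_seqHead_add : σ.seqSingle * σ.seqHead + σ.seqShift * σ.seqTail = 1 :=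
  end_ext_apply (σ := σ) fun v n => by
    cases n <;> simp [apply_seqSingle_zero, apply_seqSingle_succ, apply_seqShift_zero,
      apply_seqShift_succ, apply_seqTail, seqHead_apply]

/-- Removing the first entry from a sequence on which `r` acts everywhere leaves such a sequence:
the swindle behind the vanishing condition. -/
theorem seqMap_eq (r : Module.End k V) :
    σ.seqMap r = σ.seqSingle * r * σ.seqHead + σ.seqShift * σ.seqMap r * σ.seqTail :=
  end_ext_apply (σ := σ) fun v n => by
    cases n <;> simp [apply_seqSingle_zero, apply_seqSingle_succ, apply_seqShift_zero,
      apply_seqShift_succ, apply_seqTail, seqHead_apply, apply_seqMap]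

end LinearEquiv

end Sequence

end

noncomputable section

/-! ### Extension of scalars of an entwining structure -/

namespace EntwiningStructure

variable {k : Type*} [Field k] (D : Type*) [Ring D] [Algebra k D] {A : Type*} [Ring A] [Algebra k A]
  {C : Type*} [AddCommGroup C] [Module k C] [Coalgebra k C] (S : EntwiningStructure k A C)

/-- The map `c ⊗ d ⊗ a ↦ d ⊗ a_ψ ⊗ c^ψ`. -/
def extendMap : C ⊗[k] (D ⊗[k] A) →ₗ[k] (D ⊗[k] A) ⊗[k] C :=
  tensorEntwine (TensorProduct.comm k C D).toLinearMap S.map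

theorem extendMap_tmul (c : C) (d : D) (a : A) :
    S.extendMap D (c ⊗ₜ[k] (d ⊗ₜ[k] a)) =
      LinearMap.rTensor C (TensorProduct.mk k D A d) (S.map (c ⊗ₜ[k] a)) := by
  rw [extendMap, tensorEntwine_tmul, LinearEquiv.coe_coe, TensorProduct.comm_tmul, entwineStep_tmul]

theorem extendMap_respectsMul : EntwineRespectsMul (LinearMap.mul k (D ⊗[k] A))
    (S.extendMap D) (S.extendMap D) (S.extendMap D) := by
  rw [entwineRespectsMul_iff]
  intro c x y
  induction x using TensorProduct.induction_on with
  | zero => simp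
  | tmul d a =>
    induction y using TensorProduct.induction_on with
    | zero => simp [entwineStep_zero]
    | tmul d' a' =>
      have h := entwineRespectsMul_iff.1 S.respects_mul c a a'
      rw [LinearMap.mul_apply'] at h
      rw [LinearMap.mul_apply', Algebra.TensorProduct.tmul_mul_tmul, extendMap_tmul,
        extendMap_tmul, h]
      induction S.map (c ⊗ₜ[k] a) using TensorProduct.induction_on with
      | zero => simp
      | tmul a₁ c₁ =>
        rw [LinearMap.rTensor_tmul, entwineStep_tmul, entwineStep_tmul, extendMap_tmul]
        induction S.map (c₁ ⊗ₜ[k] a') using TensorProduct.induction_on with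
        | zero => simp
        | tmul a₂ c₂ => simp
        | add x y hx hy => simp only [map_add, hx, hy]
      | add x y hx hy => simp only [map_add, hx, hy]
    | add x y hx hy =>
      rw [map_add, TensorProduct.tmul_add, map_add, hx, hy, entwineStep_add]
      rfl
  | add x y hx hy =>
    simp only [map_add, LinearMap.add_apply, TensorProduct.tmul_add, hx, hy]

/-- The entwining structure `(D ⊗ A, C, id ⊗ ψ)`. -/
def extend : EntwiningStructure k (D ⊗[k] A) C where
  map := S.extendMap D
  respects_mul := S.extendMap_respectsMul D
  respects_comul := EntwineRespectsComul.comm.tensor S.respects_comul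
  respects_counit := EntwineRespectsCounit.comm.tensor S.respects_counit
  map_one c := by
    rw [Algebra.TensorProduct.one_def, extendMap_tmul, S.map_one]
    rfl

variable {D}

theorem extend_map_tmul (c : C) (d : D) (a : A) :
    (S.extend D).map (c ⊗ₜ[k] (d ⊗ₜ[k] a)) =
      LinearMap.rTensor C (TensorProduct.mk k D A d) (S.map (c ⊗ₜ[k] a)) :=
  S.extendMap_tmul D c d a

theorem tmul_one_mem_invariants (d : D) : d ⊗ₜ[k] (1 : A) ∈ (S.extend D).invariants := by
  intro c
  rw [extend_map_tmul, S.map_one]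
  rfl

theorem equivariant_mk (d : D) :
    EntwineEquivariant S.map (S.extend D).map (TensorProduct.mk k D A d) :=
  fun c a => S.extend_map_tmul c d a

theorem equivariant_rTensor (f : D →ₗ[k] D) :
    EntwineEquivariant (S.extend D).map (S.extend D).map (LinearMap.rTensor A f) := by
  intro c x
  induction x using TensorProduct.induction_on with
  | zero => simp
  | tmul d a =>
    have h : TensorProduct.mk k D A (f d) = LinearMap.rTensor A f ∘ₗ TensorProduct.mk k D A d := rfl
    rw [LinearMap.rTensor_tmul, extend_map_tmul, extend_map_tmul, h, LinearMap.rTensor_comp,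
      LinearMap.comp_apply]
  | add x y hx hy => simp only [map_add, TensorProduct.tmul_add, hx, hy]

/-- `d ⊗ a ↦ φ(d) a`. -/
def contractScalar (A : Type*) [Ring A] [Algebra k A] (φ : D →ₗ[k] k) : D ⊗[k] A →ₗ[k] A :=
  TensorProduct.lift (LinearMap.lsmul k A ∘ₗ φ)

theorem contractScalar_tmul (φ : D →ₗ[k] k) (d : D) (a : A) :
    contractScalar A φ (d ⊗ₜ[k] a) = φ d • a := rfl

theorem equivariant_contractScalar (φ : D →ₗ[k] k) :
    EntwineEquivariant (S.extend D).map S.map (contractScalar A φ) := by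
  intro c x
  induction x using TensorProduct.induction_on with
  | zero => simp
  | tmul d a =>
    rw [contractScalar_tmul, TensorProduct.tmul_smul, map_smul, extend_map_tmul,
      ← LinearMap.comp_apply, ← LinearMap.rTensor_comp]
    have h : contractScalar A φ ∘ₗ TensorProduct.mk k D A d = φ d • LinearMap.id := rfl
    rw [h, LinearMap.rTensor_smul, LinearMap.smul_apply, LinearMap.rTensor_id_apply]
  | add x y hx hy => simp only [map_add, TensorProduct.tmul_add, hx, hy]

/-- The Cuntz elements and the endomorphism live in the factor `End(V)`, which is entwined by the
flip, so invariance and equivariance are automatic. -/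
theorem extend_satisfiesVanishing {V : Type*} [AddCommGroup V] [Module k V] (σ : V ≃ₗ[k] ℕ → V) :
    (S.extend (Module.End k V)).SatisfiesVanishing := by
  refine satisfiesVanishing_of_cuntz _ (S.tmul_one_mem_invariants σ.seqSingle)
    (S.tmul_one_mem_invariants σ.seqShift) (S.tmul_one_mem_invariants σ.seqHead)
    (S.tmul_one_mem_invariants σ.seqTail) ?_ ?_ ?_ ?_ ?_
    (Algebra.TensorProduct.map σ.seqMap (AlgHom.id k A)) (S.equivariant_rTensor σ.seqMap.toLinearMap)
    fun b => ?_
  · rw [Algebra.TensorProduct.tmul_mul_tmul, LinearEquiv.seqHead_mul_seqSingle, one_mul]; rfl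
  · rw [Algebra.TensorProduct.tmul_mul_tmul, LinearEquiv.seqHead_mul_seqShift,
      TensorProduct.zero_tmul]
  · rw [Algebra.TensorProduct.tmul_mul_tmul, LinearEquiv.seqTail_mul_seqSingle,
      TensorProduct.zero_tmul]
  · rw [Algebra.TensorProduct.tmul_mul_tmul, LinearEquiv.seqTail_mul_seqShift, one_mul]; rfl
  · rw [Algebra.TensorProduct.tmul_mul_tmul, Algebra.TensorProduct.tmul_mul_tmul, one_mul,
      ← TensorProduct.add_tmul, LinearEquiv.seqSingle_mul_seqHead_add]
    rfl
  · induction b using TensorProduct.induction_on with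
    | zero => simp
    | tmul r a =>
      simp only [Algebra.TensorProduct.map_tmul, Algebra.TensorProduct.tmul_mul_tmul, one_mul,
        mul_one, AlgHom.id_apply]
      rw [← TensorProduct.add_tmul, ← LinearEquiv.seqMap_eq]
    | add x y hx hy =>
      rw [map_add, mul_add, add_mul, mul_add, add_mul]
      nth_rewrite 1 [hx, hy]
      abel

end EntwiningStructure

/-! ### Coboundaries are characters of vanishing cycles -/

/-- An algebra morphism to the component of degree zero of a dg-algebra. -/
def NonUnitalDGA.degreeZeroHom {k : Type*} [Field k] (R : NonUnitalDGA.{w} k) {A : Type*} [Ring A]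
    [Algebra k A] (ρ : A →ₗ[k] R.obj 0)
    (h : ∀ a b, ρ (a * b) = R.mul (Nat.add_zero 0) (ρ a) (ρ b)) : A →ₙₐ[k] R.obj 0 :=
  { ρ with
    map_zero' := map_zero ρ
    map_mul' := h }

/-! ### Cycles over an algebra satisfying the vanishing condition -/

namespace TensorTower

open EntwinedCochain

variable {k : Type*} [Field k] {A : Type u} [Ring A] [Algebra k A]
  {C : Type v} [AddCommGroup C] [Module k C] [Coalgebra k C] (S : EntwiningStructure k A C)
  {B : Type w} [Ring B] [Algebra k B] {SB : EntwiningStructure k B C}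

/-- The entwined cycle attached to a closed graded trace on the free product. -/
def cycle {f g : B} (hgf : g * f = 0) (hf : f ∈ SB.invariants) (hg : g ∈ SB.invariants)
    (ρ : A →ₙₐ[k] B) (hρ : EntwineEquivariant S.map SB.map (ρ : A →ₗ[k] B)) (n : ℕ)
    (T : C ⊗[k] TensorTower k B n →ₗ[k] k)
    (hTd : ∀ {i : ℕ} (h : i + 1 = n) (c : C) (r : TensorTower k B i),
      T (c ⊗ₜ[k] commutator (connection k f g) h r) = 0)
    (hT : ∀ {i j : ℕ} (h : i + j = n) (h' : j + i = n) (c : C) (r : TensorTower k B i)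
      (r' : TensorTower k B j), T (c ⊗ₜ[k] mul h r r') =
        (-1 : k) ^ (i * j) * mulLeftForm T h' r' (entwine SB i (c ⊗ₜ[k] r))) :
    EntwinedCycle.{u, v, w} S n where
  R := dga (connection k f g) (connection_mul_connection hgf)
  Ψ := dgEntwining SB (connection k f g) (connection_mul_connection hgf) (entwine_connection hf hg)
  ρ := NonUnitalDGA.degreeZeroHom _ (base ∘ₗ (ρ : A →ₗ[k] B))
    fun a b => congrArg (base (k := k)) (map_mul ρ a b)
  ρ_comm := hρ.comp_eq
  T := T
  T_closed := hTd
  T_trace := hT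

variable {S} in
theorem cycle_isVanishing {f g : B} (hgf : g * f = 0) (hf : f ∈ SB.invariants)
    (hg : g ∈ SB.invariants) (ρ : A →ₙₐ[k] B)
    (hρ : EntwineEquivariant S.map SB.map (ρ : A →ₗ[k] B)) {n : ℕ}
    (T : C ⊗[k] TensorTower k B n →ₗ[k] k) (hTd) (hT) (h : SB.SatisfiesVanishing) :
    (cycle S hgf hf hg ρ hρ n T hTd hT).IsVanishing := h

/-- The zero trace on the zero differential is used. It covers dimension zero, where the only
coboundary is zero. -/
theorem zero_exists_cycle (hS : SB.SatisfiesVanishing) (ρ : A →ₙₐ[k] B)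
    (hρ : EntwineEquivariant S.map SB.map (ρ : A →ₗ[k] B)) (n : ℕ) :
    ∃ Z : EntwinedCycle.{u, v, w} S n, Z.IsVanishing ∧ Z.HasCharacter 0 :=
  ⟨cycle S (mul_zero 0) (zero_mem _) (zero_mem _) ρ hρ n 0 (fun _ _ _ => rfl)
    (fun _ _ _ _ _ => (mul_zero _).symm), cycle_isVanishing _ _ _ _ _ _ _ _ hS, fun _ _ => rfl⟩

/-- If `ρ : A → B` is an equivariant algebra morphism with equivariant retraction of the form
`b ↦ θ (g b f)`, then every cyclic coboundary is the character of a cycle over `B`. -/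
theorem hochschildD_exists_cycle (hS : SB.SatisfiesVanishing) {f g : B} (hgf : g * f = 0)
    (hf : f ∈ SB.invariants) (hg : g ∈ SB.invariants) (ρ : A →ₙₐ[k] B)
    (hρ : EntwineEquivariant S.map SB.map (ρ : A →ₗ[k] B)) (θ : B →ₗ[k] A)
    (hθ : EntwineEquivariant SB.map S.map θ) (hθρ : ∀ a, θ (g * ρ a * f) = a) {m : ℕ}
    {h : EntwinedCochain k A C m} (hh : h ∈ S.cyclicCochains m) :
    ∃ Z : EntwinedCycle.{u, v, w} S (m + 1),
      Z.IsVanishing ∧ Z.HasCharacter (hochschildD S.map m h) := by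
  -- Cyclicity passes to the pullback because `θ` is equivariant; `θ` need not be multiplicative.
  have hK : pullback (fun _ => θ) h ∈ SB.cyclicCochains m := by
    refine (NonUnitalEntwining.mem_cyclicCochains_iff _ _).2 ?_
    have hh' := (NonUnitalEntwining.mem_cyclicCochains_iff _ _).1 hh
    change (-1 : k) ^ m • rotate _ _ = _
    change (-1 : k) ^ m • rotate _ _ = _ at hh'
    rw [rotate_pullback_const hθ, ← map_smul]
    exact congrArg _ hh'
  have hF := entwine_connection hf hg
  refine ⟨cycle S hgf hf hg ρ hρ (m + 1) (trace SB (pullback (fun _ => θ) h))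
    (fun {i} hi => ?_) (trace_mul SB hK), cycle_isVanishing _ _ _ _ _ _ _ _ hS, fun c a => ?_⟩
  · obtain rfl : i = m := by omega
    exact trace_commutator hK hF hi
  · refine Eq.trans ?_ (trace_baseMulD hgf hf hg hK c fun i => ρ (a i)).symm
    -- `δ` is moved only across the pullback along the multiplicative map `ρ`; the compression and
    -- `θ` remain inside the cochain on `B`.
    have hp : h = pullback (fun _ => (ρ : A →ₗ[k] B))
        (pullback (fun _ => compression k f g) (pullback (fun _ => θ) h)) := by
      ext c a
      exact congrArg (h c) (funext fun i => (hθρ (a i)).symm)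
    conv_lhs => rw [hp, hochschildD_pullback hρ (map_mul ρ)]
    rfl

end TensorTower

/-- Every cyclic coboundary is the character of a vanishing cycle. -/
theorem EntwiningStructure.exists_cycle_of_mem_cyclicCoboundaries {k : Type*} [Field k]
    {A : Type u} [Ring A] [Algebra k A] {C : Type v} [AddCommGroup C] [Module k C] [Coalgebra k C]
    (S : EntwiningStructure k A C) {V : Type w} [AddCommGroup V] [Module k V]
    (σ : V ≃ₗ[k] ℕ → V) (φ : Module.End k V →ₗ[k] k) (hφ : φ 1 = 1) {n : ℕ}
    {g : EntwinedCochain k A C n} (hg : g ∈ S.cyclicCoboundaries n) :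
    ∃ Z : EntwinedCycle.{u, v, max u w} S n, Z.IsVanishing ∧ Z.HasCharacter g := by
  have h₁₁ := LinearEquiv.seqHead_mul_seqSingle (σ := σ)
  have h₁₂ := LinearEquiv.seqHead_mul_seqShift (σ := σ)
  have h₂₁ := LinearEquiv.seqTail_mul_seqSingle (σ := σ)
  have h₂₂ := LinearEquiv.seqTail_mul_seqShift (σ := σ)
  -- One needs `head · shift = 0` for `F² = 0` but `head · p · shift = 1` to recover `a`, so `p = 1`
  -- is impossible. With `p = (single + shift) tail`, idempotence follows from `tail (single +
  -- shift) = 1`.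
  let p : Module.End k V := σ.seqSingle * σ.seqTail + σ.seqShift * σ.seqTail
  have hp : p * p = p := by
    have h (x : Module.End k V) : σ.seqTail * (σ.seqSingle * x) = 0 := by
      rw [← mul_assoc, h₂₁, zero_mul]
    have h' (x : Module.End k V) : σ.seqTail * (σ.seqShift * x) = x := by
      rw [← mul_assoc, h₂₂, one_mul]
    simp only [p, add_mul, mul_add, mul_assoc, h, h', mul_zero, zero_add]
  have hp' : σ.seqHead * p * σ.seqShift = 1 := by
    rw [mul_add, ← mul_assoc, ← mul_assoc, h₁₁, h₁₂, zero_mul, add_zero, one_mul, h₂₂]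
  let ρ : A →ₙₐ[k] Module.End k V ⊗[k] A :=
    { TensorProduct.mk k (Module.End k V) A p with
      map_zero' := map_zero (TensorProduct.mk k (Module.End k V) A p)
      map_mul' := fun a b => by simp [hp] }
  have hρ : EntwineEquivariant S.map (S.extend (Module.End k V)).map
      (ρ : A →ₗ[k] Module.End k V ⊗[k] A) := S.equivariant_mk p
  have hS := S.extend_satisfiesVanishing σ
  cases n with
  | zero =>
    obtain rfl : g = 0 := hg
    exact TensorTower.zero_exists_cycle S hS ρ hρ 0
  | succ m =>
    obtain ⟨h, hh, rfl⟩ := hg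
    refine TensorTower.hochschildD_exists_cycle S hS
      (f := σ.seqShift ⊗ₜ[k] 1) (g := σ.seqHead ⊗ₜ[k] 1) ?_ (S.tmul_one_mem_invariants _)
      (S.tmul_one_mem_invariants _) ρ hρ (contractScalar A φ) (S.equivariant_contractScalar φ)
      (fun a => ?_) hh
    · rw [Algebra.TensorProduct.tmul_mul_tmul, h₁₂, TensorProduct.zero_tmul]
    · change contractScalar A φ (σ.seqHead ⊗ₜ[k] 1 * p ⊗ₜ[k] a * σ.seqShift ⊗ₜ[k] 1) = a
      rw [Algebra.TensorProduct.tmul_mul_tmul, Algebra.TensorProduct.tmul_mul_tmul, hp',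
        contractScalar_tmul, hφ, one_mul, mul_one, one_smul]

/-- The space of sequences is isomorphic to its countable power. -/
def sequenceEquiv (k : Type*) [Field k] :
    (ULift.{w} ℕ → k) ≃ₗ[k] (ℕ → ULift.{w} ℕ → k) :=
  (LinearEquiv.funCongrLeft k k ((Equiv.prodCongr (Equiv.refl ℕ) Equiv.ulift).trans
    (Nat.pairEquiv.trans Equiv.ulift.symm))).trans (LinearEquiv.curry k k ℕ (ULift.{w} ℕ))

end

theorem theorem7p6 {A : Type u} [Ring A] [Algebra ℂ A]
    {C : Type v} [AddCommGroup C] [Module ℂ C] [Coalgebra ℂ C]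
    (S : EntwiningStructure ℂ A C) (n : ℕ) (g : EntwinedCochain ℂ A C n)
    (hg : g ∈ S.cyclicCocycles n) :
    g ∈ S.cyclicCoboundaries n ↔
      ∃ Z : EntwinedCycle.{u, v, max u w} S n, Z.IsVanishing ∧ Z.HasCharacter g := by
  refine ⟨fun h => ?_, fun ⟨Z, hZ, hc⟩ => hc.mem_cyclicCoboundaries hZ⟩
  -- The functional on endomorphisms is a coordinate of the image of the constant sequence `1`,
  -- hence takes the value `1` at the identity.
  exact S.exists_cycle_of_mem_cyclicCoboundaries (sequenceEquiv.{w} ℂ)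
    (LinearMap.proj (ULift.up 0) ∘ₗ LinearMap.applyₗ (fun _ => (1 : ℂ))) rfl h
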